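/- Let $G$ be a $3$-dimensional Lie group whose Lie algebra $\mathfrak g$ is unimodular, i.e. $\mathrm{tr}(\mathrm{ad}_x)=0$ for all $x\in\mathfrak g$. Left-invariant tensor fields on $G$ are identified with tensors on $\mathfrak g$. **Definitions.** Let $H\in\Lambda^3\mathfrak g^*$ and $F\in\Lambda^2\mathfrak g^*$ be left-invariant forms with $dF=0$ and $dH=-F\wedge F$. The Courant algebroid $E_{H,F}=TG\oplus T^*G\oplus\mathbb R$ has scalar product $\langle X+\xi+l,\,Y+\eta+m\rangle=\tfrac12(\eta(X)+\xi(Y))+lm$, anchor the projection to $TG$, and Dorfman bracket $$[X+\xi+l,Y+\eta+m]=[X,Y]+\mathcal L_X\eta-i_Yd\xi+2m\,dl+i_Xi_YH-2(m\,i_XF-l\,i_YF)+X(m)-Y(l)+F(X,Y).$$ A $B_3$-generalized pseudo-Kähler structure $(\mathcal G,\mathcal F)$ on $E=E_{H,F}$ consists of an orthogonal involution $\mathcal G\in\Gamma(\mathrm{End}\,E)$ whose $(-1)$-eigenbundle $E_-$ is mapped isomorphically onto $TG$ by the anchor, and of a skew-symmetric $\mathcal F\in\Gamma(\mathrm{End}\,E)$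 commuting with $\mathcal G$ such that, at each point, $\mathcal F u_0=0$ and $\mathcal F^2=-\mathrm{Id}-\langle\cdot,u_0\rangle u_0$ for some $u_0$ with $\langle u_0,u_0\rangle=-1$, subject to the condition that the $i$-eigenbundles of $\mathcal F$ and of $\mathcal G\mathcal F$ in $E_{\mathbb C}$ are closed under the Dorfman bracket. It has left-invariant components $(g,J_+,J_-,X_+,X_-)$, where $g$ is a pseudo-Riemannian metric on $\mathfrak g$, $J_\pm\in\mathrm{End}(\mathfrak g)$ and $X_\pm\in\mathfrak g$, if the $\mp1$-eigenbundles of $\mathcal G$ are $E_-=\{X-gX\}$ and $E_+=\{X+gX+a\mid a\in\mathbb R\}$ and $$\mathcal F(X-gX)=J_-X-gJ_-X,\qquad u_-:=X_--gX_-\ \text{ satisfies }\ \mathcal F u_-=0,\ \langle u_-,u_-\rangle=-1,$$ $$\mathcal F(X+gX+a)=Y+gY-g(X_+,X),\qquad Y:=J_+X+aX_+ .$$ The operator $L\in\mathrm{End}(\mathfrak g)$ associated to $g$ (unique up to sign) is defined by $[u,v]=L(u\times v)$, where $\times$ is the cross product of $g$ and an orientation. **Theorem.** (a) Data $(H,F,g,J_+,J_-,X_+,X_-)$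 on $\mathfrak g$ are such that $E_{H,F}$ carries a $B_3$-generalized pseudo-Kähler structure with components $(g,J_+,J_-,X_+,X_-)$ and the operator $L$ associated to $g$ is diagonalizable if and only if $g$ is a (non-degenerate, possibly indefinite) metric, $H=0$, $F=0$, the endomorphisms $J_\pm$ are $g$-skew-symmetric with $J_\pm X_\pm=0$ and restrict to complex structures on $X_\pm^\perp$, and one of the following holds: i) there is a $g$-orthonormal basis $\{v_1,v_2,v_3\}$ of $\mathfrak g$ with $g(v_2,v_2)=1$ in which $$[v_1,v_2]=\epsilon_3\lambda v_3,\quad [v_3,v_1]=0,\quad [v_2,v_3]=\epsilon_1\lambda v_1,$$ where $\epsilon_i=g(v_i,v_i)\in\{\pm1\}$ and $\lambda\in\mathbb R\setminus\{0\}$, and $X_-=v_2$, $X_+=\pm X_-$; ii) $\mathfrak g$ is abelian and $g(X_+,X_+)=g(X_-,X_-)=1$. (b) Given $g$ and $X_\pm\in\mathfrak g$, there exist $H,F,J_\pm$ and a $B_3$-generalized pseudo-Kähler structure on $E_{H,F}$ with components $(g,J_+,J_-,X_+,X_-)$, and $L$ is diagonalizable, if and only if $g$ is a metric, i) or ii)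 holds, and $g$ is (positive or negative) definite on $X_+^\perp$ and on $X_-^\perp$. (c) If $\mathfrak g$ has a basis with brackets as in i), then $\mathfrak g\cong\mathfrak{iso}(2)=\mathfrak{so}(2)\ltimes\mathbb R^2$ when $\epsilon_1\epsilon_3=1$, and $\mathfrak g\cong\mathfrak{iso}(1,1)=\mathfrak{so}(1,1)\ltimes\mathbb R^2$ when $\epsilon_1\epsilon_3=-1$. -/

import Mathlib

open scoped Manifold ContDiff

noncomputable section

/-- A smooth Lie group is `C^3`, which is what Mathlib asks for in order to make the tangent space
at the identity a Lie algebra. -/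
instance instLieGroupMinSmoothnessThree {n : ℕ} {G : Type*} [TopologicalSpace G]
    [ChartedSpace (EuclideanSpace ℝ (Fin n)) G] [Group G] [h : LieGroup (𝓡 n) ∞ G] :
    LieGroup (𝓡 n) (minSmoothness ℝ 3) G :=
  LieGroup.of_le (n := ∞) (by
    rw [minSmoothness_of_isRCLikeNormedField]
    exact ENat.LEInfty.out)

namespace BnGeometry

/-! ### The Lie algebras `iso(2)` and `iso(1,1)` -/

section Iso

attribute [local instance] LieRing.ofAssociativeRing

variable {ι : Type*} [Fintype ι] [DecidableEq ι]

/-- The Lie algebra `so(η)` acts on the abelian Lie algebra `ℝ^ι` by derivations `v ↦ A v`. -/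
def vectorAction (η : Matrix ι ι ℝ) :
    skewAdjointMatricesLieSubalgebra η →ₗ⁅ℝ⁆ LieDerivation ℝ (ι → ℝ) (ι → ℝ) where
  toFun A :=
    { toLinearMap := Matrix.mulVecLin (A : Matrix ι ι ℝ)
      leibniz' := by
        intro a b
        simp [LieRing.of_associative_ring_bracket, mul_comm] }
  map_add' A B := by
    ext v i
    simp [Matrix.add_mulVec]
  map_smul' c A := by
    ext v i
    simp [Matrix.smul_mulVec]
  map_lie' := by
    intro A B
    ext v i
    simp [LieRing.of_associative_ring_bracket, Matrix.sub_mulVec, Matrix.mulVec_mulVec,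
      LieDerivation.commutator_apply]

/-- `iso(2) = so(2) ⋉ ℝ²`, the Lie algebra of Killing fields of the Euclidean plane. -/
abbrev Iso2 : Type :=
  LieAlgebra.SemiDirectSum (R := ℝ) (Fin 2 → ℝ)
    (skewAdjointMatricesLieSubalgebra (1 : Matrix (Fin 2) (Fin 2) ℝ)) (vectorAction 1)

/-- `iso(1,1) = so(1,1) ⋉ ℝ²`, the Lie algebra of Killing fields of the Minkowski plane. -/
abbrev Iso11 : Type :=
  LieAlgebra.SemiDirectSum (R := ℝ) (Fin 2 → ℝ)
    (skewAdjointMatricesLieSubalgebra (Matrix.diagonal ![(1 : ℝ), -1]))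
    (vectorAction (Matrix.diagonal ![(1 : ℝ), -1]))

end Iso

section Courant

variable (n : ℕ) (G : Type*) [TopologicalSpace G] [ChartedSpace (EuclideanSpace ℝ (Fin n)) G]
  [Group G]

/-- The fibre of `E = TG ⊕ T*G ⊕ ℝ`, where `TG` is identified with `G × 𝔤` by left translations:
`(x, ξ, l)` at the point `p` stands for `dL_p x + ξ ∘ (dL_p)⁻¹ + l`. -/
abbrev Fiber : Type _ :=
  GroupLieAlgebra (𝓡 n) G × Module.Dual ℝ (GroupLieAlgebra (𝓡 n) G) × ℝ

variable {n G}

/-- The scalar product `⟨X + ξ + l, Y + η + m⟩ = (η(X) + ξ(Y)) / 2 + l m`. -/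
def pairing (u v : Fiber n G) : ℝ :=
  (v.2.1 u.1 + u.2.1 v.1) / 2 + u.2.2 * v.2.2

/-- Smoothness of a section of `E`: the coefficients of its components in the global frames of
left-invariant vector fields and left-invariant one-forms are smooth. -/
structure IsSmoothSection (s : G → Fiber n G) : Prop where
  vec : ∀ φ : Module.Dual ℝ (GroupLieAlgebra (𝓡 n) G),
    ContMDiff (𝓡 n) 𝓘(ℝ, ℝ) ∞ (fun p => φ (s p).1)
  form : ∀ z : GroupLieAlgebra (𝓡 n) G, ContMDiff (𝓡 n) 𝓘(ℝ, ℝ) ∞ (fun p => (s p).2.1 z)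
  scal : ContMDiff (𝓡 n) 𝓘(ℝ, ℝ) ∞ (fun p => (s p).2.2)

variable (n G) in
/-- The space `Γ(E)` of smooth sections of `E`. -/
abbrev SmoothSection : Type _ := {s : G → Fiber n G // IsSmoothSection s}

/-- The vector field on `G` with left trivialization `X : G → 𝔤`. -/
def toVectorField (X : G → GroupLieAlgebra (𝓡 n) G) (p : G) : TangentSpace (𝓡 n) p :=
  mulInvariantVectorField (X p) p

/-- The left trivialization `p ↦ (dL_p)⁻¹ (V p)` of a vector field `V` on `G`. -/
def leftTriv (V : Π p : G, TangentSpace (𝓡 n) p) (p : G) : GroupLieAlgebra (𝓡 n) G :=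
  VectorField.mpullback (𝓡 n) (𝓡 n) (p * ·) V 1

/-- The Lie bracket of vector fields on `G`, in left trivializations. -/
def fieldBracket (X Y : G → GroupLieAlgebra (𝓡 n) G) : G → GroupLieAlgebra (𝓡 n) G :=
  leftTriv (VectorField.mlieBracket (𝓡 n) (toVectorField X) (toVectorField Y))

/-- The derivative of the function `f` at `p` in the direction of the tangent vector `dL_p x`. -/
def dirDeriv (x : GroupLieAlgebra (𝓡 n) G) (f : G → ℝ) (p : G) : ℝ :=
  mfderiv (𝓡 n) 𝓘(ℝ, ℝ) f p (mulInvariantVectorField x p)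

/-- `(L_X η)(z) = X(η(z)) - η([X, z])` at `p`, where `z` is extended left-invariantly. -/
def lieDerivForm (X : G → GroupLieAlgebra (𝓡 n) G)
    (η : G → Module.Dual ℝ (GroupLieAlgebra (𝓡 n) G)) (p : G)
    (z : GroupLieAlgebra (𝓡 n) G) : ℝ :=
  dirDeriv (X p) (fun q => η q z) p - η p (fieldBracket X (fun _ => z) p)

/-- `(i_Y dξ)(z) = Y(ξ(z)) - z(ξ(Y)) - ξ([Y, z])` at `p`, where `z` is extended
left-invariantly. -/
def contractD (Y : G → GroupLieAlgebra (𝓡 n) G)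
    (ξ : G → Module.Dual ℝ (GroupLieAlgebra (𝓡 n) G)) (p : G)
    (z : GroupLieAlgebra (𝓡 n) G) : ℝ :=
  dirDeriv (Y p) (fun q => ξ q z) p - dirDeriv z (fun q => ξ q (Y q)) p
    - ξ p (fieldBracket Y (fun _ => z) p)

/-- The value on `z` of the one-form component of the Dorfman bracket of the sections
`u = X + ξ + l` and `v = Y + η + m`, namely of
`L_X η - i_Y dξ + 2 m dl + i_X i_Y H - 2 (m i_X F - l i_Y F)`. Here `H` and `F` are left-invariant
and given by forms on the Lie algebra, and `(i_X i_Y H)(z) = H(Y, X, z)`. -/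
def dorfmanForm (H : GroupLieAlgebra (𝓡 n) G [⋀^Fin 3]→ₗ[ℝ] ℝ)
    (F : GroupLieAlgebra (𝓡 n) G [⋀^Fin 2]→ₗ[ℝ] ℝ) (u v : G → Fiber n G) (p : G)
    (z : GroupLieAlgebra (𝓡 n) G) : ℝ :=
  lieDerivForm (fun q => (u q).1) (fun q => (v q).2.1) p z
    - contractD (fun q => (v q).1) (fun q => (u q).2.1) p z
    + 2 * (v p).2.2 * dirDeriv z (fun q => (u q).2.2) p
    + H ![(v p).1, (u p).1, z]
    - 2 * ((v p).2.2 * F ![(u p).1, z] - (u p).2.2 * F ![(v p).1, z])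

section Linearity

variable [LieGroup (𝓡 n) ∞ G]

lemma dirDeriv_add_left (x y : GroupLieAlgebra (𝓡 n) G) (f : G → ℝ) (p : G) :
    dirDeriv (x + y) f p = dirDeriv x f p + dirDeriv y f p := by
  unfold dirDeriv
  rw [mulInvariantVectorField_add]
  exact map_add (mfderiv (𝓡 n) 𝓘(ℝ, ℝ) f p) _ _

lemma dirDeriv_smul_left (c : ℝ) (x : GroupLieAlgebra (𝓡 n) G) (f : G → ℝ) (p : G) :
    dirDeriv (c • x) f p = c * dirDeriv x f p := by
  unfold dirDeriv
  rw [mulInvariantVectorField_smul]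
  exact map_smul (mfderiv (𝓡 n) 𝓘(ℝ, ℝ) f p) c _

lemma dirDeriv_add_right (x : GroupLieAlgebra (𝓡 n) G) {f h : G → ℝ} {p : G}
    (hf : MDifferentiableAt (𝓡 n) 𝓘(ℝ, ℝ) f p) (hh : MDifferentiableAt (𝓡 n) 𝓘(ℝ, ℝ) h p) :
    dirDeriv x (fun q => f q + h q) p = dirDeriv x f p + dirDeriv x h p := by
  unfold dirDeriv
  have := mfderiv_add hf hh
  change mfderiv (𝓡 n) 𝓘(ℝ, ℝ) (f + h) p _ = _
  rw [this]
  rfl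

lemma dirDeriv_smul_right (x : GroupLieAlgebra (𝓡 n) G) {f : G → ℝ} {p : G} (c : ℝ)
    (hf : MDifferentiableAt (𝓡 n) 𝓘(ℝ, ℝ) f p) :
    dirDeriv x (fun q => c * f q) p = c * dirDeriv x f p := by
  unfold dirDeriv
  have := const_smul_mfderiv hf c
  change mfderiv (𝓡 n) 𝓘(ℝ, ℝ) (c • f) p _ = _
  rw [this]
  rfl

lemma fieldBracket_add_right (X : G → GroupLieAlgebra (𝓡 n) G)
    (z w : GroupLieAlgebra (𝓡 n) G) (p : G) :
    fieldBracket X (fun _ => z + w) p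
      = fieldBracket X (fun _ => z) p + fieldBracket X (fun _ => w) p := by
  have hadd : toVectorField (fun _ : G => z + w)
      = toVectorField (fun _ : G => z) + toVectorField (fun _ : G => w) :=
    mulInvariantVectorField_add z w
  unfold fieldBracket leftTriv
  simp only [VectorField.mpullback_apply]
  rw [hadd, VectorField.mlieBracket_add_right]
  · exact map_add _ _ _
  · exact mdifferentiableAt_mulInvariantVectorField z
  · exact mdifferentiableAt_mulInvariantVectorField w

lemma fieldBracket_smul_right (X : G → GroupLieAlgebra (𝓡 n) G) (c : ℝ)
    (z : GroupLieAlgebra (𝓡 n) G) (p : G) :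
    fieldBracket X (fun _ => c • z) p = c • fieldBracket X (fun _ => z) p := by
  have hsmul : toVectorField (fun _ : G => c • z) = c • toVectorField (fun _ : G => z) :=
    mulInvariantVectorField_smul c z
  unfold fieldBracket leftTriv
  simp only [VectorField.mpullback_apply]
  rw [hsmul, VectorField.mlieBracket_const_smul_right]
  · exact map_smul _ c _
  · exact mdifferentiableAt_mulInvariantVectorField z

end Linearity

lemma alternating_two_add {V : Type*} [AddCommGroup V] [Module ℝ V] (F : V [⋀^Fin 2]→ₗ[ℝ] ℝ)
    (x z w : V) : F ![x, z + w] = F ![x, z] + F ![x, w] := by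
  have key : ∀ y : V, Function.update ![x, 0] 1 y = ![x, y] := by
    intro y
    ext i
    fin_cases i <;> simp
  have h := F.map_update_add ![x, 0] 1 z w
  rwa [key, key, key] at h

lemma alternating_two_smul {V : Type*} [AddCommGroup V] [Module ℝ V] (F : V [⋀^Fin 2]→ₗ[ℝ] ℝ)
    (c : ℝ) (x z : V) : F ![x, c • z] = c * F ![x, z] := by
  have key : ∀ y : V, Function.update ![x, 0] 1 y = ![x, y] := by
    intro y
    ext i
    fin_cases i <;> simp
  have h := F.map_update_smul ![x, 0] 1 c z
  rwa [key, key] at h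

lemma alternating_three_add {V : Type*} [AddCommGroup V] [Module ℝ V]
    (H : V [⋀^Fin 3]→ₗ[ℝ] ℝ) (x y z w : V) : H ![x, y, z + w] = H ![x, y, z] + H ![x, y, w] := by
  have key : ∀ a : V, Function.update ![x, y, 0] 2 a = ![x, y, a] := by
    intro a
    ext i
    fin_cases i <;> simp
  have h := H.map_update_add ![x, y, 0] 2 z w
  rwa [key, key, key] at h

lemma alternating_three_smul {V : Type*} [AddCommGroup V] [Module ℝ V]
    (H : V [⋀^Fin 3]→ₗ[ℝ] ℝ) (c : ℝ) (x y z : V) : H ![x, y, c • z] = c * H ![x, y, z] := by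
  have key : ∀ a : V, Function.update ![x, y, 0] 2 a = ![x, y, a] := by
    intro a
    ext i
    fin_cases i <;> simp
  have h := H.map_update_smul ![x, y, 0] 2 c z
  rwa [key, key] at h

section Dorfman

variable [LieGroup (𝓡 n) ∞ G]

/-- The Dorfman bracket on `Γ(E)` twisted by `(H, F)`:
`[X + ξ + l, Y + η + m] = [X, Y] + L_X η - i_Y dξ + 2 m dl + i_X i_Y H - 2 (m i_X F - l i_Y F)
+ X(m) - Y(l) + F(X, Y)`. -/
def dorfman (H : GroupLieAlgebra (𝓡 n) G [⋀^Fin 3]→ₗ[ℝ] ℝ)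
    (F : GroupLieAlgebra (𝓡 n) G [⋀^Fin 2]→ₗ[ℝ] ℝ) (u v : SmoothSection n G) (p : G) :
    Fiber n G :=
  (fieldBracket (fun q => (u.1 q).1) (fun q => (v.1 q).1) p,
   { toFun := dorfmanForm H F u.1 v.1 p
     map_add' := by
       intro z w
       have hu : ∀ z, MDifferentiableAt (𝓡 n) 𝓘(ℝ, ℝ) (fun q => (u.1 q).2.1 z) p := fun z =>
         (u.2.form z).mdifferentiableAt (by simp)
       have hv : ∀ z, MDifferentiableAt (𝓡 n) 𝓘(ℝ, ℝ) (fun q => (v.1 q).2.1 z) p := fun z =>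
         (v.2.form z).mdifferentiableAt (by simp)
       simp only [dorfmanForm, lieDerivForm, contractD, map_add, fieldBracket_add_right,
         dirDeriv_add_left, alternating_two_add, alternating_three_add]
       rw [dirDeriv_add_right _ (hu z) (hu w), dirDeriv_add_right _ (hv z) (hv w)]
       ring
     map_smul' := by
       intro c z
       have hu : MDifferentiableAt (𝓡 n) 𝓘(ℝ, ℝ) (fun q => (u.1 q).2.1 z) p :=
         (u.2.form z).mdifferentiableAt (by simp)
       have hv : MDifferentiableAt (𝓡 n) 𝓘(ℝ, ℝ) (fun q => (v.1 q).2.1 z) p :=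
         (v.2.form z).mdifferentiableAt (by simp)
       simp only [dorfmanForm, lieDerivForm, contractD, map_smul, smul_eq_mul,
         fieldBracket_smul_right, dirDeriv_smul_left, alternating_two_smul,
         alternating_three_smul, RingHom.id_apply]
       rw [dirDeriv_smul_right _ c hu, dirDeriv_smul_right _ c hv]
       ring },
   dirDeriv (u.1 p).1 (fun q => (v.1 q).2.2) p - dirDeriv (v.1 p).1 (fun q => (u.1 q).2.2) p
     + F ![(u.1 p).1, (v.1 p).1])

/-- The left-invariant forms given by `H` and `F` define a Courant algebroid `E_{H,F}` of type
`B_n`: `dF = 0` and `dH = - F ∧ F`. The exterior derivatives of left-invariant forms are expressed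
by the Lie bracket on the Lie algebra. -/
structure IsCourantData (H : GroupLieAlgebra (𝓡 n) G [⋀^Fin 3]→ₗ[ℝ] ℝ)
    (F : GroupLieAlgebra (𝓡 n) G [⋀^Fin 2]→ₗ[ℝ] ℝ) : Prop where
  closed : ∀ x y z : GroupLieAlgebra (𝓡 n) G,
    -F ![⁅x, y⁆, z] + F ![⁅x, z⁆, y] - F ![⁅y, z⁆, x] = 0
  dH_eq : ∀ x y z w : GroupLieAlgebra (𝓡 n) G,
    -H ![⁅x, y⁆, z, w] + H ![⁅x, z⁆, y, w] - H ![⁅x, w⁆, y, z] - H ![⁅y, z⁆, x, w]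
        + H ![⁅y, w⁆, x, z] - H ![⁅z, w⁆, x, y]
      = -(2 * (F ![x, y] * F ![z, w] - F ![x, z] * F ![y, w] + F ![x, w] * F ![y, z]))

/-- A field `A` of endomorphisms of the fibres of `E` is smooth, that is `A ∈ Γ(End E)`. -/
def IsSmoothEnd (A : G → Module.End ℝ (Fiber n G)) : Prop :=
  ∀ s : G → Fiber n G, IsSmoothSection s → IsSmoothSection (fun p => A p (s p))

/-- `𝒢` is the endomorphism `𝒢^end` of an (admissible) generalized metric on `E`: it is an
orthogonal involution, and the anchor maps its `(-1)`-eigenbundle `E₋` isomorphically to `TG`.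
Orthogonality says that the scalar product is non-degenerate on `E₋` and that the
`1`-eigenbundle `E₊` is the orthogonal complement of `E₋`. -/
structure IsGeneralizedMetric (𝒢 : G → Module.End ℝ (Fiber n G)) : Prop where
  smooth : IsSmoothEnd 𝒢
  invol : ∀ p u, 𝒢 p (𝒢 p u) = u
  orth : ∀ p u v, pairing (𝒢 p u) (𝒢 p v) = pairing u v
  admissible : ∀ p (x : GroupLieAlgebra (𝓡 n) G), ∃! u : Fiber n G, 𝒢 p u = -u ∧ u.1 = x

/-- `𝓕` is (the endomorphism of) a `B_n`-generalized almost complex structure: it is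
skew-symmetric, it annihilates some `u₀` with `⟨u₀, u₀⟩ = (-1)^n`, and
`𝓕² = -Id + (-1)^n ⟨·, u₀⟩ u₀`. -/
structure IsAlmostComplex (𝓕 : G → Module.End ℝ (Fiber n G)) : Prop where
  smooth : IsSmoothEnd 𝓕
  skew : ∀ p u v, pairing (𝓕 p u) v = -pairing u (𝓕 p v)
  square : ∀ p, ∃ u₀ : Fiber n G, pairing u₀ u₀ = (-1) ^ n ∧ 𝓕 p u₀ = 0 ∧
    ∀ u, 𝓕 p (𝓕 p u) = -u + ((-1) ^ n * pairing u u₀) • u₀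

/-- The complex section `a + i b` of `E_ℂ` takes values in the `i`-eigenbundle `L` of `𝓕`. -/
def IsEigenSection (𝓕 : G → Module.End ℝ (Fiber n G)) (a b : G → Fiber n G) : Prop :=
  ∀ p, 𝓕 p (a p) = -b p ∧ 𝓕 p (b p) = a p

/-- The space of smooth sections of the `i`-eigenbundle of `𝓕` is closed under the complex bilinear
extension `[a + i b, c + i d] = ([a, c] - [b, d]) + i ([a, d] + [b, c])` of the Dorfman bracket. -/
def IsIntegrable (H : GroupLieAlgebra (𝓡 n) G [⋀^Fin 3]→ₗ[ℝ] ℝ)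
    (F : GroupLieAlgebra (𝓡 n) G [⋀^Fin 2]→ₗ[ℝ] ℝ) (𝓕 : G → Module.End ℝ (Fiber n G)) : Prop :=
  ∀ a b c d : SmoothSection n G, IsEigenSection 𝓕 a.1 b.1 → IsEigenSection 𝓕 c.1 d.1 →
    IsEigenSection 𝓕 (fun p => dorfman H F a c p - dorfman H F b d p)
      (fun p => dorfman H F a d p + dorfman H F b c p)

/-- `𝓕` is a `B_n`-generalized complex structure on `E_{H,F}`. -/
def IsGeneralizedComplex (H : GroupLieAlgebra (𝓡 n) G [⋀^Fin 3]→ₗ[ℝ] ℝ)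
    (F : GroupLieAlgebra (𝓡 n) G [⋀^Fin 2]→ₗ[ℝ] ℝ) (𝓕 : G → Module.End ℝ (Fiber n G)) : Prop :=
  IsAlmostComplex 𝓕 ∧ IsIntegrable H F 𝓕

/-- `(𝒢, 𝓕)` is a `B_n`-generalized pseudo-Kähler structure on the Courant algebroid `E_{H,F}`
twisted by the left-invariant forms `H` and `F`. -/
structure IsPseudoKahler (H : GroupLieAlgebra (𝓡 n) G [⋀^Fin 3]→ₗ[ℝ] ℝ)
    (F : GroupLieAlgebra (𝓡 n) G [⋀^Fin 2]→ₗ[ℝ] ℝ) (𝒢 𝓕 : G → Module.End ℝ (Fiber n G)) :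
    Prop where
  courant : IsCourantData H F
  metric : IsGeneralizedMetric 𝒢
  comm : ∀ p u, 𝒢 p (𝓕 p u) = 𝓕 p (𝒢 p u)
  complex₁ : IsGeneralizedComplex H F 𝓕
  complex₂ : IsGeneralizedComplex H F (fun p => 𝒢 p * 𝓕 p)

end Dorfman

/-! ### Components, for odd `n` -/

section Components

/-- A (pseudo-Riemannian) metric: a non-degenerate symmetric bilinear form. -/
def IsMetric {V : Type*} [AddCommGroup V] [Module ℝ V] (g : V →ₗ[ℝ] V →ₗ[ℝ] ℝ) : Prop :=
  (∀ x y, g x y = g y x) ∧ ∀ x, (∀ y, g x y = 0) → x = 0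

/-- The left-invariant tensor fields on `G` given by the tensors `(g, J₊, J₋, X₊, X₋)` on the Lie
algebra are the components of `(𝒢, 𝓕)`. That is, `𝒢` is in standard form,
`E₋ = {X - g X}` and `E₊ = {X + g X + a}`; under `E₋ ≅ TG` the restriction of `𝓕` is `J₋`, and
`X₋` is the image of a generator `u₋` of `Ker 𝓕` with `⟨u₋, u₋⟩ = -1`; and under
`E₊ ≅ TG ⊕ ℝ` the restriction of `𝓕` is `X + a ↦ (J₊ X + a X₊) - g(X₊, X)`. -/
structure HasComponents (𝒢 𝓕 : G → Module.End ℝ (Fiber n G))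
    (g : GroupLieAlgebra (𝓡 n) G →ₗ[ℝ] GroupLieAlgebra (𝓡 n) G →ₗ[ℝ] ℝ)
    (Jp Jm : Module.End ℝ (GroupLieAlgebra (𝓡 n) G)) (Xp Xm : GroupLieAlgebra (𝓡 n) G) :
    Prop where
  metric : IsMetric g
  minus : ∀ p x, 𝒢 p (x, -g x, 0) = -(x, -g x, 0)
  plus : ∀ p x a, 𝒢 p (x, g x, a) = (x, g x, a)
  endo_minus : ∀ p x, 𝓕 p (x, -g x, 0) = (Jm x, -g (Jm x), 0)
  kernel : ∀ p, 𝓕 p (Xm, -g Xm, 0) = 0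
  norm : pairing ((Xm, -g Xm, 0) : Fiber n G) (Xm, -g Xm, 0) = -1
  endo_plus : ∀ p x a,
    𝓕 p (x, g x, a) = (Jp x + a • Xp, g (Jp x + a • Xp), -g Xp x)

/-- `J` is `g`-skew-symmetric, `J X = 0`, and `J` is a complex structure on `X^⊥`. -/
structure IsTransverseComplex {V : Type*} [AddCommGroup V] [Module ℝ V]
    (g : V →ₗ[ℝ] V →ₗ[ℝ] ℝ) (J : Module.End ℝ V) (X : V) : Prop where
  skew : ∀ x y, g (J x) y = -g x (J y)
  kernel : J X = 0
  square : ∀ x, g X x = 0 → J (J x) = -x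

/-- The restriction of `g` to `X^⊥` is positive or negative definite. -/
def IsDefiniteOnPerp {V : Type*} [AddCommGroup V] [Module ℝ V]
    (g : V →ₗ[ℝ] V →ₗ[ℝ] ℝ) (X : V) : Prop :=
  (∀ x, g X x = 0 → x ≠ 0 → 0 < g x x) ∨ (∀ x, g X x = 0 → x ≠ 0 → g x x < 0)

end Components

end Courant

/-! ### Three-dimensional Lie algebras with a metric -/

section Three

variable {V : Type*} [LieRing V] [LieAlgebra ℝ V]

variable (V) in
/-- A Lie algebra is unimodular if `tr (ad x) = 0` for all `x`. -/
def IsUnimodular : Prop :=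
  ∀ x : V, LinearMap.trace ℝ V (LieAlgebra.ad ℝ V x) = 0

/-- `v` is a `g`-orthonormal basis: `g (v i) (v j) = ± δ_ij`. -/
def IsOrthonormalBasis (g : V →ₗ[ℝ] V →ₗ[ℝ] ℝ) (v : Module.Basis (Fin 3) ℝ V) : Prop :=
  (∀ i j, i ≠ j → g (v i) (v j) = 0) ∧ ∀ i, g (v i) (v i) = 1 ∨ g (v i) (v i) = -1

/-- `L` is a canonical operator of `(V, g)`: `[u, v] = L (u × v)`, where the cross product is the
one determined by `g` and an orientation, `g (u × v, w) = vol (u, v, w)` for the metric volume form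
`vol` of the orientation. -/
def IsCanonicalOperator (g : V →ₗ[ℝ] V →ₗ[ℝ] ℝ) (L : Module.End ℝ V) : Prop :=
  ∃ (vol : V [⋀^Fin 3]→ₗ[ℝ] ℝ) (cross : V → V → V),
    (∀ v : Module.Basis (Fin 3) ℝ V, IsOrthonormalBasis g v → vol v = 1 ∨ vol v = -1) ∧
    (∀ x y z, g (cross x y) z = vol ![x, y, z]) ∧
    ∀ x y, ⁅x, y⁆ = L (cross x y)

/-- There is a basis of eigenvectors of `L`. -/
def IsDiagonalizable (L : Module.End ℝ V) : Prop :=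
  ∃ (b : Module.Basis (Fin 3) ℝ V) (μ : Fin 3 → ℝ), ∀ i, L (b i) = μ i • b i

/-- `v = (v₁, v₂, v₃)` is a `g`-orthonormal basis with `g(v₂, v₂) = 1`, in which the Lie bracket is
`[v₁, v₂] = ε₃ r v₃`, `[v₃, v₁] = 0`, `[v₂, v₃] = ε₁ r v₁`, where `ε_i = g(v_i, v_i)` and
`r ≠ 0`. -/
structure IsAdaptedBasis (g : V →ₗ[ℝ] V →ₗ[ℝ] ℝ) (v : Module.Basis (Fin 3) ℝ V) (r : ℝ) :
    Prop where
  orthonormal : IsOrthonormalBasis g v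
  norm_two : g (v 1) (v 1) = 1
  ne_zero : r ≠ 0
  lie_one_two : ⁅v 0, v 1⁆ = (g (v 2) (v 2) * r) • v 2
  lie_three_one : ⁅v 2, v 0⁆ = 0
  lie_two_three : ⁅v 1, v 2⁆ = (g (v 0) (v 0) * r) • v 0

/-- The non-abelian case of the classification: `X₋ = v₂` and `X₊ = ± X₋` for an adapted
basis. -/
def CaseNonabelian (g : V →ₗ[ℝ] V →ₗ[ℝ] ℝ) (Xp Xm : V) : Prop :=
  ∃ (v : Module.Basis (Fin 3) ℝ V) (r : ℝ), IsAdaptedBasis g v r ∧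
    Xm = v 1 ∧ (Xp = Xm ∨ Xp = -Xm)

/-- The abelian case of the classification: `X₊` and `X₋` are unit vectors. -/
def CaseAbelian (g : V →ₗ[ℝ] V →ₗ[ℝ] ℝ) (Xp Xm : V) : Prop :=
  (∀ x y : V, ⁅x, y⁆ = 0) ∧ g Xp Xp = 1 ∧ g Xm Xm = 1

end Three

end BnGeometry

end

set_option linter.unusedSectionVars false

noncomputable section

namespace BnGeometry

/-! ### Calculus of vector-valued functions and vector fields in the left trivialization. -/

section Geometry

variable {n : ℕ} {G : Type*} [TopologicalSpace G] [ChartedSpace (EuclideanSpace ℝ (Fin n)) G]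
  [Group G] [LieGroup (𝓡 n) ∞ G]

/-! Necessity. Only brackets of left-invariant sections are needed. On `E₊` the structures `𝓕` and
`𝒢𝓕` agree, on `E₋` they differ by a sign. Comparing the integrability of both gives two facts. The
bracket of a section of `E₊` with one of `E₋` is orthogonal to `u₋` (`IsPseudoKahler.killing`),
which says that `X₋` is Killing, that `i_{X₋} F = 0`, and that `H` contracted with `X₋` is fixed by
`g(X₋, [·,·])`. The bracket of two `i`-eigensections in `E₊` stays in `E₊`, which applied to `X₊`
gives `IsPseudoKahler.torsion_plus`.

Unimodularity makes `L` symmetric (`canonicalOperator_symm`), so a diagonalizable `L` has a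
`g`-orthonormal eigenbasis, a Milnor basis `[v_{i+1}, v_{i+2}] = ε_i l_i v_i`
(`exists_milnorBasis`). In such a basis the two facts become polynomial equations in the coordinates
of `X₊` and `X₋`, the `l_i`, `H` and `F`. First `F = 0` (`F_eq_zero`, whose algebra is
`cyclic_system`). What is left is linear in the `l_i` and forces `H = 0`, and either all `l_i`
vanish or `X₊` and `X₋` both lie along one `v_i` with `l_i = 0` and the other two equal
(`cyclic_classification`, `classification`).

Sufficiency. In both cases `[x, y] = φ(x) D y - φ(y) D x` for a covector `φ` and a `g`-skew `D`
commuting with `J₊` and `J₋` and killing `X₊`: take `D = ad v₂` and `φ = g(v₂, ·)`, or zero. Then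
`∇_z = z + φ(z) D` is a torsion-free metric connection for which `𝒢` and `𝓕` are parallel, and the
untwisted Dorfman bracket can be written with `∇` (`dorfman_zero_eq`). Integrability follows at once
(`isIntegrable_const`, `exists_isPseudoKahler`).

For (b), a transverse complex structure acts on the plane `X^⊥` as a rotation, so it exists exactly
when `g` is definite there. For (c), `v₁` and `v₃` span the translations, and `v₂` acts on them by a
generator of `so(2)` or `so(1,1)` (`IsAdaptedBasis.nonempty_equiv`). -/

instance instFiniteDimensionalGroupLieAlgebra :
    FiniteDimensional ℝ (GroupLieAlgebra (𝓡 n) G) :=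
  inferInstanceAs (FiniteDimensional ℝ (EuclideanSpace ℝ (Fin n)))

lemma finrank_groupLieAlgebra : Module.finrank ℝ (GroupLieAlgebra (𝓡 n) G) = n :=
  finrank_euclideanSpace_fin (𝕜 := ℝ) (n := n)

variable {W : Type*} [AddCommGroup W] [Module ℝ W] [FiniteDimensional ℝ W]

variable (n) in
/-- All coordinates of the vector-valued function `s` are differentiable at `p`. -/
def CoordDifferentiableAt (s : G → W) (p : G) : Prop :=
  ∀ ψ : Module.Dual ℝ W, MDifferentiableAt (𝓡 n) 𝓘(ℝ, ℝ) (fun q => ψ (s q)) p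

/-- The derivative of a vector-valued function `s` in the direction of `dL_p x`. -/
def secDeriv (x : GroupLieAlgebra (𝓡 n) G) (s : G → W) (p : G) : W :=
  ∑ i, dirDeriv x (fun q => (Module.finBasis ℝ W).coord i (s q)) p • Module.finBasis ℝ W i

lemma dirDeriv_const (x : GroupLieAlgebra (𝓡 n) G) (c : ℝ) (p : G) :
    dirDeriv x (fun _ => c) p = 0 := by
  unfold dirDeriv
  rw [mfderiv_const]
  rfl

lemma dirDeriv_mul_const (x : GroupLieAlgebra (𝓡 n) G) {f : G → ℝ} {p : G} (c : ℝ)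
    (hf : MDifferentiableAt (𝓡 n) 𝓘(ℝ, ℝ) f p) :
    dirDeriv x (fun q => f q * c) p = dirDeriv x f p * c := by
  simp only [mul_comm _ c]
  exact dirDeriv_smul_right x c hf

/-- Differentiability is proved together with the formula because the induction step for the
derivative needs it for the partial sum. -/
lemma dirDeriv_sum {ι : Type*} (t : Finset ι) (x : GroupLieAlgebra (𝓡 n) G) {f : ι → G → ℝ}
    {p : G} (hf : ∀ i, MDifferentiableAt (𝓡 n) 𝓘(ℝ, ℝ) (f i) p) :
    MDifferentiableAt (𝓡 n) 𝓘(ℝ, ℝ) (fun q => ∑ i ∈ t, f i q) p ∧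
    dirDeriv x (fun q => ∑ i ∈ t, f i q) p = ∑ i ∈ t, dirDeriv x (f i) p := by
  classical
  induction t using Finset.induction_on with
  | empty => simpa [dirDeriv_const] using mdifferentiableAt_const
  | insert a t ha ih =>
    simp only [Finset.sum_insert ha]
    refine ⟨(hf a).add ih.1, ?_⟩
    have := mfderiv_add (hf a) ih.1
    rw [← ih.2]
    unfold dirDeriv
    change mfderiv (𝓡 n) 𝓘(ℝ, ℝ) (f a + fun q => ∑ i ∈ t, f i q) p _ = _
    rw [this]
    rfl

/-- This frees `secDeriv` from the basis chosen in its definition: it can be tested against any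
functional. -/
lemma apply_secDeriv (x : GroupLieAlgebra (𝓡 n) G) {s : G → W} {p : G}
    (hs : CoordDifferentiableAt n s p) (ψ : Module.Dual ℝ W) :
    ψ (secDeriv x s p) = dirDeriv x (fun q => ψ (s q)) p := by
  have h : (fun q => ψ (s q))
      = fun q => ∑ i, (Module.finBasis ℝ W).coord i (s q) * ψ (Module.finBasis ℝ W i) := by
    ext q
    have := congrArg ψ ((Module.finBasis ℝ W).sum_repr (s q))
    simpa only [map_sum, map_smul, smul_eq_mul, Module.Basis.coord_apply] using this.symm
  have hd (i) : MDifferentiableAt (𝓡 n) 𝓘(ℝ, ℝ) (fun q => (Module.finBasis ℝ W).coord i (s q)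
      * ψ (Module.finBasis ℝ W i)) p := (hs _).mul mdifferentiableAt_const
  rw [h, (dirDeriv_sum Finset.univ x hd).2]
  simp only [secDeriv, map_sum, map_smul, smul_eq_mul]
  refine Finset.sum_congr rfl fun i _ => ?_
  rw [dirDeriv_mul_const]
  exact hs _

lemma eq_of_dual_apply_eq {v w : W} (h : ∀ ψ : Module.Dual ℝ W, ψ v = ψ w) : v = w := by
  rw [← sub_eq_zero, ← Module.forall_dual_apply_eq_zero_iff ℝ]
  intro ψ
  rw [map_sub, h, sub_self]

lemma CoordDifferentiableAt.comp {W' : Type*} [AddCommGroup W'] [Module ℝ W'] {s : G → W} {p : G}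
    (hs : CoordDifferentiableAt n s p) (A : W →ₗ[ℝ] W') :
    CoordDifferentiableAt n (fun q => A (s q)) p := fun ψ => hs (ψ ∘ₗ A)

lemma map_secDeriv {W' : Type*} [AddCommGroup W'] [Module ℝ W'] [FiniteDimensional ℝ W']
    (x : GroupLieAlgebra (𝓡 n) G) {s : G → W} {p : G} (hs : CoordDifferentiableAt n s p)
    (A : W →ₗ[ℝ] W') : A (secDeriv x s p) = secDeriv x (fun q => A (s q)) p := by
  apply eq_of_dual_apply_eq
  intro ψ
  rw [apply_secDeriv x (hs.comp A)]
  exact apply_secDeriv x hs (ψ ∘ₗ A)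

lemma secDeriv_add_left (x y : GroupLieAlgebra (𝓡 n) G) (s : G → W) (p : G) :
    secDeriv (x + y) s p = secDeriv x s p + secDeriv y s p := by
  simp only [secDeriv, dirDeriv_add_left, add_smul, Finset.sum_add_distrib]



lemma secDeriv_smul_left (c : ℝ) (x : GroupLieAlgebra (𝓡 n) G) (s : G → W) (p : G) :
    secDeriv (c • x) s p = c • secDeriv x s p := by
  simp only [secDeriv, dirDeriv_smul_left, mul_smul, Finset.smul_sum]

lemma mulInvariantVectorField_one (x : GroupLieAlgebra (𝓡 n) G) :
    mulInvariantVectorField x (1 : G) = x := by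
  have h : (fun q : G => 1 * q) = id := by ext q; simp
  unfold mulInvariantVectorField
  rw [h, mfderiv_id]
  rfl

lemma leftTriv_toVectorField (X : G → GroupLieAlgebra (𝓡 n) G) (p : G) :
    leftTriv (toVectorField X) p = X p := by
  have h := congrFun (mpullback_mulInvariantVectorField p (X (p * 1))) 1
  rw [mulInvariantVectorField_one] at h
  rw [mul_one] at h
  rw [← h]
  unfold leftTriv toVectorField
  simp only [VectorField.mpullback_apply, mul_one]

lemma fieldBracket_const (x y : GroupLieAlgebra (𝓡 n) G) (p : G) :
    fieldBracket (fun _ => x) (fun _ => y) p = ⁅x, y⁆ := by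
  have h := mulInvariantVector_mlieBracket (I := 𝓡 n) (G := G) x y
  unfold fieldBracket
  change leftTriv (VectorField.mlieBracket (𝓡 n) (mulInvariantVectorField x)
    (mulInvariantVectorField y)) p = _
  rw [← h]
  exact leftTriv_toVectorField (fun _ => ⁅x, y⁆) p

lemma fieldBracket_swap (X Y : G → GroupLieAlgebra (𝓡 n) G) (p : G) :
    fieldBracket X Y p = -fieldBracket Y X p := by
  unfold fieldBracket leftTriv
  rw [VectorField.mlieBracket_swap]
  simp only [VectorField.mpullback_apply, Pi.neg_apply]
  exact map_neg _ _

lemma fieldBracket_add_right_of_differentiable (X : G → GroupLieAlgebra (𝓡 n) G)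
    {Y Z : G → GroupLieAlgebra (𝓡 n) G} {p : G}
    (hY : MDifferentiableAt (𝓡 n) ((𝓡 n).prod 𝓘(ℝ, EuclideanSpace ℝ (Fin n)))
      (fun q => (toVectorField Y q : TangentBundle (𝓡 n) G)) p)
    (hZ : MDifferentiableAt (𝓡 n) ((𝓡 n).prod 𝓘(ℝ, EuclideanSpace ℝ (Fin n)))
      (fun q => (toVectorField Z q : TangentBundle (𝓡 n) G)) p) :
    fieldBracket X (fun q => Y q + Z q) p = fieldBracket X Y p + fieldBracket X Z p := by
  have hadd : toVectorField (fun q => Y q + Z q) = toVectorField Y + toVectorField Z := by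
    funext q
    exact congrFun (mulInvariantVectorField_add (Y q) (Z q)) q
  unfold fieldBracket leftTriv
  simp only [VectorField.mpullback_apply]
  rw [hadd, VectorField.mlieBracket_add_right]
  · exact map_add _ _ _
  · rwa [mul_one]
  · rwa [mul_one]

lemma toVectorField_smul (f : G → ℝ) (z : GroupLieAlgebra (𝓡 n) G) :
    toVectorField (fun q => f q • z) = f • toVectorField (fun _ => z) := by
  funext q
  exact congrFun (mulInvariantVectorField_smul (f q) z) q

lemma mdifferentiableAt_toVectorField_const (z : GroupLieAlgebra (𝓡 n) G) {p : G} :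
    MDifferentiableAt (𝓡 n) ((𝓡 n).prod 𝓘(ℝ, EuclideanSpace ℝ (Fin n)))
      (fun q => (toVectorField (fun _ => z) q : TangentBundle (𝓡 n) G)) p :=
  mdifferentiableAt_mulInvariantVectorField z

lemma mdifferentiableAt_toVectorField_smul {f : G → ℝ} {p : G}
    (hf : MDifferentiableAt (𝓡 n) 𝓘(ℝ, ℝ) f p) (z : GroupLieAlgebra (𝓡 n) G) :
    MDifferentiableAt (𝓡 n) ((𝓡 n).prod 𝓘(ℝ, EuclideanSpace ℝ (Fin n)))
      (fun q => (toVectorField (fun q => f q • z) q : TangentBundle (𝓡 n) G)) p := by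
  rw [toVectorField_smul]
  exact hf.smul_section (mdifferentiableAt_mulInvariantVectorField z)

/-- The Leibniz rule `[X, f Z] = f [X, Z] + X(f) Z` for left-invariant `Z`. Since `leftTriv`
evaluates at `p * 1`, most steps only identify this point with `p`. -/
lemma fieldBracket_smul_fun (X : G → GroupLieAlgebra (𝓡 n) G)
    {f : G → ℝ} {p : G} (hf : MDifferentiableAt (𝓡 n) 𝓘(ℝ, ℝ) f p)
    (z : GroupLieAlgebra (𝓡 n) G) :
    fieldBracket X (fun q => f q • z) p
      = f p • fieldBracket X (fun _ => z) p + dirDeriv (X p) f p • z := by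
  have hf' : MDifferentiableAt (𝓡 n) 𝓘(ℝ, ℝ) f (p * 1) := by rwa [mul_one]
  have hz := leftTriv_toVectorField (fun _ => z) p
  unfold fieldBracket leftTriv at *
  simp only [VectorField.mpullback_apply] at *
  rw [toVectorField_smul, VectorField.mlieBracket_smul_right hf'
    (mdifferentiableAt_toVectorField_const z), add_comm]
  erw [map_add, map_smul, map_smul]
  rw [hz]
  have hd : dirDeriv (X (p * 1)) f (p * 1) = dirDeriv (X p) f p := by rw [mul_one]
  refine congrArg₂ (· + ·) ?_ (congrArg (· • z) hd)
  simp only [mul_one]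

lemma fieldBracket_sum_smul {ι : Type*} (t : Finset ι) (X : G → GroupLieAlgebra (𝓡 n) G)
    {f : ι → G → ℝ} {p : G} (hf : ∀ i, MDifferentiableAt (𝓡 n) 𝓘(ℝ, ℝ) (f i) p)
    (z : ι → GroupLieAlgebra (𝓡 n) G) :
    MDifferentiableAt (𝓡 n) ((𝓡 n).prod 𝓘(ℝ, EuclideanSpace ℝ (Fin n)))
      (fun q => (toVectorField (fun q => ∑ i ∈ t, f i q • z i) q : TangentBundle (𝓡 n) G)) p ∧
    fieldBracket X (fun q => ∑ i ∈ t, f i q • z i) p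
      = ∑ i ∈ t, (f i p • fieldBracket X (fun _ => z i) p + dirDeriv (X p) (f i) p • z i) := by
  classical
  induction t using Finset.induction_on with
  | empty =>
    have h := fieldBracket_smul_fun (n := n) X (mdifferentiableAt_const (c := (0 : ℝ)) (x := p)) 0
    have h' := mdifferentiableAt_toVectorField_smul (n := n)
      (mdifferentiableAt_const (c := (0 : ℝ)) (x := p)) 0
    simp only [smul_zero, zero_smul, add_zero] at h h'
    simpa using ⟨h', h⟩
  | insert a t ha ih =>
    simp only [Finset.sum_insert ha]
    have ha' := mdifferentiableAt_toVectorField_smul (hf a) (z a)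
    refine ⟨?_, ?_⟩
    · have h := mdifferentiableAt_add_section ha' ih.1
      convert h using 2 with q
      congr 1
      exact congrFun (mulInvariantVectorField_add _ _) q
    · rw [fieldBracket_add_right_of_differentiable X ha' ih.1, ih.2, fieldBracket_smul_fun X (hf a)]

/-- Antisymmetry moves the variable field to the second slot, where it is expanded in a
left-invariant frame and the Leibniz rule applies. `fieldBracket_eq` then expands the other slot in
the same way. -/
lemma fieldBracket_const_right {X : G → GroupLieAlgebra (𝓡 n) G} {p : G}
    (hX : CoordDifferentiableAt n X p) (z : GroupLieAlgebra (𝓡 n) G) :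
    fieldBracket X (fun _ => z) p = ⁅X p, z⁆ - secDeriv z X p := by
  set b := Module.finBasis ℝ (GroupLieAlgebra (𝓡 n) G)
  have hX' : X = fun q => ∑ i, b.coord i (X q) • b i := by
    funext q
    exact (b.sum_repr (X q)).symm
  rw [fieldBracket_swap]
  conv_lhs => rw [hX']
  rw [(fieldBracket_sum_smul Finset.univ (fun _ => z) (fun i => hX (b.coord i)) b).2]
  simp only [fieldBracket_const, Finset.sum_add_distrib]
  have h : ∑ i, b.coord i (X p) • ⁅z, b i⁆ = ⁅z, X p⁆ := by
    conv_rhs => rw [← b.sum_repr (X p), lie_sum]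
    simp
  rw [h, ← lie_skew z (X p)]
  simp only [secDeriv, b]
  abel

lemma fieldBracket_eq {X Y : G → GroupLieAlgebra (𝓡 n) G} {p : G}
    (hX : CoordDifferentiableAt n X p) (hY : CoordDifferentiableAt n Y p) :
    fieldBracket X Y p = ⁅X p, Y p⁆ + secDeriv (X p) Y p - secDeriv (Y p) X p := by
  set b := Module.finBasis ℝ (GroupLieAlgebra (𝓡 n) G)
  have hY' : Y = fun q => ∑ i, b.coord i (Y q) • b i := by
    funext q
    exact (b.sum_repr (Y q)).symm
  conv_lhs => rw [hY']
  rw [(fieldBracket_sum_smul Finset.univ X (fun i => hY (b.coord i)) b).2]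
  simp only [fieldBracket_const_right hX, Finset.sum_add_distrib, smul_sub,
    Finset.sum_sub_distrib]
  have h : ∑ i, b.coord i (Y p) • ⁅X p, b i⁆ = ⁅X p, Y p⁆ := by
    conv_rhs => rw [← b.sum_repr (Y p), lie_sum]
    simp
  have h' : ∑ i, b.coord i (Y p) • secDeriv (b i) X p = secDeriv (Y p) X p := by
    have hl (c : ℝ) (x : GroupLieAlgebra (𝓡 n) G) :
        secDeriv (c • x) X p = c • secDeriv x X p := secDeriv_smul_left c x X p
    let A : GroupLieAlgebra (𝓡 n) G →ₗ[ℝ] GroupLieAlgebra (𝓡 n) G :=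
      { toFun := fun x => secDeriv x X p
        map_add' := fun x y => secDeriv_add_left x y X p
        map_smul' := fun c x => secDeriv_smul_left c x X p }
    have := congrArg A (b.sum_repr (Y p))
    rw [map_sum] at this
    simpa [A, secDeriv_smul_left] using this
  rw [h, h']
  simp only [secDeriv, b]
  abel

end Geometry

/-! ### Smooth sections of `E` and the Dorfman bracket in terms of derivatives of sections. -/

section Sections

variable {n : ℕ} {G : Type*} [TopologicalSpace G] [ChartedSpace (EuclideanSpace ℝ (Fin n)) G]
  [Group G] [LieGroup (𝓡 n) ∞ G]

/-- Smoothness of all scalar coordinates. On the one-form component a functional is evaluation at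
some vector `z`, because the Lie algebra is reflexive. -/
lemma IsSmoothSection.contMDiff_dual {s : G → Fiber n G} (hs : IsSmoothSection s)
    (ψ : Module.Dual ℝ (Fiber n G)) : ContMDiff (𝓡 n) 𝓘(ℝ, ℝ) ∞ (fun p => ψ (s p)) := by
  obtain ⟨z, hz⟩ := (Module.evalEquiv ℝ (GroupLieAlgebra (𝓡 n) G)).surjective
    (ψ ∘ₗ LinearMap.inr ℝ _ _ ∘ₗ LinearMap.inl ℝ _ _)
  have h : (fun p => ψ (s p)) = fun p => (ψ ∘ₗ LinearMap.inl ℝ _ _) (s p).1 + (s p).2.1 z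
      + (s p).2.2 * ψ (0, 0, 1) := by
    funext p
    have h1 : s p = ((s p).1, 0) + (0, (s p).2.1, 0) + (s p).2.2 • (0, 0, 1) := by
      ext <;> simp
    have h2 := LinearMap.congr_fun hz (s p).2.1
    simp only [Module.evalEquiv_apply, Module.Dual.eval_apply, LinearMap.comp_apply,
      LinearMap.inl_apply, LinearMap.inr_apply] at h2
    rw [h2]
    conv_lhs => rw [h1]
    simp only [map_add, map_smul, smul_eq_mul, LinearMap.comp_apply, LinearMap.inl_apply]
  rw [h]
  exact ((hs.vec _).add (hs.form z)).add (hs.scal.mul contMDiff_const)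

lemma isSmoothSection_of_dual {s : G → Fiber n G}
    (hs : ∀ ψ : Module.Dual ℝ (Fiber n G), ContMDiff (𝓡 n) 𝓘(ℝ, ℝ) ∞ (fun p => ψ (s p))) :
    IsSmoothSection s where
  vec φ := hs (φ ∘ₗ LinearMap.fst ℝ _ _)
  form z := hs (Module.Dual.eval ℝ _ z ∘ₗ LinearMap.fst ℝ _ _ ∘ₗ LinearMap.snd ℝ _ _)
  scal := hs (LinearMap.snd ℝ _ _ ∘ₗ LinearMap.snd ℝ _ _)

lemma isSmoothEnd_const (A : Module.End ℝ (Fiber n G)) : IsSmoothEnd (fun _ : G => A) :=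
  fun _ hs => isSmoothSection_of_dual fun ψ => hs.contMDiff_dual (ψ ∘ₗ A)

variable (n G) in
/-- The left-invariant section with value `u`. -/
def constSection (u : Fiber n G) : SmoothSection n G :=
  ⟨fun _ => u, isSmoothSection_of_dual fun _ => contMDiff_const⟩

lemma coordDifferentiableAt (s : SmoothSection n G) (p : G) : CoordDifferentiableAt n s.1 p :=
  fun ψ => (s.2.contMDiff_dual ψ).mdifferentiableAt (by simp)

lemma coordDifferentiableAt_vec (s : SmoothSection n G) (p : G) :
    CoordDifferentiableAt n (fun q => (s.1 q).1) p :=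
  (coordDifferentiableAt s p).comp (LinearMap.fst ℝ _ _)

lemma secDeriv_vec (x : GroupLieAlgebra (𝓡 n) G) (s : SmoothSection n G) (p : G) :
    secDeriv x (fun q => (s.1 q).1) p = (secDeriv x s.1 p).1 :=
  (map_secDeriv x (coordDifferentiableAt s p) (LinearMap.fst ℝ _ _)).symm

lemma dirDeriv_form (x : GroupLieAlgebra (𝓡 n) G) (s : SmoothSection n G) (p : G)
    (z : GroupLieAlgebra (𝓡 n) G) :
    dirDeriv x (fun q => (s.1 q).2.1 z) p = (secDeriv x s.1 p).2.1 z :=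
  (apply_secDeriv x (coordDifferentiableAt s p)
    (Module.Dual.eval ℝ _ z ∘ₗ LinearMap.fst ℝ _ _ ∘ₗ LinearMap.snd ℝ _ _)).symm

lemma dirDeriv_scal (x : GroupLieAlgebra (𝓡 n) G) (s : SmoothSection n G) (p : G) :
    dirDeriv x (fun q => (s.1 q).2.2) p = (secDeriv x s.1 p).2.2 :=
  (apply_secDeriv x (coordDifferentiableAt s p)
    (LinearMap.snd ℝ _ _ ∘ₗ LinearMap.snd ℝ _ _)).symm

lemma dirDeriv_mul (x : GroupLieAlgebra (𝓡 n) G) {f h : G → ℝ} {p : G}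
    (hf : MDifferentiableAt (𝓡 n) 𝓘(ℝ, ℝ) f p) (hh : MDifferentiableAt (𝓡 n) 𝓘(ℝ, ℝ) h p) :
    dirDeriv x (fun q => f q * h q) p = dirDeriv x f p * h p + f p * dirDeriv x h p := by
  have := (hf.hasMFDerivAt.mul hh.hasMFDerivAt).mfderiv
  unfold dirDeriv
  change mfderiv (𝓡 n) 𝓘(ℝ, ℝ) (f * h) p _ = _
  rw [this]
  change f p * dirDeriv x h p + h p * dirDeriv x f p
    = dirDeriv x f p * h p + f p * dirDeriv x h p
  ring

/-- The product rule for `ξ(Y)`, obtained by expanding `Y` in a basis. -/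
lemma dirDeriv_form_vec (x : GroupLieAlgebra (𝓡 n) G) (u v : SmoothSection n G) (p : G) :
    dirDeriv x (fun q => (u.1 q).2.1 (v.1 q).1) p
      = (secDeriv x u.1 p).2.1 (v.1 p).1 + (u.1 p).2.1 (secDeriv x v.1 p).1 := by
  set b := Module.finBasis ℝ (GroupLieAlgebra (𝓡 n) G)
  have hexp (ξ : Module.Dual ℝ (GroupLieAlgebra (𝓡 n) G)) (y : GroupLieAlgebra (𝓡 n) G) :
      ξ y = ∑ i, b.coord i y * ξ (b i) := by
    have := congrArg ξ (b.sum_repr y)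
    simpa only [map_sum, map_smul, smul_eq_mul, Module.Basis.coord_apply] using this.symm
  have hv (i) : MDifferentiableAt (𝓡 n) 𝓘(ℝ, ℝ) (fun q => b.coord i (v.1 q).1) p :=
    coordDifferentiableAt_vec v p (b.coord i)
  have hu (i) : MDifferentiableAt (𝓡 n) 𝓘(ℝ, ℝ) (fun q => (u.1 q).2.1 (b i)) p :=
    (u.2.form _).mdifferentiableAt (by simp)
  have hd (i) : MDifferentiableAt (𝓡 n) 𝓘(ℝ, ℝ)
      (fun q => b.coord i (v.1 q).1 * (u.1 q).2.1 (b i)) p := (hv i).mul (hu i)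
  have h (i) : dirDeriv x (fun q => b.coord i (v.1 q).1) p = b.coord i (secDeriv x v.1 p).1 := by
    rw [← secDeriv_vec, apply_secDeriv x (coordDifferentiableAt_vec v p)]
  rw [funext fun q => hexp (u.1 q).2.1 (v.1 q).1, (dirDeriv_sum Finset.univ x hd).2,
    hexp _ (v.1 p).1, hexp _ (secDeriv x v.1 p).1, ← Finset.sum_add_distrib]
  refine Finset.sum_congr rfl fun i _ => ?_
  rw [dirDeriv_mul x (hv i) (hu i), dirDeriv_form, h]
  ring

lemma dorfman_vec (H : GroupLieAlgebra (𝓡 n) G [⋀^Fin 3]→ₗ[ℝ] ℝ)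
    (F : GroupLieAlgebra (𝓡 n) G [⋀^Fin 2]→ₗ[ℝ] ℝ) (u v : SmoothSection n G) (p : G) :
    (dorfman H F u v p).1 = ⁅(u.1 p).1, (v.1 p).1⁆ + (secDeriv (u.1 p).1 v.1 p).1
      - (secDeriv (v.1 p).1 u.1 p).1 := by
  have h := fieldBracket_eq (coordDifferentiableAt_vec u p) (coordDifferentiableAt_vec v p)
  rw [secDeriv_vec, secDeriv_vec] at h
  exact h

/-- The derivatives along `z` come from `z(ξ(Y))`, `2 m z(l)` and the two field brackets with `z`.
The terms `ξ(z(Y))` cancel, and the rest combines to `2 ⟨z(u), v⟩`. -/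
lemma dorfman_form (H : GroupLieAlgebra (𝓡 n) G [⋀^Fin 3]→ₗ[ℝ] ℝ)
    (F : GroupLieAlgebra (𝓡 n) G [⋀^Fin 2]→ₗ[ℝ] ℝ) (u v : SmoothSection n G) (p : G)
    (z : GroupLieAlgebra (𝓡 n) G) :
    (dorfman H F u v p).2.1 z
      = (u.1 p).2.1 ⁅(v.1 p).1, z⁆ - (v.1 p).2.1 ⁅(u.1 p).1, z⁆ + H ![(v.1 p).1, (u.1 p).1, z]
        - 2 * ((v.1 p).2.2 * F ![(u.1 p).1, z] - (u.1 p).2.2 * F ![(v.1 p).1, z])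
        + (secDeriv (u.1 p).1 v.1 p).2.1 z - (secDeriv (v.1 p).1 u.1 p).2.1 z
        + 2 * pairing (secDeriv z u.1 p) (v.1 p) := by
  change dorfmanForm H F u.1 v.1 p z = _
  simp only [dorfmanForm, lieDerivForm, contractD]
  rw [fieldBracket_const_right (coordDifferentiableAt_vec u p),
    fieldBracket_const_right (coordDifferentiableAt_vec v p), secDeriv_vec, secDeriv_vec,
    dirDeriv_form, dirDeriv_form, dirDeriv_form_vec, dirDeriv_scal]
  simp only [map_sub, pairing]
  ring

lemma dorfman_scal (H : GroupLieAlgebra (𝓡 n) G [⋀^Fin 3]→ₗ[ℝ] ℝ)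
    (F : GroupLieAlgebra (𝓡 n) G [⋀^Fin 2]→ₗ[ℝ] ℝ) (u v : SmoothSection n G) (p : G) :
    (dorfman H F u v p).2.2 = (secDeriv (u.1 p).1 v.1 p).2.2 - (secDeriv (v.1 p).1 u.1 p).2.2
      + F ![(u.1 p).1, (v.1 p).1] := by
  rw [← dirDeriv_scal, ← dirDeriv_scal]
  rfl

section Split

variable {φ : Module.Dual ℝ (GroupLieAlgebra (𝓡 n) G)}
  {D : Module.End ℝ (GroupLieAlgebra (𝓡 n) G)}

variable (D) in
/-- The skew-symmetric extension of an endomorphism of the Lie algebra to the fibre of `E`. -/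
def fiberEnd : Module.End ℝ (Fiber n G) where
  toFun u := (D u.1, -(u.2.1 ∘ₗ D), 0)
  map_add' u v := by
    ext <;> simp [add_comm]
  map_smul' c u := by
    ext <;> simp

variable (φ D) in
/-- The covariant derivative `∇_z s = z(s) + φ(z) D s` on sections of `E`. -/
def nabla (z : GroupLieAlgebra (𝓡 n) G) (s : G → Fiber n G) (p : G) : Fiber n G :=
  secDeriv z s p + φ z • fiberEnd D (s p)

lemma nabla_vec (z : GroupLieAlgebra (𝓡 n) G) (s : G → Fiber n G) (p : G) :
    (nabla φ D z s p).1 = (secDeriv z s p).1 + φ z • D (s p).1 := rfl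

lemma nabla_form (z : GroupLieAlgebra (𝓡 n) G) (s : G → Fiber n G) (p : G)
    (w : GroupLieAlgebra (𝓡 n) G) :
    (nabla φ D z s p).2.1 w = (secDeriv z s p).2.1 w - φ z * (s p).2.1 (D w) := by
  change (secDeriv z s p).2.1 w + φ z * (-((s p).2.1 (D w))) = _
  ring

lemma nabla_scal (z : GroupLieAlgebra (𝓡 n) G) (s : G → Fiber n G) (p : G) :
    (nabla φ D z s p).2.2 = (secDeriv z s p).2.2 := by
  change (secDeriv z s p).2.2 + φ z * 0 = _
  ring

lemma pairing_add_left (u v w : Fiber n G) :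
    pairing (u + v) w = pairing u w + pairing v w := by
  change (w.2.1 (u.1 + v.1) + (u.2.1 w.1 + v.2.1 w.1)) / 2 + (u.2.2 + v.2.2) * w.2.2 = _
  rw [map_add, pairing, pairing]
  ring

lemma pairing_smul_left (c : ℝ) (u w : Fiber n G) : pairing (c • u) w = c * pairing u w := by
  change (w.2.1 (c • u.1) + c * u.2.1 w.1) / 2 + c * u.2.2 * w.2.2 = _
  rw [map_smul, smul_eq_mul, pairing]
  ring

variable (φ D) in
/-- The one-form `z ↦ 2 ⟨∇_z u, v⟩`. -/
def nablaForm (u v : G → Fiber n G) (p : G) : Module.Dual ℝ (GroupLieAlgebra (𝓡 n) G) where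
  toFun z := 2 * pairing (nabla φ D z u p) (v p)
  map_add' z w := by
    simp only [nabla, secDeriv_add_left, map_add, add_smul, pairing_add_left]
    ring
  map_smul' c z := by
    simp only [nabla, secDeriv_smul_left, map_smul, smul_eq_mul, mul_smul, pairing_add_left,
      pairing_smul_left, RingHom.id_apply]
    ring

/-- If `[x, y] = φ(x) D y - φ(y) D x`, then the untwisted Dorfman bracket is the torsion of
`nabla φ D`. -/
lemma dorfman_zero_eq (hD : ∀ x y : GroupLieAlgebra (𝓡 n) G, ⁅x, y⁆ = φ x • D y - φ y • D x)
    (u v : SmoothSection n G) (p : G) :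
    ∃ R : Module.Dual ℝ (GroupLieAlgebra (𝓡 n) G),
      (∀ z, R z = 2 * pairing (nabla φ D z u.1 p) (v.1 p)) ∧
      dorfman 0 0 u v p
        = nabla φ D (u.1 p).1 v.1 p - nabla φ D (v.1 p).1 u.1 p + (0, R, 0) := by
  refine ⟨nablaForm φ D u.1 v.1 p, fun z => rfl, ?_⟩
  refine Prod.ext ?_ (Prod.ext (LinearMap.ext fun z => ?_) ?_)
  · change (dorfman 0 0 u v p).1 = (nabla φ D (u.1 p).1 v.1 p).1 - (nabla φ D (v.1 p).1 u.1 p).1 + 0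
    rw [dorfman_vec, hD, nabla_vec, nabla_vec]
    abel
  · change (dorfman 0 0 u v p).2.1 z = (nabla φ D (u.1 p).1 v.1 p).2.1 z
      - (nabla φ D (v.1 p).1 u.1 p).2.1 z + 2 * pairing (nabla φ D z u.1 p) (v.1 p)
    rw [dorfman_form, hD, hD, nabla_form, nabla_form, pairing, pairing, nabla_vec, nabla_scal,
      nabla_form, map_sub, map_sub, map_add, map_smul, map_smul, map_smul, map_smul]
    simp only [smul_eq_mul, AlternatingMap.zero_apply]
    ring
  · change (dorfman 0 0 u v p).2.2 = (nabla φ D (u.1 p).1 v.1 p).2.2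
      - (nabla φ D (v.1 p).1 u.1 p).2.2 + 0
    rw [dorfman_scal, nabla_scal, nabla_scal, AlternatingMap.zero_apply]

/-- A constant `𝓕` commuting with `fiberEnd D` is parallel for `nabla φ D`, so covariant derivatives
of eigensections are eigensections. -/
lemma nabla_eigen {𝓕 : Module.End ℝ (Fiber n G)}
    (hcomm : ∀ u, 𝓕 (fiberEnd D u) = fiberEnd D (𝓕 u)) {a b : SmoothSection n G}
    (hab : IsEigenSection (fun _ => 𝓕) a.1 b.1) (z : GroupLieAlgebra (𝓡 n) G) (p : G) :
    𝓕 (nabla φ D z a.1 p) = -nabla φ D z b.1 p ∧ 𝓕 (nabla φ D z b.1 p) = nabla φ D z a.1 p := by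
  have ha := map_secDeriv z (coordDifferentiableAt a p) 𝓕
  have hb := map_secDeriv z (coordDifferentiableAt b p) 𝓕
  have hn := map_secDeriv z (coordDifferentiableAt b p) (-LinearMap.id)
  rw [funext fun q => (hab q).1] at ha
  rw [funext fun q => (hab q).2] at hb
  simp only [LinearMap.neg_apply, LinearMap.id_apply] at hn
  simp only [nabla, map_add, map_smul, hcomm, (hab p).1, (hab p).2, ha, hb, ← hn, map_neg,
    smul_neg, neg_add, and_self]

/-- In the formula `∇_X v - ∇_Y u + 2 ⟨∇ u, v⟩` for the bracket of two eigensections, the first two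
terms are eigenvectors because `𝓕` is parallel. The last vanishes because the `i`-eigenspace of a
skew endomorphism is isotropic. -/
lemma isIntegrable_const {𝓕 : Module.End ℝ (Fiber n G)}
    (hD : ∀ x y : GroupLieAlgebra (𝓡 n) G, ⁅x, y⁆ = φ x • D y - φ y • D x)
    (hcomm : ∀ u, 𝓕 (fiberEnd D u) = fiberEnd D (𝓕 u))
    (hskew : ∀ u v, pairing (𝓕 u) v = -pairing u (𝓕 v)) :
    IsIntegrable 0 0 (fun _ : G => 𝓕) := by
  intro a b c d hab hcd p
  obtain ⟨Rac, hRac, hac⟩ := dorfman_zero_eq hD a c p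
  obtain ⟨Rad, hRad, had⟩ := dorfman_zero_eq hD a d p
  obtain ⟨Rbc, hRbc, hbc⟩ := dorfman_zero_eq hD b c p
  obtain ⟨Rbd, hRbd, hbd⟩ := dorfman_zero_eq hD b d p
  -- `e1` and `e2` are the real and imaginary parts of `⟨∇(a + i b), c + i d⟩ = 0`.
  have e1 : Rac = Rbd := by
    ext z
    rw [hRac, hRbd, ← (nabla_eigen hcomm hab z p).2, hskew, (hcd p).1]
    simp only [pairing, Prod.fst_neg, Prod.snd_neg, LinearMap.neg_apply, map_neg]
    ring
  have e2 : Rad = -Rbc := by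
    ext z
    rw [LinearMap.neg_apply, hRad, hRbc, ← (nabla_eigen hcomm hab z p).2, hskew, (hcd p).2]
    ring
  have h1 : dorfman 0 0 a c p - dorfman 0 0 b d p = nabla φ D (a.1 p).1 c.1 p
      - nabla φ D (c.1 p).1 a.1 p - nabla φ D (b.1 p).1 d.1 p + nabla φ D (d.1 p).1 b.1 p := by
    rw [hac, hbd, e1]
    abel
  have h2 : dorfman 0 0 a d p + dorfman 0 0 b c p = nabla φ D (a.1 p).1 d.1 p
      - nabla φ D (d.1 p).1 a.1 p + nabla φ D (b.1 p).1 c.1 p - nabla φ D (c.1 p).1 b.1 p := by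
    have : ((0, Rad, 0) : Fiber n G) = -(0, Rbc, 0) := by
      rw [e2]
      ext <;> simp
    rw [had, hbc, this]
    abel
  simp only [h1, h2, map_add, map_sub, (nabla_eigen (φ := φ) hcomm hab _ p).1,
    (nabla_eigen (φ := φ) hcomm hab _ p).2, (nabla_eigen (φ := φ) hcomm hcd _ p).1,
    (nabla_eigen (φ := φ) hcomm hcd _ p).2]
  constructor <;> abel

end Split

lemma secDeriv_const (x : GroupLieAlgebra (𝓡 n) G) (u : Fiber n G) (p : G) :
    secDeriv x (fun _ => u) p = 0 := by
  simp [secDeriv, dirDeriv_const]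

/-- The Dorfman bracket of left-invariant sections. -/
lemma dorfman_constSection (H : GroupLieAlgebra (𝓡 n) G [⋀^Fin 3]→ₗ[ℝ] ℝ)
    (F : GroupLieAlgebra (𝓡 n) G [⋀^Fin 2]→ₗ[ℝ] ℝ) (u v : Fiber n G) (p : G) :
    (dorfman H F (constSection n G u) (constSection n G v) p).1 = ⁅u.1, v.1⁆ ∧
    (∀ z, (dorfman H F (constSection n G u) (constSection n G v) p).2.1 z
      = u.2.1 ⁅v.1, z⁆ - v.2.1 ⁅u.1, z⁆ + H ![v.1, u.1, z]
        - 2 * (v.2.2 * F ![u.1, z] - u.2.2 * F ![v.1, z])) ∧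
    (dorfman H F (constSection n G u) (constSection n G v) p).2.2 = F ![u.1, v.1] := by
  refine ⟨?_, fun z => ?_, ?_⟩
  · rw [dorfman_vec]
    simp [constSection, secDeriv_const]
  · rw [dorfman_form]
    simp [constSection, secDeriv_const, pairing]
  · rw [dorfman_scal]
    simp [constSection, secDeriv_const]

end Sections

/-! ### Endomorphisms that are complex structures transverse to a unit vector. -/

section TransverseComplex

variable {V : Type*} [AddCommGroup V] [Module ℝ V] {g : V →ₗ[ℝ] V →ₗ[ℝ] ℝ}
  {J : Module.End ℝ V} {X : V}

lemma IsTransverseComplex.square_eq (hJ : IsTransverseComplex g J X) (hX : g X X = 1) (x : V) :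
    J (J x) = -x + g X x • X := by
  have h := hJ.square (x - g X x • X) (by simp [hX])
  simp only [map_sub, map_smul, hJ.kernel, smul_zero, sub_zero] at h
  rw [h]
  abel

lemma IsTransverseComplex.apply_left (hg : IsMetric g) (hJ : IsTransverseComplex g J X) (x : V) :
    g X (J x) = 0 := by
  rw [hg.1, hJ.skew, hJ.kernel, map_zero, neg_zero]

end TransverseComplex

/-! ### The decomposition `E = E₊ ⊕ E₋` and the endomorphisms with prescribed components. -/

section Splitting

variable {n : ℕ} {G : Type*} [TopologicalSpace G] [ChartedSpace (EuclideanSpace ℝ (Fin n)) G]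
  [Group G] [LieGroup (𝓡 n) ∞ G]
  {g : GroupLieAlgebra (𝓡 n) G →ₗ[ℝ] GroupLieAlgebra (𝓡 n) G →ₗ[ℝ] ℝ}
  {Jp Jm : Module.End ℝ (GroupLieAlgebra (𝓡 n) G)} {Xp Xm : GroupLieAlgebra (𝓡 n) G}

variable (g) in
/-- The element `x + g x + a` of `E₊`. -/
def plusPart (x : GroupLieAlgebra (𝓡 n) G) (a : ℝ) : Fiber n G := (x, g x, a)

variable (g) in
/-- The element `x - g x` of `E₋`. -/
def minusPart (x : GroupLieAlgebra (𝓡 n) G) : Fiber n G := (x, -g x, 0)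

lemma plusPart_add (x y : GroupLieAlgebra (𝓡 n) G) (a b : ℝ) :
    plusPart g x a + plusPart g y b = plusPart g (x + y) (a + b) := by
  simp [plusPart]

lemma plusPart_smul (c : ℝ) (x : GroupLieAlgebra (𝓡 n) G) (a : ℝ) :
    c • plusPart g x a = plusPart g (c • x) (c * a) := by
  simp [plusPart]

lemma plusPart_neg (x : GroupLieAlgebra (𝓡 n) G) (a : ℝ) :
    -plusPart g x a = plusPart g (-x) (-a) := by
  simp [plusPart]

lemma minusPart_add (x y : GroupLieAlgebra (𝓡 n) G) :
    minusPart g x + minusPart g y = minusPart g (x + y) := by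
  simp [minusPart, add_comm]

lemma minusPart_smul (c : ℝ) (x : GroupLieAlgebra (𝓡 n) G) :
    c • minusPart g x = minusPart g (c • x) := by
  simp [minusPart]

lemma minusPart_neg (x : GroupLieAlgebra (𝓡 n) G) : -minusPart g x = minusPart g (-x) := by
  simp [minusPart]

lemma pairing_comm (u v : Fiber n G) : pairing u v = pairing v u := by
  simp only [pairing]
  ring

lemma pairing_neg_left (u v : Fiber n G) : pairing (-u) v = -pairing u v := by
  rw [← neg_one_smul ℝ, pairing_smul_left, neg_one_mul]

lemma pairing_plusPart (hg : IsMetric g) (x y : GroupLieAlgebra (𝓡 n) G) (a b : ℝ) :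
    pairing (plusPart g x a) (plusPart g y b) = g x y + a * b := by
  simp only [pairing, plusPart, hg.1 y x]
  ring

lemma pairing_minusPart (hg : IsMetric g) (x y : GroupLieAlgebra (𝓡 n) G) :
    pairing (minusPart g x) (minusPart g y) = -g x y := by
  simp only [pairing, minusPart, LinearMap.neg_apply, hg.1 y x]
  ring

lemma pairing_plusPart_minusPart (hg : IsMetric g) (x y : GroupLieAlgebra (𝓡 n) G) (a : ℝ) :
    pairing (plusPart g x a) (minusPart g y) = 0 := by
  simp only [pairing, plusPart, minusPart, LinearMap.neg_apply, hg.1 y x]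
  ring

lemma pairing_split (hg : IsMetric g) (x y x' y' : GroupLieAlgebra (𝓡 n) G) (a a' : ℝ) :
    pairing (plusPart g x a + minusPart g y) (plusPart g x' a' + minusPart g y')
      = g x x' + a * a' - g y y' := by
  rw [pairing_add_left, pairing_comm (plusPart g x a), pairing_comm (minusPart g y),
    pairing_add_left, pairing_add_left, pairing_plusPart hg, pairing_minusPart hg,
    pairing_plusPart_minusPart hg, pairing_comm (minusPart g y'), pairing_plusPart_minusPart hg,
    hg.1 x', hg.1 y']
  ring

/-- The isomorphism `V ≅ V*` given by a metric. -/
def IsMetric.toDual {V : Type*} [AddCommGroup V] [Module ℝ V] [FiniteDimensional ℝ V]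
    {g : V →ₗ[ℝ] V →ₗ[ℝ] ℝ} (hg : IsMetric g) : V ≃ₗ[ℝ] Module.Dual ℝ V :=
  LinearEquiv.ofInjectiveOfFinrankEq g
    ((injective_iff_map_eq_zero g).2 fun x hx => hg.2 x fun y => by rw [hx]; rfl)
    Subspace.dual_finrank_eq.symm

lemma exists_split (hg : IsMetric g) (u : Fiber n G) :
    ∃ x a y, u = plusPart g x a + minusPart g y := by
  refine ⟨(1 / 2 : ℝ) • (u.1 + hg.toDual.symm u.2.1), u.2.2,
    (1 / 2 : ℝ) • (u.1 - hg.toDual.symm u.2.1), ?_⟩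
  have h : g (hg.toDual.symm u.2.1) = u.2.1 := hg.toDual.apply_symm_apply u.2.1
  refine Prod.ext ?_ (Prod.ext ?_ ?_)
  · simp only [plusPart, minusPart, Prod.fst_add]
    module
  · simp only [plusPart, minusPart, Prod.fst_add, Prod.snd_add, map_smul, map_add, map_sub, h]
    module
  · simp [plusPart, minusPart]

lemma minusPart_eq_zero {y : GroupLieAlgebra (𝓡 n) G} (h : minusPart g y = 0) : y = 0 :=
  congrArg Prod.fst h

/-- The endomorphism of the fibre which is `1` on `E₊` and `-1` on `E₋`. -/
def metricEnd (hg : IsMetric g) : Module.End ℝ (Fiber n G) where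
  toFun u := (hg.toDual.symm u.2.1, g u.1, u.2.2)
  map_add' u v := by simp
  map_smul' c u := by simp

lemma metricEnd_plusPart (hg : IsMetric g) (x : GroupLieAlgebra (𝓡 n) G) (a : ℝ) :
    metricEnd hg (plusPart g x a) = plusPart g x a := by
  change (hg.toDual.symm (hg.toDual x), g x, a) = _
  rw [LinearEquiv.symm_apply_apply]
  rfl

lemma metricEnd_minusPart (hg : IsMetric g) (x : GroupLieAlgebra (𝓡 n) G) :
    metricEnd hg (minusPart g x) = -minusPart g x := by
  change (hg.toDual.symm (-hg.toDual x), g x, 0) = _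
  rw [map_neg, LinearEquiv.symm_apply_apply]
  simp [minusPart]

variable (Jp Jm Xp) in
/-- The endomorphism of the fibre with components `Jp, Jm, Xp`. -/
def complexEnd (hg : IsMetric g) : Module.End ℝ (Fiber n G) where
  toFun u :=
    plusPart g ((1 / 2 : ℝ) • Jp (u.1 + hg.toDual.symm u.2.1) + u.2.2 • Xp)
      (-((1 / 2 : ℝ) * g Xp (u.1 + hg.toDual.symm u.2.1)))
      + minusPart g ((1 / 2 : ℝ) • Jm (u.1 - hg.toDual.symm u.2.1))
  map_add' u v := by
    rw [add_add_add_comm, plusPart_add, minusPart_add]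
    simp only [Prod.fst_add, Prod.snd_add, map_add, map_sub]
    congr 1
    · congr 1
      · module
      · ring
    · congr 1
      module
  map_smul' c u := by
    rw [RingHom.id_apply, smul_add, plusPart_smul, minusPart_smul]
    simp only [Prod.smul_fst, Prod.smul_snd, map_add, map_sub, map_smul, smul_eq_mul]
    congr 1
    · congr 1
      · module
      · ring
    · congr 1
      module

lemma complexEnd_plusPart (hg : IsMetric g) (x : GroupLieAlgebra (𝓡 n) G) (a : ℝ) :
    complexEnd Jp Jm Xp hg (plusPart g x a) = plusPart g (Jp x + a • Xp) (-g Xp x) := by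
  have h : hg.toDual.symm (plusPart g x a).2.1 = x := hg.toDual.symm_apply_apply x
  simp only [complexEnd, LinearMap.coe_mk, AddHom.coe_mk, h]
  simp only [plusPart, minusPart, sub_self, map_zero, smul_zero, map_add]
  refine Prod.ext ?_ (Prod.ext ?_ ?_)
  · simp only [Prod.fst_add]
    module
  · simp only [Prod.fst_add, Prod.snd_add, map_smul, map_add]
    module
  · simp only [Prod.snd_add]
    ring

lemma complexEnd_minusPart (hg : IsMetric g) (x : GroupLieAlgebra (𝓡 n) G) :
    complexEnd Jp Jm Xp hg (minusPart g x) = minusPart g (Jm x) := by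
  have h : hg.toDual.symm (minusPart g x).2.1 = -x := by
    change hg.toDual.symm (-hg.toDual x) = _
    rw [map_neg, LinearEquiv.symm_apply_apply]
  simp only [complexEnd, LinearMap.coe_mk, AddHom.coe_mk, h]
  simp only [plusPart, minusPart, sub_neg_eq_add, add_neg_cancel, map_zero, smul_zero, map_add]
  refine Prod.ext ?_ (Prod.ext ?_ ?_)
  · simp only [Prod.fst_add]
    module
  · simp only [Prod.fst_add, Prod.snd_add, map_smul, map_add, map_zero, zero_smul]
    module
  · simp

lemma fiberEnd_plusPart {D : Module.End ℝ (GroupLieAlgebra (𝓡 n) G)}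
    (hD : ∀ x y, g (D x) y = -g x (D y)) (x : GroupLieAlgebra (𝓡 n) G) (a : ℝ) :
    fiberEnd D (plusPart g x a) = plusPart g (D x) 0 := by
  refine Prod.ext rfl (Prod.ext (LinearMap.ext fun z => ?_) rfl)
  exact (hD x z).symm

lemma fiberEnd_minusPart {D : Module.End ℝ (GroupLieAlgebra (𝓡 n) G)}
    (hD : ∀ x y, g (D x) y = -g x (D y)) (x : GroupLieAlgebra (𝓡 n) G) :
    fiberEnd D (minusPart g x) = minusPart g (D x) := by
  refine Prod.ext rfl (Prod.ext (LinearMap.ext fun z => ?_) rfl)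
  change -(-g x (D z)) = -g (D x) z
  rw [hD]

end Splitting

/-! ### Construction of a structure from a parallel splitting. -/

section Three

variable {G : Type*} [TopologicalSpace G] [ChartedSpace (EuclideanSpace ℝ (Fin 3)) G]
  [Group G] [LieGroup (𝓡 3) ∞ G]
  {g : GroupLieAlgebra (𝓡 3) G →ₗ[ℝ] GroupLieAlgebra (𝓡 3) G →ₗ[ℝ] ℝ}
  {Jp Jm : Module.End ℝ (GroupLieAlgebra (𝓡 3) G)} {Xp Xm : GroupLieAlgebra (𝓡 3) G}

theorem exists_isPseudoKahler (hg : IsMetric g) (hp : IsTransverseComplex g Jp Xp)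
    (hm : IsTransverseComplex g Jm Xm) (hXp : g Xp Xp = 1) (hXm : g Xm Xm = 1)
    {φ : Module.Dual ℝ (GroupLieAlgebra (𝓡 3) G)} {D : Module.End ℝ (GroupLieAlgebra (𝓡 3) G)}
    (hbr : ∀ x y : GroupLieAlgebra (𝓡 3) G, ⁅x, y⁆ = φ x • D y - φ y • D x)
    (hD : ∀ x y, g (D x) y = -g x (D y)) (hDp : ∀ x, D (Jp x) = Jp (D x))
    (hDm : ∀ x, D (Jm x) = Jm (D x)) (hDX : D Xp = 0) :
    ∃ 𝒢 𝓕 : G → Module.End ℝ (Fiber 3 G), IsPseudoKahler 0 0 𝒢 𝓕 ∧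
      HasComponents 𝒢 𝓕 g Jp Jm Xp Xm := by
  set A := metricEnd hg (n := 3) (G := G)
  set B := complexEnd Jp Jm Xp hg
  have A1 := metricEnd_plusPart hg (n := 3) (G := G)
  have A2 := metricEnd_minusPart hg (n := 3) (G := G)
  have B1 : ∀ x a, B (plusPart g x a) = _ := complexEnd_plusPart hg
  have B2 : ∀ x, B (minusPart g x) = _ := complexEnd_minusPart hg
  have hAA (u) : A (A u) = u := by
    obtain ⟨x, a, y, rfl⟩ := exists_split hg u
    simp only [A, map_add, A1, A2, map_neg, neg_neg]
  have hAo (u v) : pairing (A u) (A v) = pairing u v := by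
    obtain ⟨x, a, y, rfl⟩ := exists_split hg u
    obtain ⟨x', a', y', rfl⟩ := exists_split hg v
    simp only [A, map_add, A1, A2, minusPart_neg, pairing_split hg, map_neg, LinearMap.neg_apply,
      neg_neg]
  have hAB (u) : A (B u) = B (A u) := by
    obtain ⟨x, a, y, rfl⟩ := exists_split hg u
    simp only [A, map_add, A1, A2, B1, B2, map_neg]
  have hBs (u v) : pairing (B u) v = -pairing u (B v) := by
    obtain ⟨x, a, y, rfl⟩ := exists_split hg u
    obtain ⟨x', a', y', rfl⟩ := exists_split hg v
    simp only [map_add, B1, B2, pairing_split hg, LinearMap.add_apply, map_smul, smul_eq_mul,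
      LinearMap.smul_apply, hp.skew, hm.skew, hg.1 x Xp]
    ring
  -- On `E₊` the term `-g(X₊, x) X₊` cancels the defect `J₊² x = -x + g(X₊, x) X₊`, so `B² = -1`
  -- there. On `E₋` the defect of `J₋²` gives the rank-one term.
  have hB2 (u) : B (B u) = -u + ((-1) ^ 3 * pairing u (minusPart g Xm)) • minusPart g Xm := by
    obtain ⟨x, a, y, rfl⟩ := exists_split hg u
    have h : minusPart g Xm = plusPart g 0 0 + minusPart g Xm := by simp [plusPart]
    conv_rhs => rw [h, pairing_split hg, ← h]
    simp only [map_add, B1, B2, hp.square_eq hXp, hm.square_eq hXm, map_smul, hp.kernel,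
      hp.apply_left hg, hXp, neg_add, plusPart_neg, minusPart_neg, minusPart_smul, add_assoc,
      minusPart_add]
    congr 1
    · congr 1
      · module
      · simp
    · congr 2
      rw [hg.1 y Xm]
      simp only [map_zero, mul_zero, zero_sub, add_zero]
      module
  have hB0 : B (minusPart g Xm) = 0 := by
    rw [B2, hm.kernel]
    simp [minusPart]
  have hu0 : pairing (minusPart g Xm) (minusPart g Xm) = (-1 : ℝ) ^ 3 := by
    rw [pairing_minusPart hg, hXm]
    norm_num
  have hDA (u) : A (fiberEnd D u) = fiberEnd D (A u) := by
    obtain ⟨x, a, y, rfl⟩ := exists_split hg u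
    simp only [A, map_add, A1, A2, map_neg, fiberEnd_plusPart hD, fiberEnd_minusPart hD]
  have hDB (u) : B (fiberEnd D u) = fiberEnd D (B u) := by
    obtain ⟨x, a, y, rfl⟩ := exists_split hg u
    have h : g Xp (D x) = 0 := by
      rw [← neg_eq_zero, ← hD, hDX]
      simp
    simp only [map_add, B1, B2, fiberEnd_plusPart hD, fiberEnd_minusPart hD, hDp, hDm, map_smul,
      hDX, smul_zero, zero_smul, h, neg_zero]
  -- `A` is an orthogonal involution, hence self-adjoint, and it commutes with the skew `B`.
  have hCs (u v) : pairing ((A * B) u) v = -pairing u ((A * B) v) := by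
    simp only [Module.End.mul_apply]
    rw [← hAA v, hAo, hBs, hAA, hAB]
  refine ⟨fun _ => A, fun _ => B, ⟨⟨fun x y z => ?_, fun x y z w => ?_⟩,
    ⟨isSmoothEnd_const A, fun _ => hAA, fun _ => hAo, fun _ x => ?_⟩, fun _ => hAB,
    ⟨⟨isSmoothEnd_const B, fun _ => hBs, fun _ => ⟨minusPart g Xm, hu0, hB0, hB2⟩⟩,
      isIntegrable_const hbr hDB hBs⟩,
    ⟨⟨isSmoothEnd_const (A * B), fun _ => hCs,
      fun _ => ⟨minusPart g Xm, hu0, ?_, fun u => ?_⟩⟩,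
      isIntegrable_const hbr (fun u => ?_) hCs⟩⟩,
    ⟨hg, fun _ x => ?_, fun _ x a => ?_, fun _ x => ?_, fun _ => ?_, ?_, fun _ x a => ?_⟩⟩
  · simp
  · simp
  · refine ⟨minusPart g x, ⟨A2 x, rfl⟩, ?_⟩
    rintro u ⟨hu, hux⟩
    obtain ⟨y, a, z, rfl⟩ := exists_split hg u
    simp only [A, map_add, A1, A2, neg_add] at hu
    have h : (2 : ℝ) • plusPart g y a = 0 := by
      have := add_right_cancel hu
      rw [two_smul]
      nth_rw 1 [this]
      simp
    have h' := (smul_eq_zero.1 h).resolve_left two_ne_zero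
    rw [h', zero_add] at hux ⊢
    rw [← hux]
    rfl
  · simp only [Module.End.mul_apply, hB0, map_zero]
  · simp only [Module.End.mul_apply]
    rw [hAB, hAA, hB2]
  · simp only [Module.End.mul_apply]
    rw [hDB, hDA]
  · exact A2 x
  · exact A1 x a
  · exact B2 x
  · exact hB0
  · exact hu0.trans (by norm_num)
  · exact B1 x a

end Three

/-! ### Sign and linearity rules for alternating forms of degree two and three. -/

section Alternating

variable {V : Type*} [AddCommGroup V] [Module ℝ V]

lemma alternating_two_swap (F : V [⋀^Fin 2]→ₗ[ℝ] ℝ) (x y : V) : F ![x, y] = -F ![y, x] := by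
  have h := F.map_swap ![y, x] (i := 0) (j := 1) (by decide)
  rw [← h]
  congr 1
  ext i
  fin_cases i <;> rfl

lemma alternating_two_self (F : V [⋀^Fin 2]→ₗ[ℝ] ℝ) (x : V) : F ![x, x] = 0 := by
  linarith [alternating_two_swap F x x]

lemma alternating_two_smul_left (F : V [⋀^Fin 2]→ₗ[ℝ] ℝ) (c : ℝ) (x y : V) :
    F ![c • x, y] = c * F ![x, y] := by
  rw [alternating_two_swap, alternating_two_smul, alternating_two_swap F x]
  ring

lemma alternating_two_add_left (F : V [⋀^Fin 2]→ₗ[ℝ] ℝ) (x y z : V) :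
    F ![x + y, z] = F ![x, z] + F ![y, z] := by
  rw [alternating_two_swap, alternating_two_add, alternating_two_swap F x,
    alternating_two_swap F y]
  ring

lemma alternating_two_neg_left (F : V [⋀^Fin 2]→ₗ[ℝ] ℝ) (x y : V) :
    F ![-x, y] = -F ![x, y] := by
  rw [← neg_one_smul ℝ, alternating_two_smul_left, neg_one_mul]

lemma alternating_two_zero_left (F : V [⋀^Fin 2]→ₗ[ℝ] ℝ) (x : V) : F ![0, x] = 0 := by
  rw [← zero_smul ℝ (0 : V), alternating_two_smul_left, zero_mul]

lemma alternating_three_swap_left (H : V [⋀^Fin 3]→ₗ[ℝ] ℝ) (x y z : V) :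
    H ![x, y, z] = -H ![y, x, z] := by
  have h := H.map_swap ![y, x, z] (i := 0) (j := 1) (by decide)
  rw [← h]
  congr 1
  ext i
  fin_cases i <;> rfl

lemma alternating_three_swap_right (H : V [⋀^Fin 3]→ₗ[ℝ] ℝ) (x y z : V) :
    H ![x, y, z] = -H ![x, z, y] := by
  have h := H.map_swap ![x, z, y] (i := 1) (j := 2) (by decide)
  rw [← h]
  congr 1
  ext i
  fin_cases i <;> rfl

lemma alternating_three_rotate (H : V [⋀^Fin 3]→ₗ[ℝ] ℝ) (x y z : V) :
    H ![x, y, z] = H ![y, z, x] := by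
  rw [alternating_three_swap_left, alternating_three_swap_right, neg_neg]

lemma alternating_three_self_left (H : V [⋀^Fin 3]→ₗ[ℝ] ℝ) (x z : V) : H ![x, x, z] = 0 := by
  linarith [alternating_three_swap_left H x x z]

lemma alternating_three_self_right (H : V [⋀^Fin 3]→ₗ[ℝ] ℝ) (x z : V) : H ![x, z, z] = 0 := by
  linarith [alternating_three_swap_right H x z z]

lemma alternating_three_smul_left (H : V [⋀^Fin 3]→ₗ[ℝ] ℝ) (c : ℝ) (x y z : V) :
    H ![c • x, y, z] = c * H ![x, y, z] := by
  rw [alternating_three_rotate, alternating_three_smul, ← alternating_three_rotate]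

lemma alternating_three_add_left (H : V [⋀^Fin 3]→ₗ[ℝ] ℝ) (x x' y z : V) :
    H ![x + x', y, z] = H ![x, y, z] + H ![x', y, z] := by
  rw [alternating_three_rotate, alternating_three_add, ← alternating_three_rotate H x,
    ← alternating_three_rotate H x']

lemma alternating_three_neg_left (H : V [⋀^Fin 3]→ₗ[ℝ] ℝ) (x y z : V) :
    H ![-x, y, z] = -H ![x, y, z] := by
  rw [← neg_one_smul ℝ, alternating_three_smul_left, neg_one_mul]

lemma alternating_three_zero_left (H : V [⋀^Fin 3]→ₗ[ℝ] ℝ) (x y : V) : H ![0, x, y] = 0 := by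
  rw [← zero_smul ℝ (0 : V), alternating_three_smul_left, zero_mul]

end Alternating

/-! ### Consequences of integrability for the components. -/

section Necessary

variable {G : Type*} [TopologicalSpace G] [ChartedSpace (EuclideanSpace ℝ (Fin 3)) G]
  [Group G] [LieGroup (𝓡 3) ∞ G]
  {H : GroupLieAlgebra (𝓡 3) G [⋀^Fin 3]→ₗ[ℝ] ℝ} {F : GroupLieAlgebra (𝓡 3) G [⋀^Fin 2]→ₗ[ℝ] ℝ}
  {𝒢 𝓕 : G → Module.End ℝ (Fiber 3 G)}
  {g : GroupLieAlgebra (𝓡 3) G →ₗ[ℝ] GroupLieAlgebra (𝓡 3) G →ₗ[ℝ] ℝ}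
  {Jp Jm : Module.End ℝ (GroupLieAlgebra (𝓡 3) G)} {Xp Xm : GroupLieAlgebra (𝓡 3) G}

lemma HasComponents.norm_minus (hc : HasComponents 𝒢 𝓕 g Jp Jm Xp Xm) : g Xm Xm = 1 := by
  have h := hc.norm
  rw [← minusPart, pairing_minusPart hc.metric] at h
  linarith

/-- The vector `u₀` of the definition can be taken to be `u₋`: evaluating `𝓕²` on the kernel vector
`u₋` gives `u₋ = t u₀`, and comparing norms gives `t² = 1`, so the sign drops out. -/
lemma IsPseudoKahler.square (hk : IsPseudoKahler H F 𝒢 𝓕)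
    (hc : HasComponents 𝒢 𝓕 g Jp Jm Xp Xm) (p : G) (u : Fiber 3 G) :
    𝓕 p (𝓕 p u) = -u - pairing u (minusPart g Xm) • minusPart g Xm := by
  obtain ⟨u₀, hn, -, hsq⟩ := hk.complex₁.1.square p
  have hk0 : 𝓕 p (minusPart g Xm) = 0 := hc.kernel p
  have hn' : pairing (minusPart g Xm) (minusPart g Xm) = -1 := hc.norm
  have h := hsq (minusPart g Xm)
  rw [hk0, map_zero] at h
  set t := (-1) ^ 3 * pairing (minusPart g Xm) u₀ with ht
  have hu : minusPart g Xm = t • u₀ := by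
    rw [← sub_eq_zero, ← neg_eq_zero, h]
    abel
  have ht2 : t * t = 1 := by
    rw [hu, pairing_smul_left, pairing_comm, pairing_smul_left, hn] at hn'
    linarith
  rw [hsq, hu, pairing_comm u (t • u₀), pairing_smul_left, smul_smul, pairing_comm u₀ u,
    mul_right_comm, ht2]
  module

lemma plusPart_inj {x y : GroupLieAlgebra (𝓡 3) G} {a b : ℝ}
    (h : plusPart g x a = plusPart g y b) : x = y ∧ a = b :=
  ⟨congrArg Prod.fst h, congrArg (fun u => u.2.2) h⟩

/-- `𝓕` maps the scalar section `1` to `X₊ + g X₊`, and this to `J₊ X₊ + g J₊ X₊ - g(X₊, X₊)`. Both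
claims follow since `𝓕² = -1` on `E₊`. -/
lemma IsPseudoKahler.norm_plus (hk : IsPseudoKahler H F 𝒢 𝓕)
    (hc : HasComponents 𝒢 𝓕 g Jp Jm Xp Xm) : g Xp Xp = 1 ∧ Jp Xp = 0 := by
  have B1 : ∀ x a, 𝓕 1 (plusPart g x a) = plusPart g (Jp x + a • Xp) (-g Xp x) := hc.endo_plus 1
  have h := hk.square hc 1 (plusPart g 0 1)
  rw [pairing_plusPart_minusPart hc.metric, B1, B1, zero_smul, sub_zero, plusPart_neg] at h
  have h' := plusPart_inj h
  simp only [map_zero, one_smul, zero_add, neg_zero, zero_smul, add_zero] at h'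
  exact ⟨by linarith [h'.2], h'.1⟩

lemma IsPseudoKahler.transverse_plus (hk : IsPseudoKahler H F 𝒢 𝓕)
    (hc : HasComponents 𝒢 𝓕 g Jp Jm Xp Xm) : IsTransverseComplex g Jp Xp := by
  have B1 : ∀ x a, 𝓕 1 (plusPart g x a) = plusPart g (Jp x + a • Xp) (-g Xp x) := hc.endo_plus 1
  refine ⟨fun x y => ?_, (hk.norm_plus hc).2, fun x hx => ?_⟩
  · have h := hk.complex₁.1.skew 1 (plusPart g x 0) (plusPart g y 0)
    rw [B1, B1, pairing_plusPart hc.metric, pairing_plusPart hc.metric] at h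
    simpa using h
  · have h := hk.square hc 1 (plusPart g x 0)
    rw [pairing_plusPart_minusPart hc.metric, B1, B1, zero_smul, zero_smul, sub_zero,
      plusPart_neg] at h
    have h' := (plusPart_inj h).1
    simpa [hx] using h'

lemma IsPseudoKahler.transverse_minus (hk : IsPseudoKahler H F 𝒢 𝓕)
    (hc : HasComponents 𝒢 𝓕 g Jp Jm Xp Xm) : IsTransverseComplex g Jm Xm := by
  have B2 : ∀ x, 𝓕 1 (minusPart g x) = minusPart g (Jm x) := hc.endo_minus 1
  refine ⟨fun x y => ?_, ?_, fun x hx => ?_⟩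
  · have h := hk.complex₁.1.skew 1 (minusPart g x) (minusPart g y)
    rw [B2, B2, pairing_minusPart hc.metric, pairing_minusPart hc.metric] at h
    linarith
  · exact minusPart_eq_zero ((B2 Xm).symm.trans (hc.kernel 1))
  · have h := hk.square hc 1 (minusPart g x)
    rw [pairing_minusPart hc.metric, hc.metric.1, hx, B2, B2] at h
    simpa [minusPart] using congrArg Prod.fst h

lemma dorfman_plusPart_minusPart (x y z : GroupLieAlgebra (𝓡 3) G) (a : ℝ)
    (p : G) :
    2 * pairing (dorfman H F (constSection 3 G (plusPart g x a))
      (constSection 3 G (minusPart g y)) p) (minusPart g z)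
      = g x ⁅y, z⁆ + g y ⁅x, z⁆ - g z ⁅x, y⁆ + H ![y, x, z] + 2 * a * F ![y, z] := by
  obtain ⟨h1, h2, h3⟩ := dorfman_constSection H F (plusPart g x a) (minusPart g y) p
  simp only [pairing]
  rw [h1, h2]
  simp only [plusPart, minusPart, LinearMap.neg_apply]
  ring

lemma dorfman_plusPart_plusPart (x y z : GroupLieAlgebra (𝓡 3) G) (a b : ℝ)
    (p : G) :
    2 * pairing (dorfman H F (constSection 3 G (plusPart g x a))
      (constSection 3 G (plusPart g y b)) p) (minusPart g z)
      = g x ⁅y, z⁆ - g y ⁅x, z⁆ - g z ⁅x, y⁆ + H ![y, x, z]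
        - 2 * (b * F ![x, z] - a * F ![y, z]) := by
  obtain ⟨h1, h2, h3⟩ := dorfman_constSection H F (plusPart g x a) (plusPart g y b) p
  simp only [pairing]
  rw [h1, h2]
  simp only [plusPart, minusPart, LinearMap.neg_apply]
  ring

lemma pairing_minusPart_of_fixed {A : Module.End ℝ (Fiber 3 G)}
    (ho : ∀ u v, pairing (A u) (A v) = pairing u v)
    (hm : ∀ x, A (minusPart g x) = -minusPart g x) {u : Fiber 3 G} (hu : A u = u)
    (z : GroupLieAlgebra (𝓡 3) G) : pairing u (minusPart g z) = 0 := by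
  have h := ho u (minusPart g z)
  rw [hu, hm, pairing_comm, pairing_neg_left, pairing_comm] at h
  linarith

/-- The vanishing of the torsion terms `⟨[E₊, E₋], u₋⟩`, on the complement of `u₋`. -/
lemma IsPseudoKahler.killing_of_orthogonal (hk : IsPseudoKahler H F 𝒢 𝓕)
    (hc : HasComponents 𝒢 𝓕 g Jp Jm Xp Xm) (x y : GroupLieAlgebra (𝓡 3) G) (a : ℝ)
    (hy : g Xm y = 0) :
    g x ⁅y, Xm⁆ + g y ⁅x, Xm⁆ - g Xm ⁅x, y⁆ + H ![y, x, Xm] + 2 * a * F ![y, Xm] = 0 := by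
  have B1 : ∀ p x a, 𝓕 p (plusPart g x a) = plusPart g (Jp x + a • Xp) (-g Xp x) := hc.endo_plus
  have B2 : ∀ p x, 𝓕 p (minusPart g x) = minusPart g (Jm x) := hc.endo_minus
  have A1 : ∀ p x a, 𝒢 p (plusPart g x a) = plusPart g x a := hc.plus
  have A2 : ∀ p x, 𝒢 p (minusPart g x) = -minusPart g x := hc.minus
  have hsp (p : G) : 𝓕 p (𝓕 p (plusPart g x a)) = -plusPart g x a := by
    rw [hk.square hc, pairing_plusPart_minusPart hc.metric, zero_smul, sub_zero]
  have hsm (p : G) : 𝓕 p (𝓕 p (minusPart g y)) = -minusPart g y := by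
    rw [hk.square hc, pairing_minusPart hc.metric, hc.metric.1, hy, neg_zero, zero_smul, sub_zero]
  set u := plusPart g x a
  set u' := plusPart g (Jp x + a • Xp) (-g Xp x)
  have hu : ∀ p, 𝓕 p u = u' := fun p => B1 p x a
  have hu' : ∀ p, 𝓕 p u' = -u := fun p => by rw [← hu p, hsp]
  have hw' : ∀ p, 𝓕 p (minusPart g (Jm y)) = -minusPart g y := fun p => by rw [← B2 p, hsm]
  have huA : ∀ p, 𝒢 p u = u := fun p => A1 p _ _
  have huA' : ∀ p, 𝒢 p u' = u' := fun p => A1 p _ _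
  -- An eigenvector of a skew `𝓐` for the eigenvalue `i` is orthogonal to its kernel, hence to `u₋`.
  -- The real part of this orthogonality for the bracket of two eigensections is the claim.
  have key (𝓐 : G → Module.End ℝ (Fiber 3 G)) (hs : ∀ p u v, pairing (𝓐 p u) v = -pairing u (𝓐 p v))
      (hX : ∀ p, 𝓐 p (minusPart g Xm) = 0) (hI : IsIntegrable H F 𝓐)
      (v w v' w' : Fiber 3 G) (h1 : ∀ p, 𝓐 p v = -v' ∧ 𝓐 p v' = v)
      (h2 : ∀ p, 𝓐 p w = -w' ∧ 𝓐 p w' = w) :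
      pairing (dorfman H F (constSection 3 G v) (constSection 3 G w) 1) (minusPart g Xm)
        = pairing (dorfman H F (constSection 3 G v') (constSection 3 G w') 1)
          (minusPart g Xm) := by
    have h := (hI (constSection 3 G v) (constSection 3 G v') (constSection 3 G w)
      (constSection 3 G w') h1 h2 1).2
    have h' := hs 1 (dorfman H F (constSection 3 G v) (constSection 3 G w') 1
      + dorfman H F (constSection 3 G v') (constSection 3 G w) 1) (minusPart g Xm)
    rw [h, hX] at h'
    beta_reduce at h'
    rw [sub_eq_add_neg, pairing_add_left, pairing_neg_left,
      pairing_comm _ (0 : Fiber 3 G)] at h'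
    simp only [pairing, Prod.fst_zero, Prod.snd_zero, LinearMap.zero_apply, map_zero] at h' ⊢
    linarith
  have k1 := key 𝓕 hk.complex₁.1.skew hc.kernel hk.complex₁.2 u (minusPart g y) (-u')
    (-minusPart g (Jm y)) (fun p => ⟨by rw [neg_neg, hu], by rw [map_neg, hu', neg_neg]⟩)
    (fun p => ⟨by rw [neg_neg, B2], by rw [map_neg, hw', neg_neg]⟩)
  -- On `E₋` passing from `𝓕` to `𝒢𝓕` changes the sign of the imaginary part, whereas on `E₊`
  -- nothing changes. So `k1` and `k2` equate `⟨[u, w], u₋⟩` with opposite numbers, and it vanishes.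
  have k2 := key _ hk.complex₂.1.skew
    (fun p => by
      rw [Module.End.mul_apply, show 𝓕 p (minusPart g Xm) = 0 from hc.kernel p, map_zero])
    hk.complex₂.2 u (minusPart g y) (-u') (minusPart g (Jm y))
    (fun p => ⟨by rw [neg_neg, Module.End.mul_apply, hu, huA'],
      by rw [Module.End.mul_apply, map_neg, hu', neg_neg, huA]⟩)
    (fun p => ⟨by rw [Module.End.mul_apply, B2, A2],
      by rw [Module.End.mul_apply, hw', map_neg, A2, neg_neg]⟩)
  simp only [u', minusPart_neg, plusPart_neg] at k1 k2
  have e := dorfman_plusPart_minusPart (H := H) (F := F) (g := g) x y Xm a 1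
  have e1 := dorfman_plusPart_minusPart (H := H) (F := F) (g := g) (-(Jp x + a • Xp)) (-Jm y) Xm
    (- -g Xp x) 1
  have e2 := dorfman_plusPart_minusPart (H := H) (F := F) (g := g) (-(Jp x + a • Xp)) (Jm y) Xm
    (- -g Xp x) 1
  rw [← k1] at e1
  rw [← k2] at e2
  simp only [neg_lie, lie_neg, map_neg, LinearMap.neg_apply, alternating_two_neg_left,
    alternating_three_neg_left] at e1 e2
  linarith

/-- The vanishing of the torsion terms `⟨[E₊, E₋], u₋⟩`. -/
lemma IsPseudoKahler.killing (hk : IsPseudoKahler H F 𝒢 𝓕)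
    (hc : HasComponents 𝒢 𝓕 g Jp Jm Xp Xm) (x y : GroupLieAlgebra (𝓡 3) G) (a : ℝ) :
    g x ⁅y, Xm⁆ + g y ⁅x, Xm⁆ - g Xm ⁅x, y⁆ + H ![y, x, Xm] + 2 * a * F ![y, Xm] = 0 := by
  -- The expression is linear in `y` and vanishes identically at `y = X₋`, so `y` may be replaced by
  -- its projection to the complement of `X₋`.
  have hy : g Xm (y + (-g Xm y) • Xm) = 0 := by
    rw [map_add, map_smul, hc.norm_minus, smul_eq_mul]
    ring
  have h := hk.killing_of_orthogonal hc x _ a hy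
  rw [alternating_three_add_left, alternating_three_smul_left, alternating_two_add_left,
    alternating_two_smul_left, alternating_two_self, alternating_three_rotate H Xm,
    alternating_three_self_right, add_lie, smul_lie, lie_self, smul_zero, add_zero, lie_add,
    lie_smul, map_add, map_smul, map_add, map_smul, LinearMap.add_apply, LinearMap.smul_apply,
    smul_eq_mul] at h
  linarith

/-- The component `⟨[E₊, E₊], E₋⟩` of the torsion is of type `(1, 1)`. -/
lemma IsPseudoKahler.torsion_plus (hk : IsPseudoKahler H F 𝒢 𝓕)
    (hc : HasComponents 𝒢 𝓕 g Jp Jm Xp Xm) (x z : GroupLieAlgebra (𝓡 3) G) :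
    g x ⁅Xp, z⁆ - g Xp ⁅x, z⁆ - g z ⁅x, Xp⁆ + H ![Xp, x, z] = 2 * F ![Jp x, z] := by
  have B1 : ∀ p x a, 𝓕 p (plusPart g x a) = plusPart g (Jp x + a • Xp) (-g Xp x) := hc.endo_plus
  have A1 : ∀ p x a, 𝒢 p (plusPart g x a) = plusPart g x a := hc.plus
  have A2 : ∀ p x, 𝒢 p (minusPart g x) = -minusPart g x := hc.minus
  have hsp (p : G) (x : GroupLieAlgebra (𝓡 3) G) (a : ℝ) :
      𝓕 p (𝓕 p (plusPart g x a)) = -plusPart g x a := by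
    rw [hk.square hc, pairing_plusPart_minusPart hc.metric, zero_smul, sub_zero]
  have hI (x : GroupLieAlgebra (𝓡 3) G) (a : ℝ) :
      IsEigenSection 𝓕 (constSection 3 G (plusPart g x a)).1
        (constSection 3 G (-plusPart g (Jp x + a • Xp) (-g Xp x))).1 := fun p =>
    ⟨(B1 p x a).trans (neg_neg _).symm, by
      change 𝓕 p (-plusPart g (Jp x + a • Xp) (-g Xp x)) = plusPart g x a
      rw [map_neg, ← B1 p, hsp, neg_neg]⟩
  have hI' (x : GroupLieAlgebra (𝓡 3) G) (a : ℝ) :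
      IsEigenSection (fun p => 𝒢 p * 𝓕 p) (constSection 3 G (plusPart g x a)).1
        (constSection 3 G (-plusPart g (Jp x + a • Xp) (-g Xp x))).1 := fun p =>
    ⟨by rw [Module.End.mul_apply, (hI x a p).1]; simp [constSection, A1],
      by rw [Module.End.mul_apply, (hI x a p).2]; simp [constSection, A1]⟩
  -- The same eigensections of `E₊` serve for `𝓕` and `𝒢𝓕`. Comparing the two conclusions shows that
  -- the real part of their bracket is fixed by `𝒢`, hence orthogonal to `E₋`. The partner of `X₊`
  -- is the scalar section `1`, which is where `F` enters.
  have h1 := (hk.complex₁.2 _ _ _ _ (hI x 0) (hI Xp 0) 1).2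
  have h2 := (hk.complex₂.2 _ _ _ _ (hI' x 0) (hI' Xp 0) 1).2
  rw [Module.End.mul_apply, h1] at h2
  have h := pairing_minusPart_of_fixed (hk.metric.orth 1) (A2 1) h2 z
  beta_reduce at h
  rw [sub_eq_add_neg, pairing_add_left, pairing_neg_left] at h
  have e1 := dorfman_plusPart_plusPart (H := H) (F := F) (g := g) x Xp z 0 0 1
  simp only [plusPart_neg, (hk.norm_plus hc).1, (hk.norm_plus hc).2, zero_smul, add_zero,
    neg_zero, neg_neg] at h
  have e2 := dorfman_plusPart_plusPart (H := H) (F := F) (g := g) (-Jp x) 0 z (g Xp x) 1 1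
  simp only [zero_lie, lie_zero, map_zero, LinearMap.zero_apply, alternating_two_neg_left,
    alternating_two_zero_left, alternating_three_zero_left] at e2
  linarith

end Necessary

/-! ### Orthogonal bases of eigenvectors for an indefinite metric. -/

section Orthonormal

variable {V : Type*} [AddCommGroup V] [Module ℝ V] {g : V →ₗ[ℝ] V →ₗ[ℝ] ℝ}

lemma IsMetric.ext_basis (hg : IsMetric g) {ι : Type*} (v : Module.Basis ι ℝ V) {x y : V}
    (h : ∀ j, g x (v j) = g y (v j)) : x = y := by
  rw [← sub_eq_zero]
  refine hg.2 _ fun z => ?_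
  have : g (x - y) = 0 := v.ext fun j => by simp [h]
  rw [this, LinearMap.zero_apply]

lemma IsMetric.apply_self_ne_zero (hg : IsMetric g) {ι : Type*} (v : Module.Basis ι ℝ V)
    (h : ∀ i j, i ≠ j → g (v i) (v j) = 0) (i : ι) : g (v i) (v i) ≠ 0 := by
  intro hi
  refine v.ne_zero i (hg.ext_basis v fun j => ?_)
  rw [map_zero, LinearMap.zero_apply]
  by_cases hij : i = j
  · rw [← hij, hi]
  · exact h i j hij

/-- A diagonalizable endomorphism which is symmetric for a metric has an orthogonal basis of
eigenvectors. -/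
lemma IsMetric.exists_orthogonal_eigenbasis (hg : IsMetric g) [FiniteDimensional ℝ V]
    {L : Module.End ℝ V} (hL : ∀ x y, g (L x) y = g x (L y)) {ι : Type*} [Fintype ι]
    (b : Module.Basis ι ℝ V) (μ : ι → ℝ) (hb : ∀ i, L (b i) = μ i • b i) :
    ∃ (v : Module.Basis ι ℝ V) (μ' : ι → ℝ), (∀ i, L (v i) = μ' i • v i) ∧
      ∀ i j, i ≠ j → g (v i) (v j) = 0 := by
  classical
  have htop : iSup L.eigenspace = ⊤ := by
    rw [eq_top_iff, ← b.span_eq, Submodule.span_le]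
    rintro _ ⟨i, rfl⟩
    exact Submodule.mem_iSup_of_mem (μ i) (Module.End.mem_eigenspace_iff.2 (hb i))
  have hint := DirectSum.isInternal_submodule_of_iSupIndep_of_iSup_eq_top
    L.eigenspaces_iSupIndep htop
  have : Invertible (2 : ℝ) := invertibleOfNonzero two_ne_zero
  -- Each eigenspace has an orthogonal basis by symmetry of the restricted form alone; distinct
  -- eigenspaces are orthogonal because `L` is symmetric.
  have hex (t : ℝ) : ∃ w : Module.Basis (Fin (Module.finrank ℝ (L.eigenspace t))) ℝ
      (L.eigenspace t), LinearMap.IsOrthoᵢ (g.domRestrict₁₂ _ _) w :=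
    LinearMap.BilinForm.exists_orthogonal_basis ⟨fun x y => hg.1 x y⟩
  choose w hw using hex
  let c := hint.collectedBasis w
  let e := c.indexEquiv b
  have hc (a) : L (c a) = a.1 • c a :=
    Module.End.mem_eigenspace_iff.1 (hint.collectedBasis_mem w a)
  have hco (a a') (h : a ≠ a') : g (c a) (c a') = 0 := by
    obtain ⟨t, i⟩ := a
    obtain ⟨t', i'⟩ := a'
    by_cases ht : t = t'
    · subst ht
      have hi : i ≠ i' := fun hi => h (by rw [hi])
      simp only [c, DirectSum.IsInternal.collectedBasis_coe]
      exact hw t hi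
    · have h1 := hL (c ⟨t, i⟩) (c ⟨t', i'⟩)
      rw [hc, hc, map_smul, map_smul, LinearMap.smul_apply, smul_eq_mul, smul_eq_mul,
        ← sub_eq_zero, ← sub_mul] at h1
      exact (mul_eq_zero.1 h1).resolve_left (sub_ne_zero.2 ht)
  refine ⟨c.reindex e, fun i => (e.symm i).1, fun i => ?_, fun i j hij => ?_⟩
  · rw [Module.Basis.reindex_apply, hc]
  · rw [Module.Basis.reindex_apply, Module.Basis.reindex_apply]
    exact hco _ _ (fun h => hij (e.symm.injective h))

end Orthonormal

/-! ### The canonical operator and Milnor bases, with indices taken modulo three. -/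

section Canonical

variable {V : Type*} [LieRing V] [LieAlgebra ℝ V] {g : V →ₗ[ℝ] V →ₗ[ℝ] ℝ}
  {v : Module.Basis (Fin 3) ℝ V}

lemma fin_three_cases : ∀ i j : Fin 3, j = i ∨ j = i + 1 ∨ j = i + 2 := by decide

lemma fin_three_cases' : ∀ i j : Fin 3,
    i = j ∨ ∃ k : Fin 3, (i = k + 1 ∧ j = k + 2) ∨ (i = k + 2 ∧ j = k + 1) := by decide

lemma fin_three_add : ∀ i : Fin 3, i ≠ i + 1 ∧ i ≠ i + 2 ∧ i + 1 + 1 = i + 2 ∧ i + 1 + 2 = i ∧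
    i + 2 + 1 = i ∧ i + 2 + 2 = i + 1 := by decide

lemma IsMetric.exists_orthonormal_of_orthogonal (hg : IsMetric g) (b : Module.Basis (Fin 3) ℝ V)
    (h : ∀ i j, i ≠ j → g (b i) (b j) = 0) :
    ∃ v : Module.Basis (Fin 3) ℝ V, IsOrthonormalBasis g v ∧
      ∃ c : Fin 3 → ℝ, ∀ i, v i = c i • b i := by
  have hne := hg.apply_self_ne_zero b h
  have hs (i) : √|g (b i) (b i)| ≠ 0 := (Real.sqrt_pos.2 (abs_pos.2 (hne i))).ne'
  have hc (i) : IsUnit (√|g (b i) (b i)|)⁻¹ := (inv_ne_zero (hs i)).isUnit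
  refine ⟨b.isUnitSMul hc, ⟨fun i j hij => ?_, fun i => ?_⟩, _, fun i => b.isUnitSMul_apply hc i⟩
  · simp [Module.Basis.isUnitSMul_apply, h i j hij]
  · have hsq := Real.mul_self_sqrt (abs_nonneg (g (b i) (b i)))
    have key : g (b.isUnitSMul hc i) (b.isUnitSMul hc i)
        = (|g (b i) (b i)|)⁻¹ * g (b i) (b i) := by
      rw [Module.Basis.isUnitSMul_apply, map_smul, map_smul, LinearMap.smul_apply, smul_eq_mul,
        smul_eq_mul, ← mul_assoc, ← mul_inv, hsq]
    rw [key]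
    rcases lt_or_gt_of_ne (hne i) with hi | hi
    · right
      rw [abs_of_neg hi, inv_neg, neg_mul, inv_mul_cancel₀ (hne i)]
    · left
      rw [abs_of_pos hi, inv_mul_cancel₀ (hne i)]

lemma IsOrthonormalBasis.mul_self (hv : IsOrthonormalBasis g v) (i : Fin 3) :
    g (v i) (v i) * g (v i) (v i) = 1 := by
  rcases hv.2 i with h | h <;> rw [h] <;> norm_num

lemma IsOrthonormalBasis.repr_eq (hv : IsOrthonormalBasis g v) (x : V) (i : Fin 3) :
    v.repr x i = g (v i) (v i) * g x (v i) := by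
  have h : g x (v i) = ∑ j, v.repr x j * g (v j) (v i) := by
    conv_lhs => rw [← v.sum_repr x]
    simp only [map_sum, map_smul, LinearMap.sum_apply, LinearMap.smul_apply, smul_eq_mul]
  rw [h, Finset.sum_eq_single i (fun j _ hj => by rw [hv.1 j i hj, mul_zero]) (by simp),
    mul_left_comm, hv.mul_self, mul_one]

lemma cross_eq (hg : IsMetric g) (hv : IsOrthonormalBasis g v) {vol : V [⋀^Fin 3]→ₗ[ℝ] ℝ}
    {cross : V → V → V} (hc : ∀ x y z, g (cross x y) z = vol ![x, y, z]) (i : Fin 3) :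
    cross (v (i + 1)) (v (i + 2)) = (vol v * g (v i) (v i)) • v i := by
  have hvol : vol v = vol ![v i, v (i + 1), v (i + 2)] := by
    have h0 : (v : Fin 3 → V) = ![v 0, v 1, v 2] := by ext j; fin_cases j <;> rfl
    rw [h0]
    fin_cases i
    · rfl
    · exact alternating_three_rotate vol _ _ _
    · exact (alternating_three_rotate vol _ _ _).trans (alternating_three_rotate vol _ _ _)
  refine hg.ext_basis v fun j => ?_
  rw [hc, map_smul, LinearMap.smul_apply, smul_eq_mul]
  rcases fin_three_cases i j with rfl | rfl | rfl
  · rw [mul_assoc, hv.mul_self, mul_one, hvol, alternating_three_rotate vol (v j)]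
  · rw [hv.1 i (i + 1) (fin_three_add i).1, mul_zero, alternating_three_rotate,
      alternating_three_self_right]
  · rw [hv.1 i (i + 2) (fin_three_add i).2.1, mul_zero, alternating_three_self_right]

/-- `v` is a `g`-orthonormal basis with `[v₁, v₂] = ε₃ λ₃ v₃` and its cyclic permutations. -/
structure IsMilnorBasis (g : V →ₗ[ℝ] V →ₗ[ℝ] ℝ) (v : Module.Basis (Fin 3) ℝ V)
    (l : Fin 3 → ℝ) : Prop where
  orthonormal : IsOrthonormalBasis g v
  lie : ∀ i, ⁅v (i + 1), v (i + 2)⁆ = (g (v i) (v i) * l i) • v i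

/-- The canonical operator of a unimodular Lie algebra is symmetric. -/
lemma canonicalOperator_symm (hV : IsUnimodular V) (hg : IsMetric g)
    (hv : IsOrthonormalBasis g v) {L : Module.End ℝ V} (hL : IsCanonicalOperator g L) (x y : V) :
    g (L x) y = g x (L y) := by
  obtain ⟨vol, cross, hvol, hc, hb⟩ := hL
  have key (i : Fin 3) : g (L (v (i + 1))) (v (i + 2)) = g (L (v (i + 2))) (v (i + 1)) := by
    -- Up to signs, `ad v_i` maps `v_{i+1}` to `L v_{i+2}` and `v_{i+2}` to `L v_{i+1}`. Its trace
    -- is therefore, up to sign, the difference of two opposite off-diagonal entries of `g(L·, ·)`.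
    have h := hV (v i)
    rw [LinearMap.trace_eq_matrix_trace ℝ v, Matrix.trace] at h
    simp only [Matrix.diag_apply, LinearMap.toMatrix_apply, LieAlgebra.ad_apply, hv.repr_eq] at h
    have hsum (f : Fin 3 → ℝ) : ∑ j, f j = f i + f (i + 1) + f (i + 2) := by
      rw [Fin.sum_univ_three]
      fin_cases i
      · rfl
      · exact (by ring : f 0 + f 1 + f 2 = f 1 + f 2 + f 0)
      · exact (by ring : f 0 + f 1 + f 2 = f 2 + f 0 + f 1)
    have e1 : ⁅v i, v (i + 1)⁆ = (vol v * g (v (i + 2)) (v (i + 2))) • L (v (i + 2)) := by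
      have := cross_eq hg hv hc (i + 2)
      rw [(fin_three_add i).2.2.2.2.1, (fin_three_add i).2.2.2.2.2] at this
      rw [hb, this, map_smul]
    have e2 : ⁅v i, v (i + 2)⁆ = -(vol v * g (v (i + 1)) (v (i + 1))) • L (v (i + 1)) := by
      have := cross_eq hg hv hc (i + 1)
      rw [(fin_three_add i).2.2.1, (fin_three_add i).2.2.2.1] at this
      rw [← lie_skew, hb, this, map_smul, neg_smul]
    rw [hsum, e1, e2, lie_self] at h
    simp only [map_smul, LinearMap.smul_apply, smul_eq_mul, map_zero, LinearMap.zero_apply] at h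
    have s1 := hv.mul_self (i + 1)
    have s2 := hv.mul_self (i + 2)
    have s0 : vol v * vol v = 1 := by rcases hvol v hv with h | h <;> rw [h] <;> norm_num
    have h3 : (vol v * vol v) * (g (v (i + 1)) (v (i + 1)) * g (v (i + 1)) (v (i + 1)))
        * (g (v (i + 2)) (v (i + 2)) * g (v (i + 2)) (v (i + 2)))
        * (g (L (v (i + 2))) (v (i + 1)) - g (L (v (i + 1))) (v (i + 2))) = 0 := by
      linear_combination vol v * g (v (i + 1)) (v (i + 1)) * g (v (i + 2)) (v (i + 2)) * h
    rw [s0, s1, s2] at h3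
    linarith
  have h : g ∘ₗ L = (g ∘ₗ L).flip := by
    refine v.ext fun i => v.ext fun j => ?_
    change g (L (v i)) (v j) = g (L (v j)) (v i)
    rcases fin_three_cases' i j with rfl | ⟨k, ⟨rfl, rfl⟩ | ⟨rfl, rfl⟩⟩
    · rfl
    · exact key k
    · exact (key k).symm
  rw [hg.1 x]
  exact LinearMap.congr_fun₂ h x y

/-- The zero operator is symmetric and diagonal in every basis, so an orthogonal eigenbasis for it
is just an orthogonal basis, which is then normalized. -/
lemma IsMetric.exists_orthonormal [FiniteDimensional ℝ V] (hV : Module.finrank ℝ V = 3)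
    (hg : IsMetric g) : ∃ v : Module.Basis (Fin 3) ℝ V, IsOrthonormalBasis g v := by
  obtain ⟨b, μ, -, hb⟩ := hg.exists_orthogonal_eigenbasis (L := 0) (by simp)
    (Module.finBasisOfFinrankEq ℝ V hV) 0 (by simp)
  obtain ⟨v, hv, -⟩ := hg.exists_orthonormal_of_orthogonal b hb
  exact ⟨v, hv⟩

/-- Normalizing an orthogonal eigenbasis keeps it an eigenbasis, and `v_{i+1} × v_{i+2} = ± ε_i
v_i`. The sign is `vol v` and is absorbed into `l`. -/
theorem exists_milnorBasis [FiniteDimensional ℝ V] (hdim : Module.finrank ℝ V = 3)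
    (hV : IsUnimodular V) (hg : IsMetric g) {L : Module.End ℝ V} (hL : IsCanonicalOperator g L)
    (hd : IsDiagonalizable L) : ∃ (v : Module.Basis (Fin 3) ℝ V) (l : Fin 3 → ℝ),
      IsMilnorBasis g v l := by
  obtain ⟨w, hw⟩ := hg.exists_orthonormal hdim
  obtain ⟨b, μ, hb⟩ := hd
  obtain ⟨b', μ', hb', ho⟩ :=
    hg.exists_orthogonal_eigenbasis (canonicalOperator_symm hV hg hw hL) b μ hb
  obtain ⟨v, hv, c, hc⟩ := hg.exists_orthonormal_of_orthogonal b' ho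
  obtain ⟨vol, cross, hvol, hcr, hbr⟩ := hL
  refine ⟨v, fun i => vol v * μ' i, hv, fun i => ?_⟩
  rw [hbr, cross_eq hg hv hcr, map_smul]
  have : L (v i) = μ' i • v i := by rw [hc, map_smul, hb', smul_comm]
  rw [this, smul_smul]
  ring_nf

/-- Both Gram determinants are `±1` and differ by the square of the determinant of the base change,
which is therefore `1`. -/
lemma IsOrthonormalBasis.det_eq {w : Module.Basis (Fin 3) ℝ V} (hv : IsOrthonormalBasis g v)
    (hw : IsOrthonormalBasis g w) : v.det w = 1 ∨ v.det w = -1 := by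
  have h := congrArg Matrix.det (LinearMap.BilinForm.toMatrix_mul_basis_toMatrix v w g)
  have hdiag {u : Module.Basis (Fin 3) ℝ V} (hu : IsOrthonormalBasis g u) :
      LinearMap.BilinForm.toMatrix u g = Matrix.diagonal fun i => g (u i) (u i) := by
    ext i j
    rw [LinearMap.BilinForm.toMatrix_apply, Matrix.diagonal_apply]
    split_ifs with hij
    · rw [hij]
    · exact hu.1 i j hij
  have hdet {u : Module.Basis (Fin 3) ℝ V} (hu : IsOrthonormalBasis g u) :
      (LinearMap.BilinForm.toMatrix u g).det = 1 ∨ (LinearMap.BilinForm.toMatrix u g).det = -1 := by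
    rw [hdiag hu, Matrix.det_diagonal, Fin.prod_univ_three]
    rcases hu.2 0 with h0 | h0 <;> rcases hu.2 1 with h1 | h1 <;> rcases hu.2 2 with h2 | h2 <;>
      rw [h0, h1, h2] <;> norm_num
  rw [Matrix.det_mul, Matrix.det_mul, Matrix.det_transpose, ← Module.Basis.det_apply] at h
  set d := v.det w
  have : d * d = 1 := by
    have hn := mul_self_nonneg d
    rcases hdet hv with h1 | h1 <;> rcases hdet hw with h2 | h2 <;> rw [h1, h2] at h <;> linarith
  exact mul_self_eq_one_iff.1 this

/-- Orient by `v.det`, write the cross product in coordinates, and let `L` be diagonal with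
eigenvalues `l i`. -/
theorem IsMilnorBasis.exists_canonicalOperator {l : Fin 3 → ℝ} (hv : IsMilnorBasis g v l) :
    ∃ L, IsCanonicalOperator g L ∧ IsDiagonalizable L := by
  refine ⟨v.constr ℝ fun i => l i • v i, ⟨v.det, fun x y =>
    (g (v 0) (v 0) * (v.repr x 1 * v.repr y 2 - v.repr x 2 * v.repr y 1)) • v 0
    + (g (v 1) (v 1) * (v.repr x 2 * v.repr y 0 - v.repr x 0 * v.repr y 2)) • v 1
    + (g (v 2) (v 2) * (v.repr x 0 * v.repr y 1 - v.repr x 1 * v.repr y 0)) • v 2,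
    fun w hw => hv.orthonormal.det_eq hw, fun x y z => ?_, fun x y => ?_⟩,
    v, l, fun i => by rw [Module.Basis.constr_basis]⟩
  · have h (i : Fin 3) : g (v i) z = g (v i) (v i) * v.repr z i := by
      conv_lhs => rw [← v.sum_repr z]
      rw [map_sum, Finset.sum_eq_single i
        (fun j _ hj => by rw [map_smul, hv.orthonormal.1 i j hj.symm, smul_zero]) (by simp),
        map_smul, smul_eq_mul, mul_comm]
    rw [Module.Basis.det_apply, Matrix.det_fin_three]
    simp only [Module.Basis.toMatrix_apply, Matrix.cons_val, map_add, map_smul,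
      LinearMap.add_apply, LinearMap.smul_apply, smul_eq_mul, h]
    linear_combination (v.repr x 1 * v.repr y 2 - v.repr x 2 * v.repr y 1) * v.repr z 0
        * hv.orthonormal.mul_self 0
      + (v.repr x 2 * v.repr y 0 - v.repr x 0 * v.repr y 2) * v.repr z 1
        * hv.orthonormal.mul_self 1
      + (v.repr x 0 * v.repr y 1 - v.repr x 1 * v.repr y 0) * v.repr z 2
        * hv.orthonormal.mul_self 2
  · have h0 : ⁅v 1, v 2⁆ = (g (v 0) (v 0) * l 0) • v 0 := hv.lie 0
    have h1 : ⁅v 2, v 0⁆ = (g (v 1) (v 1) * l 1) • v 1 := hv.lie 1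
    have h2 : ⁅v 0, v 1⁆ = (g (v 2) (v 2) * l 2) • v 2 := hv.lie 2
    have h0' : ⁅v 2, v 1⁆ = -((g (v 0) (v 0) * l 0) • v 0) := by rw [← lie_skew, h0]
    have h1' : ⁅v 0, v 2⁆ = -((g (v 1) (v 1) * l 1) • v 1) := by rw [← lie_skew, h1]
    have h2' : ⁅v 1, v 0⁆ = -((g (v 2) (v 2) * l 2) • v 2) := by rw [← lie_skew, h2]
    conv_lhs => rw [← v.sum_repr x, ← v.sum_repr y]
    simp only [Fin.sum_univ_three, add_lie, lie_add, smul_lie, lie_smul, lie_self, h0, h1, h2,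
      h0', h1', h2', map_add, map_smul, Module.Basis.constr_basis]
    module

end Canonical

/-! ### The integrability conditions in a Milnor basis. -/

section Classification

variable {V : Type*} [LieRing V] [LieAlgebra ℝ V] {g : V →ₗ[ℝ] V →ₗ[ℝ] ℝ}
  {v : Module.Basis (Fin 3) ℝ V} {l : Fin 3 → ℝ}

lemma sum_fin_three_cyclic {M : Type*} [AddCommGroup M] (i : Fin 3) (f : Fin 3 → M) :
    ∑ j, f j = f i + f (i + 1) + f (i + 2) := by
  rw [Fin.sum_univ_three]
  fin_cases i
  · rfl
  · exact (by abel : f 0 + f 1 + f 2 = f 1 + f 2 + f 0)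
  · exact (by abel : f 0 + f 1 + f 2 = f 2 + f 0 + f 1)

lemma basis_expand (v : Module.Basis (Fin 3) ℝ V) (i : Fin 3) (x : V) :
    x = v.repr x i • v i + v.repr x (i + 1) • v (i + 1) + v.repr x (i + 2) • v (i + 2) := by
  conv_lhs => rw [← v.sum_repr x]
  exact sum_fin_three_cyclic i fun j => v.repr x j • v j

/-- The structure equations of a Milnor basis, starting from its `i`-th vector. -/
lemma IsMilnorBasis.table (hv : IsMilnorBasis g v l) (i : Fin 3) :
    (g (v i) (v (i + 1)) = 0 ∧ g (v i) (v (i + 2)) = 0 ∧ g (v (i + 1)) (v i) = 0 ∧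
      g (v (i + 1)) (v (i + 2)) = 0 ∧ g (v (i + 2)) (v i) = 0 ∧ g (v (i + 2)) (v (i + 1)) = 0) ∧
    ⁅v (i + 1), v (i + 2)⁆ = (g (v i) (v i) * l i) • v i ∧
    ⁅v (i + 2), v (i + 1)⁆ = -((g (v i) (v i) * l i) • v i) ∧
    ⁅v (i + 2), v i⁆ = (g (v (i + 1)) (v (i + 1)) * l (i + 1)) • v (i + 1) ∧
    ⁅v i, v (i + 2)⁆ = -((g (v (i + 1)) (v (i + 1)) * l (i + 1)) • v (i + 1)) ∧
    ⁅v i, v (i + 1)⁆ = (g (v (i + 2)) (v (i + 2)) * l (i + 2)) • v (i + 2) ∧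
    ⁅v (i + 1), v i⁆ = -((g (v (i + 2)) (v (i + 2)) * l (i + 2)) • v (i + 2)) := by
  obtain ⟨n1, n2, e1, e2, e3, e4⟩ := fin_three_add i
  have n3 : i + 1 ≠ i + 2 := by
    rw [← e1]
    exact (fin_three_add (i + 1)).1
  have h0 := hv.lie i
  have h1 := hv.lie (i + 1)
  have h2 := hv.lie (i + 2)
  rw [e1, e2] at h1
  rw [e3, e4] at h2
  have ho := hv.orthonormal.1
  exact ⟨⟨ho _ _ n1, ho _ _ n2, ho _ _ n1.symm, ho _ _ n3, ho _ _ n2.symm, ho _ _ n3.symm⟩, h0,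
    by rw [← lie_skew, h0], h1, by rw [← lie_skew, h1], h2, by rw [← lie_skew, h2]⟩

/-- Evaluate at `(v_{i+1}, v_{i+2})` and at the swapped pair. The half sum is the Killing equation;
the half difference is the part containing `H`. -/
lemma killing_coords (hv : IsMilnorBasis g v l) {H : V [⋀^Fin 3]→ₗ[ℝ] ℝ} {X : V}
    (hK : ∀ x y, g x ⁅y, X⁆ + g y ⁅x, X⁆ - g X ⁅x, y⁆ + H ![y, x, X] = 0) (i : Fin 3) :
    v.repr X i * (l (i + 1) - l (i + 2)) = 0 ∧
    v.repr X i * (l i + H ![v i, v (i + 1), v (i + 2)]) = 0 := by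
  obtain ⟨⟨g1, g2, g3, g4, g5, g6⟩, b1, b2, b3, b4, b5, b6⟩ := hv.table i
  have s0 := hv.orthonormal.mul_self i
  have s1 := hv.orthonormal.mul_self (i + 1)
  have s2 := hv.orthonormal.mul_self (i + 2)
  have k1 := hK (v (i + 1)) (v (i + 2))
  have k2 := hK (v (i + 2)) (v (i + 1))
  have hX := basis_expand v i X
  set a := v.repr X i
  set b := v.repr X (i + 1)
  set c := v.repr X (i + 2)
  have h1 : H ![v (i + 2), v (i + 1), v i] = -H ![v i, v (i + 1), v (i + 2)] := by
    rw [alternating_three_swap_left, alternating_three_rotate, alternating_three_rotate]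
  have h2 : H ![v (i + 1), v (i + 2), v i] = H ![v i, v (i + 1), v (i + 2)] :=
    (alternating_three_rotate _ _ _ _).symm
  have h3 (x y : V) : H ![x, y, x] = 0 := by
    rw [← alternating_three_rotate, alternating_three_self_left]
  rw [hX] at k1 k2
  simp only [lie_add, lie_smul, map_add, map_smul, LinearMap.add_apply, LinearMap.smul_apply,
    smul_eq_mul, lie_self, map_zero, map_neg, b1, b2, b3, b6, g3, g5, alternating_three_add, alternating_three_smul, h1, h2, h3, alternating_three_self_right]
    at k1 k2
  constructor
  · linear_combination (k1 + k2) / 2 - a * l (i + 1) * s1 + a * l (i + 2) * s2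
  · linear_combination (k2 - k1) / 2 - a * l i * s0

lemma torsion_coords (hv : IsMilnorBasis g v l) {H : V [⋀^Fin 3]→ₗ[ℝ] ℝ}
    {F : V [⋀^Fin 2]→ₗ[ℝ] ℝ} {J : Module.End ℝ V} {Y : V}
    (hT : ∀ x z, g x ⁅Y, z⁆ - g Y ⁅x, z⁆ - g z ⁅x, Y⁆ + H ![Y, x, z] = 2 * F ![J x, z])
    (i : Fin 3) :
    v.repr Y i * (l (i + 2) - l (i + 1) - l i + H ![v i, v (i + 1), v (i + 2)])
      = 2 * F ![J (v (i + 1)), v (i + 2)] ∧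
    v.repr Y i * (l (i + 2) - l (i + 1) + l i - H ![v i, v (i + 1), v (i + 2)])
      = 2 * F ![J (v (i + 2)), v (i + 1)] ∧ F ![J (v i), v i] = 0 := by
  obtain ⟨⟨g1, g2, g3, g4, g5, g6⟩, b1, b2, b3, b4, b5, b6⟩ := hv.table i
  have s0 := hv.orthonormal.mul_self i
  have s1 := hv.orthonormal.mul_self (i + 1)
  have s2 := hv.orthonormal.mul_self (i + 2)
  have k1 := hT (v (i + 1)) (v (i + 2))
  have k2 := hT (v (i + 2)) (v (i + 1))
  have k3 := hT (v i) (v i)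
  have hY := basis_expand v i Y
  set a := v.repr Y i
  set b := v.repr Y (i + 1)
  set c := v.repr Y (i + 2)
  have h1 : H ![v i, v (i + 2), v (i + 1)] = -H ![v i, v (i + 1), v (i + 2)] :=
    alternating_three_swap_right _ _ _ _
  have h3 (x y : V) : H ![x, y, x] = 0 := by
    rw [← alternating_three_rotate, alternating_three_self_left]
  rw [hY] at k1 k2 k3
  simp only [lie_add, lie_smul, add_lie, smul_lie, map_add, map_smul, LinearMap.add_apply,
    LinearMap.smul_apply, smul_eq_mul, lie_self, map_zero, map_neg, b1, b2, b3, b4, b5, b6, g1, g2,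
    g3, g5, alternating_three_add_left, alternating_three_smul_left, h1, h3,
    alternating_three_self_right, alternating_three_self_left] at k1 k2 k3
  refine ⟨?_, ?_, ?_⟩
  · linear_combination k1 + a * l (i + 1) * s1 - a * l (i + 2) * s2 + a * l i * s0
  · linear_combination k2 + a * l (i + 1) * s1 - a * l (i + 2) * s2 - a * l i * s0
  · linear_combination -k3 / 2

/-- The hypothesis says that the Euclidean cross product of `a` and `w` vanishes. -/
lemma exists_cyclic_smul {a w : Fin 3 → ℝ} (ha : a ≠ 0)
    (h : ∀ i, a (i + 1) * w (i + 2) = a (i + 2) * w (i + 1)) : ∃ t, ∀ i, w i = t * a i := by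
  obtain ⟨i, hi⟩ := Function.ne_iff.1 ha
  rw [Pi.zero_apply] at hi
  obtain ⟨-, -, e1, e2, e3, e4⟩ := fin_three_add i
  refine ⟨w i / a i, fun j => ?_⟩
  have h1 := h (i + 1)
  have h2 := h (i + 2)
  rw [e1, e2] at h1
  rw [e3, e4] at h2
  rcases fin_three_cases i j with rfl | rfl | rfl
  · field_simp
  · field_simp
    linarith
  · field_simp
    linarith

/-- The components of `F` and `J` cannot both be nonzero. -/
lemma cyclic_system {a b e l : Fin 3 → ℝ} {h τ : ℝ} (ha : a ≠ 0) (he : ∀ i, e i * e i = 1)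
    (hb : ∑ i, e i * (b i * b i) = 1)
    (hA₁ : ∀ i, a i * (l (i + 1) - l (i + 2)) = 0) (hA₂ : ∀ i, a i * (l i + h) = 0)
    (hB₁ : ∀ i, b i * (l (i + 2) - l (i + 1) - l i + h)
      = 2 * (τ * (e i * b (i + 2) * a (i + 1))))
    (hB₂ : ∀ i, b i * (l (i + 2) - l (i + 1) + l i - h)
      = 2 * (τ * (e i * b (i + 1) * a (i + 2))))
    (hB₃ : ∀ i, τ * (e (i + 1) * b (i + 2) * a (i + 2) + e (i + 2) * b (i + 1) * a (i + 1)) = 0) :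
    τ = 0 := by
  by_contra hτ
  obtain ⟨i, hi⟩ := Function.ne_iff.1 ha
  rw [Pi.zero_apply] at hi
  obtain ⟨-, -, e1, e2, e3, e4⟩ := fin_three_add i
  have c0 := (mul_eq_zero.1 (hB₃ i)).resolve_left hτ
  have c1 := (mul_eq_zero.1 (hB₃ (i + 1))).resolve_left hτ
  have c2 := (mul_eq_zero.1 (hB₃ (i + 2))).resolve_left hτ
  have d1 := hB₂ (i + 1)
  have d2 := hB₁ (i + 2)
  rw [e1, e2] at c1 d1
  rw [e3, e4] at c2 d2
  rw [sum_fin_three_cyclic i] at hb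
  have s0 := he i
  have s1 := he (i + 1)
  have s2 := he (i + 2)
  have hl1 := (mul_eq_zero.1 (hA₁ i)).resolve_left hi
  have hl2 := (mul_eq_zero.1 (hA₂ i)).resolve_left hi
  -- Multiplied by suitable signs, `hB₃` says that the numbers `e_j a_j b_j` have vanishing pairwise
  -- sums, so all of them vanish.
  have hbi : b i = 0 := by
    have : b i * a i = 0 := by
      linear_combination (e (i + 2) * c1 + e (i + 1) * c2 - e (i + 1) * e (i + 2) * e i * c0) / 2
        - b i * a i * (s1 + s2) / 2 + e i * e (i + 2) * (b (i + 2) * a (i + 2)) * s1 / 2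
        + e i * e (i + 1) * (b (i + 1) * a (i + 1)) * s2 / 2
    exact (mul_eq_zero.1 this).resolve_right hi
  have hl3 : l i = -h := by linarith
  have hl4 : l (i + 1) = l (i + 2) := by linarith
  rw [hbi] at hb
  rw [hl3, hl4] at d1 d2
  -- The left sides of `d1` and `d2` are now `-2 h b_{i+1}` and `2 h b_{i+2}`, so weighting them by
  -- `b_{i+2}` and `b_{i+1}` eliminates `h`. As `b i = 0`, the remaining quadratic form is `±g(Y,
  -- Y)`, which contradicts `hb`.
  have hc : (τ * a i) * (e (i + 1) * (b (i + 2) * b (i + 2)) + e (i + 2) * (b (i + 1) * b (i + 1)))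
      = 0 := by
    linear_combination -b (i + 2) * d1 / 2 - b (i + 1) * d2 / 2
  have hc' := (mul_eq_zero.1 hc).resolve_left (mul_ne_zero hτ hi)
  have : (1 : ℝ) = 0 := by
    linear_combination -hb + e (i + 1) * e (i + 2) * hc'
      - e (i + 2) * (b (i + 2) * b (i + 2)) * s1 - e (i + 1) * (b (i + 1) * b (i + 1)) * s2
  exact one_ne_zero this

end Classification

/-! ### Vanishing of `F` and `H`, and the two cases. -/

section Classification

variable {V : Type*} [LieRing V] [LieAlgebra ℝ V] {g : V →ₗ[ℝ] V →ₗ[ℝ] ℝ}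
  {v : Module.Basis (Fin 3) ℝ V} {l : Fin 3 → ℝ}

lemma fin_three_sub : ∀ i : Fin 3, 0 - (1 - i) = i + 2 ∧ 1 - (1 - i) = i ∧ 2 - (1 - i) = i + 1 := by
  decide

lemma IsOrthonormalBasis.apply_eq (hv : IsOrthonormalBasis g v) (x y : V) :
    g x y = ∑ i, g (v i) (v i) * (v.repr x i * v.repr y i) := by
  have h (i : Fin 3) : g x (v i) = g (v i) (v i) * v.repr x i := by
    rw [hv.repr_eq, ← mul_assoc, hv.mul_self, one_mul]
  conv_lhs => rw [← v.sum_repr y]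
  rw [map_sum]
  refine Finset.sum_congr rfl fun i _ => ?_
  rw [map_smul, h, smul_eq_mul]
  ring

lemma repr_ne_zero {X : V} (hX : g X X = 1) : (fun i => v.repr X i) ≠ 0 := by
  intro h
  have : v.repr X = 0 := Finsupp.ext fun i => congrFun h i
  rw [LinearEquiv.map_eq_zero_iff] at this
  simp [this] at hX

lemma alternating_two_eq_zero {F : V [⋀^Fin 2]→ₗ[ℝ] ℝ}
    (h : ∀ i, F ![v (i + 1), v (i + 2)] = 0) : F = 0 := by
  refine v.ext_alternating fun w _ => ?_
  have hw : (fun i => v (w i)) = ![v (w 0), v (w 1)] := by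
    ext i
    fin_cases i <;> rfl
  rw [hw, AlternatingMap.zero_apply]
  rcases fin_three_cases' (w 0) (w 1) with h01 | ⟨k, ⟨h0, h1⟩ | ⟨h0, h1⟩⟩
  · rw [h01, alternating_two_self]
  · rw [h0, h1, h]
  · rw [h0, h1, alternating_two_swap, h, neg_zero]

lemma alternating_three_eq_zero {H : V [⋀^Fin 3]→ₗ[ℝ] ℝ} (h : H ![v 0, v 1, v 2] = 0) :
    H = 0 := by
  have hv : (v : Fin 3 → V) = ![v 0, v 1, v 2] := by
    ext i
    fin_cases i <;> rfl
  rw [H.eq_smul_basis_det v, hv, h, zero_smul]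

lemma alternating_three_cyclic (H : V [⋀^Fin 3]→ₗ[ℝ] ℝ) (i : Fin 3) :
    H ![v i, v (i + 1), v (i + 2)] = H ![v 0, v 1, v 2] := by
  fin_cases i
  · rfl
  · exact (alternating_three_rotate H _ _ _).symm
  · exact ((alternating_three_rotate H _ _ _).trans (alternating_three_rotate H _ _ _)).symm

/-- The torsion equations force `F = 0`. -/
lemma F_eq_zero (hg : IsMetric g) (hv : IsMilnorBasis g v l) {H : V [⋀^Fin 3]→ₗ[ℝ] ℝ}
    {F : V [⋀^Fin 2]→ₗ[ℝ] ℝ} {J : Module.End ℝ V} {X Y : V} (hX : g X X = 1) (hY : g Y Y = 1)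
    (hJ : IsTransverseComplex g J Y) (hFX : ∀ y, F ![y, X] = 0)
    (hK : ∀ x y, g x ⁅y, X⁆ + g y ⁅x, X⁆ - g X ⁅x, y⁆ + H ![y, x, X] = 0)
    (hT : ∀ x z, g x ⁅Y, z⁆ - g Y ⁅x, z⁆ - g z ⁅x, Y⁆ + H ![Y, x, z] = 2 * F ![J x, z]) :
    F = 0 := by
  have ho := hv.orthonormal
  set w : Fin 3 → ℝ := fun i => F ![v (i + 1), v (i + 2)] with hw
  set r : Fin 3 → ℝ := fun i => g (J (v (i + 1))) (v (i + 2)) with hr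
  have hFs (i) : F ![v (i + 2), v (i + 1)] = -w i := alternating_two_swap _ _ _
  have hJs (i) : g (J (v (i + 2))) (v (i + 1)) = -r i := by
    rw [hJ.skew, hg.1]
  have hJ0 (i) : g (J (v i)) (v i) = 0 := by
    have := hJ.skew (v i) (v i)
    rw [hg.1 (v i)] at this
    linarith
  have hw1 (i) : F ![v (i + 2), v i] = w (i + 1) := by
    simp only [hw, (fin_three_add i).2.2.1, (fin_three_add i).2.2.2.1]
  have hw2 (i) : F ![v i, v (i + 1)] = w (i + 2) := by
    simp only [hw, (fin_three_add i).2.2.2.2.1, (fin_three_add i).2.2.2.2.2]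
  have hr1 (i) : g (J (v (i + 2))) (v i) = r (i + 1) := by
    simp only [hr, (fin_three_add i).2.2.1, (fin_three_add i).2.2.2.1]
  have hr2 (i) : g (J (v i)) (v (i + 1)) = r (i + 2) := by
    simp only [hr, (fin_three_add i).2.2.2.2.1, (fin_three_add i).2.2.2.2.2]
  have hw1' (i) : F ![v i, v (i + 2)] = -w (i + 1) := by rw [alternating_two_swap, hw1]
  have hw2' (i) : F ![v (i + 1), v i] = -w (i + 2) := by rw [alternating_two_swap, hw2]
  have hr1' (i) : g (J (v i)) (v (i + 2)) = -r (i + 1) := by rw [hJ.skew, hg.1, hr1]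
  have hr2' (i) : g (J (v (i + 1))) (v i) = -r (i + 2) := by rw [hJ.skew, hg.1, hr2]
  -- In dimension three a two-form annihilated by `X` is a multiple `t` of `i_X vol`. In the same
  -- way the two-form `g(J·, ·)`, annihilated by `Y`, is a multiple `κ` of `i_Y vol`.
  obtain ⟨t, ht⟩ := exists_cyclic_smul (a := fun i => v.repr X i) (w := w) (repr_ne_zero hX)
    fun i => by
      have h := hFX (v i)
      rw [basis_expand v i X] at h
      simp only [alternating_two_add, alternating_two_smul, alternating_two_self, hw2, hw1'] at h
      linarith
  obtain ⟨κ, hκ⟩ := exists_cyclic_smul (a := fun i => v.repr Y i) (w := r) (repr_ne_zero hY)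
    fun i => by
      have h : g (J Y) (v i) = 0 := by rw [hJ.kernel, map_zero, LinearMap.zero_apply]
      rw [basis_expand v i Y] at h
      simp only [map_add, map_smul, LinearMap.add_apply, LinearMap.smul_apply, smul_eq_mul, hJ0,
        hr1, hr2'] at h
      linarith
  -- If `κ = 0` then `J = 0`, and `J² x = -x + g(Y, x) Y` would make every `x` a multiple of `Y`.
  have hκ0 : κ ≠ 0 := by
    rintro rfl
    have hJv (i) : J (v i) = 0 := by
      refine hg.ext_basis v fun j => ?_
      rw [map_zero, LinearMap.zero_apply]
      rcases fin_three_cases i j with rfl | rfl | rfl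
      · exact hJ0 _
      · rw [hr2, hκ, zero_mul]
      · rw [hr1', hκ, zero_mul, neg_zero]
    have h0 := congrArg (fun x => v.repr x) (hJ.square_eq hY (v 0))
    have h1 := congrArg (fun x => v.repr x) (hJ.square_eq hY (v 1))
    simp only [hJv, map_zero, map_add, map_neg, map_smul, Module.Basis.repr_self] at h0 h1
    have h00 := DFunLike.congr_fun h0 0
    have h01 := DFunLike.congr_fun h0 1
    have h11 := DFunLike.congr_fun h1 1
    simp at h00 h01 h11
    rcases h01 with h01 | h01 <;> simp [h01] at h00 h11
  have hrepr (i j) : v.repr (J (v i)) j = g (v j) (v j) * g (J (v i)) (v j) := ho.repr_eq _ _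
  have hFJ1 (i) : F ![J (v (i + 1)), v (i + 2)] = κ * t * (g (v i) (v i) * v.repr Y (i + 2)
      * v.repr X (i + 1)) := by
    rw [basis_expand v i (J (v (i + 1)))]
    simp only [alternating_two_add_left, alternating_two_smul_left, hrepr, hr2', hJ0, hw1',
      alternating_two_self]
    rw [hκ, ht]
    ring
  have hFJ2 (i) : F ![J (v (i + 2)), v (i + 1)] = κ * t * (g (v i) (v i) * v.repr Y (i + 1)
      * v.repr X (i + 2)) := by
    rw [basis_expand v i (J (v (i + 2)))]
    simp only [alternating_two_add_left, alternating_two_smul_left, hrepr, hr1, hJ0, hw2,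
      alternating_two_self]
    rw [hκ, ht]
    ring
  have hFJ3 (i) : F ![J (v i), v i] = -(κ * t * (g (v (i + 1)) (v (i + 1)) * v.repr Y (i + 2)
      * v.repr X (i + 2) + g (v (i + 2)) (v (i + 2)) * v.repr Y (i + 1) * v.repr X (i + 1))) := by
    rw [basis_expand v i (J (v i))]
    simp only [alternating_two_add_left, alternating_two_smul_left, hrepr, hr1', hr2, hw1, hw2',
      alternating_two_self]
    rw [hκ, hκ, ht, ht]
    ring
  -- All values of `F(J·, ·)` carry the factor `κ t`, so the torsion equations become the system
  -- solved in `cyclic_system`, and `κ ≠ 0` leaves `t = 0`.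
  have hτ := cyclic_system (a := fun i => v.repr X i) (b := fun i => v.repr Y i)
    (e := fun i => g (v i) (v i)) (l := l) (h := H ![v 0, v 1, v 2]) (τ := κ * t)
    (repr_ne_zero hX) ho.mul_self (by rw [← ho.apply_eq, hY])
    (fun i => (killing_coords hv hK i).1)
    (fun i => by
      have := (killing_coords hv hK i).2
      rwa [alternating_three_cyclic] at this)
    (fun i => by
      have := (torsion_coords hv hT i).1
      rwa [alternating_three_cyclic, hFJ1] at this)
    (fun i => by
      have := (torsion_coords hv hT i).2.1
      rwa [alternating_three_cyclic, hFJ2] at this)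
    (fun i => by
      have := (torsion_coords hv hT i).2.2
      rwa [hFJ3, neg_eq_zero] at this)
  refine alternating_two_eq_zero (v := v) fun i => ?_
  have := ht i
  rw [(mul_eq_zero.1 hτ).resolve_left hκ0, zero_mul] at this
  exact this

/-- Choose `a i ≠ 0` and `b j ≠ 0`, so `l i = -h` and `l j = h`. If `i = j`, then `h = l i = 0` and
the other two values agree; where they are nonzero, `a` and `b` must vanish. If `i ≠ j`, the two
equalities among the `l` make all of them equal, hence zero. -/
lemma cyclic_classification {a b l : Fin 3 → ℝ} {h : ℝ} (ha : a ≠ 0) (hb : b ≠ 0)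
    (hA₁ : ∀ i, a i * (l (i + 1) - l (i + 2)) = 0) (hA₂ : ∀ i, a i * (l i + h) = 0)
    (hB₁ : ∀ i, b i * (l (i + 1) - l (i + 2)) = 0) (hB₂ : ∀ i, b i * (l i - h) = 0) :
    h = 0 ∧ (l = 0 ∨ ∃ i, l i = 0 ∧ l (i + 1) = l (i + 2) ∧ l (i + 1) ≠ 0 ∧ a (i + 1) = 0 ∧
      a (i + 2) = 0 ∧ b (i + 1) = 0 ∧ b (i + 2) = 0) := by
  obtain ⟨i, hi⟩ := Function.ne_iff.1 ha
  obtain ⟨j, hj⟩ := Function.ne_iff.1 hb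
  rw [Pi.zero_apply] at hi hj
  have p1 := (mul_eq_zero.1 (hA₁ i)).resolve_left hi
  have p2 := (mul_eq_zero.1 (hA₂ i)).resolve_left hi
  have q1 := (mul_eq_zero.1 (hB₁ j)).resolve_left hj
  have q2 := (mul_eq_zero.1 (hB₂ j)).resolve_left hj
  have hext (h0 : l i = 0) (h1 : l (i + 1) = 0) (h2 : l (i + 2) = 0) : l = 0 := by
    funext k
    rcases fin_three_cases i k with rfl | rfl | rfl <;> assumption
  obtain ⟨-, -, e1, e2, e3, e4⟩ := fin_three_add i
  rcases fin_three_cases i j with rfl | rfl | rfl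
  · have hh : h = 0 := by linarith
    refine ⟨hh, ?_⟩
    by_cases hl : l (j + 1) = 0
    · exact Or.inl (hext (by linarith) hl (by linarith))
    · have hl2 : l (j + 2) ≠ 0 := fun h2 => hl (by linarith)
      refine Or.inr ⟨j, by linarith, by linarith, hl, ?_, ?_, ?_, ?_⟩
      · exact (mul_eq_zero.1 (hA₂ (j + 1))).resolve_right (by rwa [hh, add_zero])
      · exact (mul_eq_zero.1 (hA₂ (j + 2))).resolve_right (by rwa [hh, add_zero])
      · exact (mul_eq_zero.1 (hB₂ (j + 1))).resolve_right (by rwa [hh, sub_zero])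
      · exact (mul_eq_zero.1 (hB₂ (j + 2))).resolve_right (by rwa [hh, sub_zero])
  · rw [e1, e2] at q1
    exact ⟨by linarith, Or.inl (hext (by linarith) (by linarith) (by linarith))⟩
  · rw [e3, e4] at q1
    exact ⟨by linarith, Or.inl (hext (by linarith) (by linarith) (by linarith))⟩

lemma IsMilnorBasis.lie_eq_zero (hv : IsMilnorBasis g v l) (hl : l = 0) (x y : V) :
    ⁅x, y⁆ = 0 := by
  have h (i j) : ⁅v i, v j⁆ = 0 := by
    rcases fin_three_cases' i j with rfl | ⟨k, ⟨rfl, rfl⟩ | ⟨rfl, rfl⟩⟩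
    · exact lie_self _
    · rw [hv.lie, hl, Pi.zero_apply, mul_zero, zero_smul]
    · rw [← lie_skew, hv.lie, hl, Pi.zero_apply, mul_zero, zero_smul, neg_zero]
  conv_lhs => rw [← v.sum_repr x, ← v.sum_repr y]
  simp only [Fin.sum_univ_three, add_lie, lie_add, smul_lie, lie_smul, h, smul_zero, add_zero]

lemma IsOrthonormalBasis.unit_multiple (hv : IsOrthonormalBasis g v) {X : V} (hX : g X X = 1)
    {i : Fin 3} (h1 : v.repr X (i + 1) = 0) (h2 : v.repr X (i + 2) = 0) :
    g (v i) (v i) = 1 ∧ (X = v i ∨ X = -v i) := by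
  have hX' := basis_expand v i X
  rw [h1, h2, zero_smul, zero_smul, add_zero, add_zero] at hX'
  set c := v.repr X i
  rw [hX', map_smul, map_smul, LinearMap.smul_apply, smul_eq_mul, smul_eq_mul] at hX
  have hc := mul_self_nonneg c
  have he : g (v i) (v i) = 1 := by
    rcases hv.2 i with h | h
    · exact h
    · rw [h] at hX
      linarith
  refine ⟨he, ?_⟩
  rw [he, mul_one] at hX
  rcases mul_self_eq_one_iff.1 hX with h | h
  · left
    rw [hX', h, one_smul]
  · right
    rw [hX', h, neg_one_smul]

/-- The necessary conditions on the Lie algebra. -/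
theorem classification (hg : IsMetric g) (hv : IsMilnorBasis g v l) {H : V [⋀^Fin 3]→ₗ[ℝ] ℝ}
    {F : V [⋀^Fin 2]→ₗ[ℝ] ℝ} {J : Module.End ℝ V} {X Y : V} (hX : g X X = 1) (hY : g Y Y = 1)
    (hJ : IsTransverseComplex g J Y) (hFX : ∀ y, F ![y, X] = 0)
    (hK : ∀ x y, g x ⁅y, X⁆ + g y ⁅x, X⁆ - g X ⁅x, y⁆ + H ![y, x, X] = 0)
    (hT : ∀ x z, g x ⁅Y, z⁆ - g Y ⁅x, z⁆ - g z ⁅x, Y⁆ + H ![Y, x, z] = 2 * F ![J x, z]) :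
    (CaseNonabelian g Y X ∨ CaseAbelian g Y X) ∧ H = 0 ∧ F = 0 := by
  have hF := F_eq_zero hg hv hX hY hJ hFX hK hT
  have hT' (i) := torsion_coords hv hT i
  simp only [hF, AlternatingMap.zero_apply, mul_zero, alternating_three_cyclic, and_true] at hT'
  obtain ⟨hh, h⟩ := cyclic_classification (a := fun i => v.repr X i) (b := fun i => v.repr Y i)
    (l := l) (h := H ![v 0, v 1, v 2]) (repr_ne_zero hX) (repr_ne_zero hY)
    (fun i => (killing_coords hv hK i).1)
    (fun i => by
      have := (killing_coords hv hK i).2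
      rwa [alternating_three_cyclic] at this)
    (fun i => by linear_combination -((hT' i).1 + (hT' i).2) / 2)
    (fun i => by linear_combination ((hT' i).2 - (hT' i).1) / 2)
  refine ⟨?_, alternating_three_eq_zero hh, hF⟩
  rcases h with hl | ⟨i, hl0, hl1, hl2, hX1, hX2, hY1, hY2⟩
  · exact Or.inr ⟨hv.lie_eq_zero hl, hY, hX⟩
  · left
    obtain ⟨he, hXv⟩ := hv.orthonormal.unit_multiple hX hX1 hX2
    obtain ⟨-, hYv⟩ := hv.orthonormal.unit_multiple hY hY1 hY2
    have hXY : Y = X ∨ Y = -X := by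
      rcases hXv with h | h <;> rcases hYv with h' | h' <;> rw [h, h'] <;> simp
    obtain ⟨s, hs, hXs⟩ : ∃ s : ℝ, s * s = 1 ∧ X = s • v i := by
      rcases hXv with h | h
      · exact ⟨1, by norm_num, by rw [h, one_smul]⟩
      · exact ⟨-1, by norm_num, by rw [h, neg_one_smul]⟩
    obtain ⟨⟨g1, g2, g3, g4, g5, g6⟩, b1, b2, b3, b4, b5, b6⟩ := hv.table i
    have hs0 : s ≠ 0 := fun h => by simp [h] at hs
    have hu (j : Fin 3) : IsUnit (![1, s, 1] j) := by
      fin_cases j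
      · exact isUnit_one
      · exact hs0.isUnit
      · exact isUnit_one
    -- The basis `(v_{i+2}, s v_i, v_{i+1})`: a cyclic shift puts `v_i` in the middle, and the sign
    -- `s` makes the middle vector equal to `X`. Both nonzero brackets acquire the factor `s`,
    -- whence the parameter `s * l (i + 1)`.
    set w := (v.reindex (Equiv.addRight (1 - i))).isUnitSMul hu with hw
    have hwv (j) : w j = ![1, s, 1] j • v (j - (1 - i)) := by
      rw [hw, Module.Basis.isUnitSMul_apply, Module.Basis.reindex_apply,
        Equiv.addRight_symm, Equiv.coe_addRight]
      exact congrArg (fun k => _ • v k) (sub_eq_add_neg _ _).symm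
    have w0 : w 0 = v (i + 2) := by
      rw [hwv, (fin_three_sub i).1]
      simp
    have w1 : w 1 = s • v i := by
      rw [hwv, (fin_three_sub i).2.1]
      simp
    have w2 : w 2 = v (i + 1) := by
      rw [hwv, (fin_three_sub i).2.2]
      simp
    refine ⟨w, s * l (i + 1), ⟨⟨?_, ?_⟩, ?_, mul_ne_zero hs0 hl2, ?_, ?_, ?_⟩, ?_, hXY⟩
    · intro j k hjk
      fin_cases j <;> fin_cases k <;> simp [w0, w1, w2, g1, g2, g3, g4, g5, g6] at hjk ⊢
    · intro j
      fin_cases j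
      · simpa [w0] using hv.orthonormal.2 (i + 2)
      · left
        simp [w1, he, hs]
      · simpa [w2] using hv.orthonormal.2 (i + 1)
    · simp [w1, he, hs]
    · rw [w0, w1, w2, lie_smul, b3, smul_smul]
      ring_nf
    · rw [w0, w2, b1, hl0, mul_zero, zero_smul]
    · rw [w0, w1, w2, smul_lie, b5, smul_smul, hl1]
      ring_nf
    · rw [hXs, w1]

end Classification

/-! ### Transverse complex structures and definiteness on the orthogonal plane. -/

section Definite

variable {V : Type*} [AddCommGroup V] [Module ℝ V] [FiniteDimensional ℝ V] {g : V →ₗ[ℝ] V →ₗ[ℝ] ℝ}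
  {J : Module.End ℝ V} {X : V}

lemma exists_expand_of_linearIndependent (hdim : Module.finrank ℝ V = 3) {a b c : V}
    (h : LinearIndependent ℝ ![a, b, c]) (y : V) :
    ∃ α β γ : ℝ, y = α • a + β • b + γ • c := by
  have htop := h.span_eq_top_of_card_eq_finrank' (by simp [hdim])
  have hy : y ∈ Submodule.span ℝ (Set.range ![a, b, c]) := htop ▸ Submodule.mem_top
  obtain ⟨d, hd⟩ := (Submodule.mem_span_range_iff_exists_fun ℝ).1 hy
  refine ⟨d 0, d 1, d 2, ?_⟩
  rw [← hd, Fin.sum_univ_three]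
  rfl

lemma linearIndependent_three {a b c : V}
    (h : ∀ α β γ : ℝ, α • a + β • b + γ • c = 0 → α = 0 ∧ β = 0 ∧ γ = 0) :
    LinearIndependent ℝ ![a, b, c] := by
  rw [Fintype.linearIndependent_iff]
  intro d hd
  rw [Fin.sum_univ_three] at hd
  obtain ⟨h0, h1, h2⟩ := h _ _ _ hd
  intro i
  fin_cases i <;> assumption

/-- `X`, `x`, `J x` form a basis: a relation `α x + β J x = 0`, combined with its image under `J`,
gives `(α² + β²) x = 0`. -/
lemma IsTransverseComplex.exists_expand (hdim : Module.finrank ℝ V = 3)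
    (hJ : IsTransverseComplex g J X) (hX : g X X = 1) {x : V} (hx : g X x = 0) (hx0 : x ≠ 0)
    {y : V} (hy : g X y = 0) : ∃ α β : ℝ, y = α • x + β • J x := by
  have hJx : g X (J x) = 0 := by
    rw [← neg_eq_zero, ← hJ.skew, hJ.kernel, map_zero, LinearMap.zero_apply]
  obtain ⟨γ, α, β, h⟩ := exists_expand_of_linearIndependent hdim
    (linearIndependent_three (a := X) (b := x) (c := J x) fun γ α β h => by
      have h1 := congrArg (g X) h
      simp only [map_add, map_smul, hX, hx, hJx, smul_eq_mul, mul_one, mul_zero, add_zero,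
        map_zero] at h1
      rw [h1, zero_smul, zero_add] at h
      have h2 := congrArg J h
      simp only [map_add, map_smul, hJ.square x hx, map_zero] at h2
      have h3 : (α * α + β * β) • x = 0 := by
        linear_combination (norm := module) α • h - β • h2
      have h4 := (smul_eq_zero.1 h3).resolve_right hx0
      exact ⟨h1, mul_self_eq_zero.1 (by nlinarith [mul_self_nonneg α, mul_self_nonneg β]),
        mul_self_eq_zero.1 (by nlinarith [mul_self_nonneg α, mul_self_nonneg β])⟩) y
  refine ⟨α, β, ?_⟩
  have h1 := congrArg (g X) h
  simp only [map_add, map_smul, hX, hx, hJx, smul_eq_mul, mul_one, mul_zero, add_zero, hy] at h1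
  rw [h, ← h1, zero_smul, zero_add]

/-- On `X^⊥`, `J` is an isometry with `g(x, J x) = 0`, so `α x + β J x` has square norm `(α² + β²)
g(x, x)` and all signs agree. A null `x` would be orthogonal to `X`, `x` and `J x`, hence zero. -/
theorem IsTransverseComplex.isDefiniteOnPerp (hdim : Module.finrank ℝ V = 3) (hg : IsMetric g)
    (hJ : IsTransverseComplex g J X) (hX : g X X = 1) : IsDefiniteOnPerp g X := by
  have key {x : V} (hx : g X x = 0) (hx0 : x ≠ 0) {y : V} (hy : g X y = 0) (hy0 : y ≠ 0) :
      ∃ t : ℝ, 0 < t ∧ g y y = t * g x x := by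
    obtain ⟨α, β, rfl⟩ := hJ.exists_expand hdim hX hx hx0 hy
    have h1 : g (J x) (J x) = g x x := by
      rw [hJ.skew, hJ.square x hx, map_neg, neg_neg]
    have h2 : g x (J x) = 0 := by
      have h := hJ.skew x x
      rw [hg.1] at h
      linarith
    have h3 : g (J x) x = 0 := by rw [hg.1, h2]
    refine ⟨α * α + β * β, ?_, ?_⟩
    · rcases eq_or_ne α 0 with rfl | hα
      · have hβ : β ≠ 0 := by
          rintro rfl
          simp at hy0
        nlinarith [mul_self_pos.2 hβ]
      · nlinarith [mul_self_pos.2 hα, mul_self_nonneg β]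
    · simp only [map_add, map_smul, LinearMap.add_apply, LinearMap.smul_apply, smul_eq_mul,
        h1, h2, h3]
      ring
  have hne {x : V} (hx : g X x = 0) (hx0 : x ≠ 0) : g x x ≠ 0 := by
    intro h0
    refine hx0 (hg.2 x fun y => ?_)
    have hy : g X (y - g X y • X) = 0 := by simp [hX]
    obtain ⟨α, β, h⟩ := hJ.exists_expand hdim hX hx hx0 hy
    have h2 : g x (J x) = 0 := by
      have h := hJ.skew x x
      rw [hg.1] at h
      linarith
    have h3 := congrArg (g x) h
    simp only [map_sub, map_add, map_smul, smul_eq_mul, h0, h2, hg.1 x X, hx] at h3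
    linarith
  by_cases h : ∃ x, g X x = 0 ∧ x ≠ 0 ∧ 0 < g x x
  · obtain ⟨x, hx, hx0, hpos⟩ := h
    left
    intro y hy hy0
    obtain ⟨t, ht, hyx⟩ := key hx hx0 hy hy0
    rw [hyx]
    exact mul_pos ht hpos
  · right
    intro y hy hy0
    exact lt_of_le_of_ne (not_lt.1 fun hlt => h ⟨y, hy, hy0, hlt⟩) (hne hy hy0)

/-- Two linear conditions on a three-dimensional space have a nonzero common solution, which
definiteness allows to normalize. -/
lemma exists_unit_perp (hdim : Module.finrank ℝ V = 3)
    {δ : ℝ} (hδ : δ * δ = 1) (hd : ∀ x, g X x = 0 → x ≠ 0 → 0 < δ * g x x) (a : V) :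
    ∃ e, g X e = 0 ∧ g a e = 0 ∧ g e e = δ := by
  have hker : LinearMap.ker ((g X).prod (g a)) ≠ ⊥ :=
    LinearMap.ker_ne_bot_of_finrank_lt (by simp [hdim])
  obtain ⟨x, hx, hx0⟩ := Submodule.exists_mem_ne_zero_of_ne_bot hker
  have hx := Prod.ext_iff.1 (LinearMap.mem_ker.1 hx)
  simp only [LinearMap.prod_apply, Function.prod_apply, Prod.fst_zero, Prod.snd_zero] at hx
  have hpos := hd x hx.1 hx0
  have hs := Real.mul_self_sqrt hpos.le
  have hs0 := (Real.sqrt_pos.2 hpos).ne'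
  set s := Real.sqrt (δ * g x x)
  refine ⟨s⁻¹ • x, by simp [hx.1], by simp [hx.2], ?_⟩
  simp only [map_smul, LinearMap.smul_apply, smul_eq_mul]
  field_simp
  linear_combination -δ * hs - g x x * hδ

theorem IsDefiniteOnPerp.exists_isTransverseComplex
    (hdim : Module.finrank ℝ V = 3) (hg : IsMetric g) (hX : g X X = 1)
    (hd : IsDefiniteOnPerp g X) : ∃ J, IsTransverseComplex g J X := by
  obtain ⟨δ, hδ, hd⟩ : ∃ δ : ℝ, δ * δ = 1 ∧ ∀ x, g X x = 0 → x ≠ 0 → 0 < δ * g x x := by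
    rcases hd with h | h
    · exact ⟨1, by norm_num, fun x hx hx0 => by linarith [h x hx hx0]⟩
    · exact ⟨-1, by norm_num, fun x hx hx0 => by linarith [h x hx hx0]⟩
  -- With the vector `0` the second orthogonality condition is void.
  obtain ⟨a, ha, -, haa⟩ := exists_unit_perp hdim hδ hd 0
  obtain ⟨b, hb, hab, hbb⟩ := exists_unit_perp hdim hδ hd a
  have hδ0 : δ ≠ 0 := fun h => by simp [h] at hδ
  have ha' : g a X = 0 := by rw [hg.1, ha]
  have hb' : g b X = 0 := by rw [hg.1, hb]
  have hba : g b a = 0 := by rw [hg.1, hab]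
  have hspan (y : V) : ∃ α β γ : ℝ, y = α • X + β • a + γ • b :=
    exists_expand_of_linearIndependent hdim (linearIndependent_three fun α β γ h => by
      have h1 := congrArg (g X) h
      have h2 := congrArg (g a) h
      have h3 := congrArg (g b) h
      simp only [map_add, map_smul, smul_eq_mul, hX, ha, hb, ha', hb', hab, hba, haa, hbb,
        map_zero, mul_zero, add_zero, zero_add, mul_one] at h1 h2 h3
      exact ⟨h1, (mul_eq_zero.1 h2).resolve_right hδ0, (mul_eq_zero.1 h3).resolve_right hδ0⟩) y
  -- The rotation `a ↦ b ↦ -a` of `X^⊥`; the factor `δ` compensates `g(a, a) = g(b, b) = δ`.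
  refine ⟨δ • ((g a).smulRight b - (g b).smulRight a), ⟨fun x y => ?_, ?_, fun x hx => ?_⟩⟩
  · simp only [LinearMap.smul_apply, LinearMap.sub_apply, LinearMap.smulRight_apply, map_smul,
      map_sub, smul_eq_mul, hg.1 x]
    ring
  · simp [ha', hb']
  · obtain ⟨α, β, γ, rfl⟩ := hspan x
    simp only [map_add, map_smul, smul_eq_mul, hX, ha, hb, mul_one, mul_zero, add_zero] at hx
    simp only [LinearMap.smul_apply, LinearMap.sub_apply, LinearMap.smulRight_apply, map_smul,
      map_sub, map_add, hx, zero_smul, map_zero, zero_add, hab, hba, haa, hbb]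
    linear_combination (norm := module) (-(δ * δ + 1) * hδ) • (β • a + γ • b)

end Definite

/-! ### The bracket of an adapted basis as a rotation by `ad v₂`. -/

section Adapted

variable {V : Type*} [LieRing V] [LieAlgebra ℝ V] {g : V →ₗ[ℝ] V →ₗ[ℝ] ℝ}
  {v : Module.Basis (Fin 3) ℝ V} {r : ℝ}

lemma IsAdaptedBasis.lie_eq (hv : IsAdaptedBasis g v r) (x y : V) :
    ⁅x, y⁆ = (g (v 0) (v 0) * r * (v.repr x 1 * v.repr y 2 - v.repr y 1 * v.repr x 2)) • v 0
      - (g (v 2) (v 2) * r * (v.repr x 1 * v.repr y 0 - v.repr y 1 * v.repr x 0)) • v 2 := by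
  have h0 := hv.lie_two_three
  have h1 := hv.lie_three_one
  have h2 := hv.lie_one_two
  have h0' : ⁅v 2, v 1⁆ = -((g (v 0) (v 0) * r) • v 0) := by rw [← lie_skew, h0]
  have h1' : ⁅v 0, v 2⁆ = 0 := by rw [← lie_skew, h1, neg_zero]
  have h2' : ⁅v 1, v 0⁆ = -((g (v 2) (v 2) * r) • v 2) := by rw [← lie_skew, h2]
  conv_lhs => rw [← v.sum_repr x, ← v.sum_repr y]
  simp only [Fin.sum_univ_three, add_lie, lie_add, smul_lie, lie_smul, lie_self, h0, h1, h2,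
    h0', h1', h2']
  module

lemma IsAdaptedBasis.isMilnorBasis (hv : IsAdaptedBasis g v r) :
    IsMilnorBasis g v ![r, 0, r] := by
  refine ⟨hv.orthonormal, fun i => ?_⟩
  fin_cases i
  · exact hv.lie_two_three
  · exact hv.lie_three_one.trans (by simp)
  · exact hv.lie_one_two

lemma IsAdaptedBasis.repr_one (hv : IsAdaptedBasis g v r) (hg : IsMetric g) (x : V) :
    v.repr x 1 = g (v 1) x := by
  rw [hv.orthonormal.repr_eq, hv.norm_two, one_mul, hg.1]

/-- The form of the bracket required by `dorfman_zero_eq`, with `φ = g(v₂, ·)` and `D = ad v₂`. -/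
lemma IsAdaptedBasis.lie_eq_sub (hv : IsAdaptedBasis g v r) (hg : IsMetric g) (x y : V) :
    ⁅x, y⁆ = g (v 1) x • LieAlgebra.ad ℝ V (v 1) y - g (v 1) y • LieAlgebra.ad ℝ V (v 1) x := by
  rw [LieAlgebra.ad_apply, LieAlgebra.ad_apply, hv.lie_eq x, hv.lie_eq (v 1), hv.lie_eq (v 1),
    ← hv.repr_one hg, ← hv.repr_one hg]
  simp only [Module.Basis.repr_self, Finsupp.single_eq_same, ne_eq, Fin.reduceEq,
    not_false_eq_true, Finsupp.single_eq_of_ne]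
  module

lemma IsAdaptedBasis.ad_skew (hv : IsAdaptedBasis g v r) (hg : IsMetric g) (x y : V) :
    g (LieAlgebra.ad ℝ V (v 1) x) y = -g x (LieAlgebra.ad ℝ V (v 1) y) := by
  rw [LieAlgebra.ad_apply, LieAlgebra.ad_apply, hv.lie_eq (v 1), hv.lie_eq (v 1), hg.1 x]
  have h (x : V) (i : Fin 3) : v.repr x i = g (v i) (v i) * g (v i) x := by
    rw [hv.orthonormal.repr_eq, hg.1 x]
  have h1 : v.repr (v 1) = Finsupp.single 1 1 := v.repr_self 1
  simp only [h1, h x, h y, Finsupp.single_eq_same, ne_eq, Fin.reduceEq, not_false_eq_true,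
    Finsupp.single_eq_of_ne, map_sub, map_smul, LinearMap.sub_apply, LinearMap.smul_apply,
    smul_eq_mul]
  ring

/-- Both endomorphisms are skew and kill `v₂`, and skew endomorphisms of the plane `v₂^⊥` are
multiples of a single one. -/
lemma IsAdaptedBasis.ad_comm (hv : IsAdaptedBasis g v r) (hg : IsMetric g) {J : Module.End ℝ V}
    {X : V} (hJ : IsTransverseComplex g J X) (hX : X = v 1 ∨ X = -v 1) (x : V) :
    LieAlgebra.ad ℝ V (v 1) (J x) = J (LieAlgebra.ad ℝ V (v 1) x) := by
  have hJ1 : J (v 1) = 0 := by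
    rcases hX with rfl | rfl
    · exact hJ.kernel
    · simpa using hJ.kernel
  have hd (i : Fin 3) : g (J (v i)) (v i) = 0 := by
    have h := hJ.skew (v i) (v i)
    rw [hg.1 (v i)] at h
    linarith
  have h1 (i : Fin 3) : g (J (v i)) (v 1) = 0 := by rw [hJ.skew, hJ1, map_zero, neg_zero]
  have h02 := hJ.skew (v 0) (v 2)
  rw [hg.1 (v 0)] at h02
  have hJ0 : J (v 0) = (g (v 2) (v 2) * g (J (v 0)) (v 2)) • v 2 := by
    have h := basis_expand v 0 (J (v 0))
    simp only [hv.orthonormal.repr_eq, hd, h1, zero_add] at h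
    simpa using h
  have hJ2 : J (v 2) = (g (v 0) (v 0) * g (J (v 2)) (v 0)) • v 0 := by
    have h := basis_expand v 0 (J (v 2))
    simp only [hv.orthonormal.repr_eq, hd, h1, zero_add] at h
    simpa [hd] using h
  have h0 : ⁅v 1, v 0⁆ = -((g (v 2) (v 2) * r) • v 2) := by rw [← lie_skew, hv.lie_one_two]
  have key : LieAlgebra.ad ℝ V (v 1) ∘ₗ J = J ∘ₗ LieAlgebra.ad ℝ V (v 1) := by
    refine v.ext fun i => ?_
    fin_cases i
    · simp only [LinearMap.comp_apply, LieAlgebra.ad_apply]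
      change ⁅v 1, J (v 0)⁆ = J ⁅v 1, v 0⁆
      rw [h0, map_neg, map_smul, hJ2, hJ0, lie_smul, hv.lie_two_three, h02]
      module
    · change ⁅v 1, J (v 1)⁆ = J ⁅v 1, v 1⁆
      rw [hJ1, lie_self, lie_zero, map_zero]
    · change ⁅v 1, J (v 2)⁆ = J ⁅v 1, v 2⁆
      rw [hv.lie_two_three, map_smul, hJ2, hJ0, lie_smul, h0, h02]
      module
  exact LinearMap.congr_fun key x

end Adapted

/-! ### Identification with `iso(2)` and `iso(1,1)`. -/

section Iso

attribute [local instance] LieRing.ofAssociativeRing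

variable {V : Type*} [LieRing V] [LieAlgebra ℝ V] {g : V →ₗ[ℝ] V →ₗ[ℝ] ℝ}
  {v : Module.Basis (Fin 3) ℝ V} {r : ℝ}

lemma mem_skewAdjoint_diagonal {s : ℝ} {A : Matrix (Fin 2) (Fin 2) ℝ} :
    A ∈ skewAdjointMatricesLieSubalgebra (Matrix.diagonal ![1, s]) ↔
      A 0 0 = 0 ∧ A 0 1 = -(s * A 1 0) ∧ s * A 1 1 = 0 := by
  rw [mem_skewAdjointMatricesLieSubalgebra, mem_skewAdjointMatricesSubmodule,
    Matrix.IsSkewAdjoint, Matrix.IsAdjointPair, ← Matrix.ext_iff]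
  simp only [Fin.forall_fin_two, Matrix.mul_diagonal, Matrix.diagonal_mul, Matrix.transpose_apply,
    Matrix.neg_apply, Matrix.cons_val_zero, Matrix.cons_val_one]
  constructor
  · rintro ⟨⟨h1, h2⟩, h3, h4⟩
    exact ⟨by linarith, by linarith, by linarith⟩
  · rintro ⟨h1, h2, h3⟩
    exact ⟨⟨by linarith, by linarith⟩, by linarith, by linarith⟩

lemma vectorAction_lie (η : Matrix (Fin 2) (Fin 2) ℝ)
    (x y : LieAlgebra.SemiDirectSum (R := ℝ) (Fin 2 → ℝ) (skewAdjointMatricesLieSubalgebra η)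
      (vectorAction η)) :
    ⁅x, y⁆ = ⟨(x.right : Matrix (Fin 2) (Fin 2) ℝ).mulVec y.left
      - (y.right : Matrix (Fin 2) (Fin 2) ℝ).mulVec x.left, ⁅x.right, y.right⁆⟩ := by
  refine LieAlgebra.SemiDirectSum.ext ?_ rfl
  change ⁅x.left, y.left⁆ + _ - _ = _
  rw [LieRing.of_associative_ring_bracket, mul_comm, sub_self, zero_add]
  rfl

/-- On the abelian ideal spanned by `v 0` and `v 2` the metric is `±diag(1, s)`, and `v 1` acts by a
nonzero skew matrix. For `s ≠ 0` such matrices form a line, so `v 1` corresponds to a generator. -/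
theorem IsAdaptedBasis.nonempty_equiv (hv : IsAdaptedBasis g v r) {s : ℝ}
    (hs : g (v 0) (v 0) * g (v 2) (v 2) = s) {η : Matrix (Fin 2) (Fin 2) ℝ}
    (hη : η = Matrix.diagonal ![1, s]) :
    Nonempty (V ≃ₗ⁅ℝ⁆ LieAlgebra.SemiDirectSum (R := ℝ) (Fin 2 → ℝ)
      (skewAdjointMatricesLieSubalgebra η) (vectorAction η)) := by
  subst hη
  have s0 := hv.orthonormal.mul_self 0
  have s2 := hv.orthonormal.mul_self 2
  have hr := hv.ne_zero
  have he : g (v 2) (v 2) ≠ 0 := fun h => by simp [h] at s2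
  have hs0 : s ≠ 0 := by
    rintro rfl
    have : g (v 0) (v 0) = 0 := (mul_eq_zero.1 hs).resolve_right he
    simp [this] at s0
  -- The matrix of `ad (v 1)` in the basis `v 0`, `v 2` of the ideal.
  let A : skewAdjointMatricesLieSubalgebra (Matrix.diagonal ![1, s]) :=
    ⟨!![0, g (v 0) (v 0) * r; -(g (v 2) (v 2) * r), 0], mem_skewAdjoint_diagonal.2
      ⟨rfl, by
        simp only [Matrix.of_apply, Matrix.cons_val]
        rw [← hs]
        linear_combination -g (v 0) (v 0) * r * s2, by simp⟩⟩
  let f : V →ₗ⁅ℝ⁆ LieAlgebra.SemiDirectSum (R := ℝ) (Fin 2 → ℝ)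
      (skewAdjointMatricesLieSubalgebra (Matrix.diagonal ![1, s])) (vectorAction _) :=
    { toFun x := ⟨![v.repr x 0, v.repr x 2], v.repr x 1 • A⟩
      map_add' x y := by
        ext i
        · fin_cases i <;> simp
        · simp [add_smul]
      map_smul' c x := by
        ext i
        · fin_cases i <;> simp
        · simp [mul_smul]
      map_lie' := by
        intro x y
        rw [hv.lie_eq x y, vectorAction_lie]
        refine LieAlgebra.SemiDirectSum.ext ?_ ?_
        · ext i
          fin_cases i <;> simp [A] <;> ring
        · simp }
  refine ⟨LieEquiv.ofBijective f ⟨?_, ?_⟩⟩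
  · rw [injective_iff_map_eq_zero]
    intro x hx
    obtain ⟨hl, hB⟩ := LieAlgebra.SemiDirectSum.ext_iff.1 hx
    have h0 : v.repr x 0 = 0 := congrFun hl 0
    have h2 : v.repr x 2 = 0 := congrFun hl 1
    have h1 : v.repr x 1 * -(g (v 2) (v 2) * r) = 0 := congrFun₂ (congrArg Subtype.val hB) 1 0
    have h1 := (mul_eq_zero.1 h1).resolve_right (neg_ne_zero.2 (mul_ne_zero he hr))
    rw [basis_expand v 0 x]
    simp [h0, h1, h2]
  · rintro ⟨w, B, hB⟩
    obtain ⟨b0, b1, b2⟩ := mem_skewAdjoint_diagonal.1 hB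
    have b2 := (mul_eq_zero.1 b2).resolve_left hs0
    refine ⟨w 0 • v 0 + (B 1 0 / -(g (v 2) (v 2) * r)) • v 1 + w 1 • v 2, ?_⟩
    refine LieAlgebra.SemiDirectSum.ext ?_ ?_
    · ext i
      fin_cases i <;> simp [f]
    · ext i j
      fin_cases i <;> fin_cases j <;> simp [f, A, b0, b1, b2]
      · rw [← hs]
        field_simp
        linear_combination B 1 0 * g (v 0) (v 0) * s2
      · field_simp

end Iso

/-! ### Assembly of the two directions. -/

section Existence

variable {G : Type*} [TopologicalSpace G] [ChartedSpace (EuclideanSpace ℝ (Fin 3)) G] [Group G]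
  [LieGroup (𝓡 3) ∞ G]
  {g : GroupLieAlgebra (𝓡 3) G →ₗ[ℝ] GroupLieAlgebra (𝓡 3) G →ₗ[ℝ] ℝ}
  {Jp Jm : Module.End ℝ (GroupLieAlgebra (𝓡 3) G)} {Xp Xm : GroupLieAlgebra (𝓡 3) G}

lemma norm_eq_one {V : Type*} [LieRing V] [LieAlgebra ℝ V] {g : V →ₗ[ℝ] V →ₗ[ℝ] ℝ} {Xp Xm : V}
    (h : CaseNonabelian g Xp Xm ∨ CaseAbelian g Xp Xm) : g Xp Xp = 1 ∧ g Xm Xm = 1 := by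
  rcases h with ⟨v, r, hv, rfl, rfl | rfl⟩ | ⟨-, h⟩
  · exact ⟨hv.norm_two, hv.norm_two⟩
  · simpa using hv.norm_two
  · exact h

theorem exists_isPseudoKahler_of_case (hg : IsMetric g)
    (h : CaseNonabelian g Xp Xm ∨ CaseAbelian g Xp Xm) (hp : IsTransverseComplex g Jp Xp)
    (hm : IsTransverseComplex g Jm Xm) :
    ∃ 𝒢 𝓕 : G → Module.End ℝ (Fiber 3 G),
      IsPseudoKahler 0 0 𝒢 𝓕 ∧ HasComponents 𝒢 𝓕 g Jp Jm Xp Xm := by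
  obtain ⟨hXp, hXm⟩ := norm_eq_one h
  rcases h with ⟨v, r, hv, hXm1, hXp1⟩ | ⟨hb, -⟩
  · have hX : Xp = v 1 ∨ Xp = -v 1 := by rwa [hXm1] at hXp1
    refine exists_isPseudoKahler hg hp hm hXp hXm (hv.lie_eq_sub hg) (hv.ad_skew hg)
      (hv.ad_comm hg hp hX) (hv.ad_comm hg hm (Or.inl hXm1)) ?_
    rcases hX with rfl | rfl <;> simp
  · exact exists_isPseudoKahler hg hp hm hXp hXm (φ := 0) (D := 0) (by simp [hb]) (by simp)
      (by simp) (by simp) (by simp)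

theorem exists_canonicalOperator_of_case (hg : IsMetric g)
    (h : CaseNonabelian g Xp Xm ∨ CaseAbelian g Xp Xm) :
    ∃ L, IsCanonicalOperator g L ∧ IsDiagonalizable L := by
  rcases h with ⟨v, r, hv, -⟩ | ⟨hb, -⟩
  · exact hv.isMilnorBasis.exists_canonicalOperator
  · obtain ⟨v, hv⟩ := hg.exists_orthonormal (finrank_groupLieAlgebra (n := 3) (G := G))
    exact IsMilnorBasis.exists_canonicalOperator (l := 0) ⟨hv, by simp [hb]⟩

theorem IsPseudoKahler.classification (hG : IsUnimodular (GroupLieAlgebra (𝓡 3) G))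
    {H : GroupLieAlgebra (𝓡 3) G [⋀^Fin 3]→ₗ[ℝ] ℝ} {F : GroupLieAlgebra (𝓡 3) G [⋀^Fin 2]→ₗ[ℝ] ℝ}
    {𝒢 𝓕 : G → Module.End ℝ (Fiber 3 G)} (hk : IsPseudoKahler H F 𝒢 𝓕)
    (hc : HasComponents 𝒢 𝓕 g Jp Jm Xp Xm)
    (hL : ∃ L, IsCanonicalOperator g L ∧ IsDiagonalizable L) :
    (CaseNonabelian g Xp Xm ∨ CaseAbelian g Xp Xm) ∧ H = 0 ∧ F = 0 := by
  obtain ⟨L, hL, hd⟩ := hL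
  obtain ⟨v, l, hv⟩ := exists_milnorBasis (finrank_groupLieAlgebra (n := 3) (G := G)) hG hc.metric hL hd
  have hK (x y) := hk.killing hc x y
  refine BnGeometry.classification hc.metric hv hc.norm_minus (hk.norm_plus hc).1
    (hk.transverse_plus hc) (fun y => ?_) (fun x y => ?_) (hk.torsion_plus hc)
  -- The Killing identity is affine in the scalar `a`; its linear coefficient is `2 F(y, X₋)`.
  · linear_combination (hK 0 y 1 - hK 0 y 0) / 2
  · linear_combination hK x y 0

end Existence

end BnGeometry

end

theorem mainTheorem9 {G : Type*} [TopologicalSpace G]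
    [ChartedSpace (EuclideanSpace ℝ (Fin 3)) G] [Group G] [LieGroup (𝓡 3) ∞ G]
    (hG : BnGeometry.IsUnimodular (GroupLieAlgebra (𝓡 3) G)) :
    -- the components of left-invariant structures with diagonalizable canonical operator
    (∀ (H : GroupLieAlgebra (𝓡 3) G [⋀^Fin 3]→ₗ[ℝ] ℝ)
        (F : GroupLieAlgebra (𝓡 3) G [⋀^Fin 2]→ₗ[ℝ] ℝ)
        (g : GroupLieAlgebra (𝓡 3) G →ₗ[ℝ] GroupLieAlgebra (𝓡 3) G →ₗ[ℝ] ℝ)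
        (Jp Jm : Module.End ℝ (GroupLieAlgebra (𝓡 3) G))
        (Xp Xm : GroupLieAlgebra (𝓡 3) G),
      ((∃ 𝒢 𝓕 : G → Module.End ℝ (BnGeometry.Fiber 3 G),
          BnGeometry.IsPseudoKahler H F 𝒢 𝓕 ∧
          BnGeometry.HasComponents 𝒢 𝓕 g Jp Jm Xp Xm) ∧
        ∃ L, BnGeometry.IsCanonicalOperator g L ∧ BnGeometry.IsDiagonalizable L) ↔
      (BnGeometry.IsMetric g ∧
        (BnGeometry.CaseNonabelian g Xp Xm ∨ BnGeometry.CaseAbelian g Xp Xm) ∧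
        H = 0 ∧ F = 0 ∧
        BnGeometry.IsTransverseComplex g Jp Xp ∧ BnGeometry.IsTransverseComplex g Jm Xm)) ∧
    -- existence of a left-invariant structure with given metric and vector fields
    (∀ (g : GroupLieAlgebra (𝓡 3) G →ₗ[ℝ] GroupLieAlgebra (𝓡 3) G →ₗ[ℝ] ℝ)
        (Xp Xm : GroupLieAlgebra (𝓡 3) G),
      ((∃ (H : GroupLieAlgebra (𝓡 3) G [⋀^Fin 3]→ₗ[ℝ] ℝ)
          (F : GroupLieAlgebra (𝓡 3) G [⋀^Fin 2]→ₗ[ℝ] ℝ)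
          (Jp Jm : Module.End ℝ (GroupLieAlgebra (𝓡 3) G))
          (𝒢 𝓕 : G → Module.End ℝ (BnGeometry.Fiber 3 G)),
          BnGeometry.IsPseudoKahler H F 𝒢 𝓕 ∧
          BnGeometry.HasComponents 𝒢 𝓕 g Jp Jm Xp Xm) ∧
        ∃ L, BnGeometry.IsCanonicalOperator g L ∧ BnGeometry.IsDiagonalizable L) ↔
      (BnGeometry.IsMetric g ∧
        (BnGeometry.CaseNonabelian g Xp Xm ∨ BnGeometry.CaseAbelian g Xp Xm) ∧
        BnGeometry.IsDefiniteOnPerp g Xp ∧ BnGeometry.IsDefiniteOnPerp g Xm)) ∧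
    -- the isomorphism type of the Lie algebra in the non-abelian case
    (∀ (g : GroupLieAlgebra (𝓡 3) G →ₗ[ℝ] GroupLieAlgebra (𝓡 3) G →ₗ[ℝ] ℝ)
        (v : Module.Basis (Fin 3) ℝ (GroupLieAlgebra (𝓡 3) G)) (r : ℝ),
      BnGeometry.IsAdaptedBasis g v r →
      (g (v 0) (v 0) * g (v 2) (v 2) = 1 →
        Nonempty (GroupLieAlgebra (𝓡 3) G ≃ₗ⁅ℝ⁆ BnGeometry.Iso2)) ∧
      (g (v 0) (v 0) * g (v 2) (v 2) = -1 →
        Nonempty (GroupLieAlgebra (𝓡 3) G ≃ₗ⁅ℝ⁆ BnGeometry.Iso11))) := by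
  refine ⟨fun H F g Jp Jm Xp Xm => ⟨?_, ?_⟩, fun g Xp Xm => ⟨?_, ?_⟩, fun g v r hv => ⟨?_, ?_⟩⟩
  · rintro ⟨⟨𝒢, 𝓕, hk, hc⟩, hL⟩
    obtain ⟨h, hH, hF⟩ := hk.classification hG hc hL
    exact ⟨hc.metric, h, hH, hF, hk.transverse_plus hc, hk.transverse_minus hc⟩
  · rintro ⟨hg, h, rfl, rfl, hp, hm⟩
    exact ⟨BnGeometry.exists_isPseudoKahler_of_case hg h hp hm,
      BnGeometry.exists_canonicalOperator_of_case hg h⟩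
  · rintro ⟨⟨H, F, Jp, Jm, 𝒢, 𝓕, hk, hc⟩, hL⟩
    have h := (hk.classification hG hc hL).1
    obtain ⟨hp, hm⟩ := BnGeometry.norm_eq_one h
    exact ⟨hc.metric, h,
      (hk.transverse_plus hc).isDefiniteOnPerp BnGeometry.finrank_groupLieAlgebra hc.metric hp,
      (hk.transverse_minus hc).isDefiniteOnPerp BnGeometry.finrank_groupLieAlgebra hc.metric hm⟩
  · rintro ⟨hg, h, hdp, hdm⟩
    obtain ⟨hp, hm⟩ := BnGeometry.norm_eq_one h
    obtain ⟨Jp, hJp⟩ :=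
      hdp.exists_isTransverseComplex BnGeometry.finrank_groupLieAlgebra hg hp
    obtain ⟨Jm, hJm⟩ :=
      hdm.exists_isTransverseComplex BnGeometry.finrank_groupLieAlgebra hg hm
    exact ⟨⟨0, 0, Jp, Jm, BnGeometry.exists_isPseudoKahler_of_case hg h hJp hJm⟩,
      BnGeometry.exists_canonicalOperator_of_case hg h⟩
  · intro hs
    refine hv.nonempty_equiv hs ?_
    rw [← Matrix.diagonal_one]
    congr 1
    ext i
    fin_cases i <;> rfl
  · intro hs
    exact hv.nonempty_equiv hs rfl
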